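/- Let $d\ge 2$, $I=[0,1]$ and $\triangle=\{x\in I^d : x_1\le x_2\le\dots\le x_d\}$. For $1\le i\le d$ let $$q_i(dt)=\frac{(1-t)^{d-i}\,t^{i-1}}{(d-i)!\,(i-1)!}\,\mathbf 1_I(t)\,dt$$ be the $i$-th marginal of Lebesgue measure on $\triangle$. For $k\in\mathbb N$ let $$\varphi_{i,k}(t)=\sqrt{\frac{(2k+d)\,k!\,(k+d-1)!}{(k+d-i)!\,(k+i-1)!}}\;\sqrt{(d-i)!\,(i-1)!}\;P_k^{(d-i,i-1)}(2t-1),\qquad t\in I,$$ where $P_k^{(\alpha,\beta)}(t)=\frac{(-1)^k}{2^k k!\,w(t)}\frac{d^k}{dt^k}\big[w(t)(1-t^2)^k\big]$, $w(t)=(1-t)^\alpha(1+t)^\beta$, are the Jacobi polynomials (so $(\varphi_{i,k})_{k}$ are the orthonormal polynomials of $L^2(q_i)$). For $r\in\mathbb N$, $r\ge1$, let $W^2_r(q_i)$ be the set of $h\in L^2(q_i)$ (functions modulo null sets) such that $h^{(r-1)}$ exists and is absolutely continuous on $I$ and $h^{(r)}\in L^2(q_i)$. For $m=(m_1,\dots,m_d)\in(\mathbb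 N^*)^d$ put $|m|=\sum_i m_i$, $\varphi_m(x)=(\varphi_{i,k}(x_i))_{1\le i\le d,\,1\le k\le m_i}\in\mathbb R^{|m|}$ and, for $\theta\in\mathbb R^{|m|}$, $$f_\theta=\exp\big(\theta\cdot\varphi_m-\psi(\theta)\big)\mathbf 1_\triangle,\qquad \psi(\theta)=\log\int_\triangle \exp(\theta\cdot\varphi_m),\qquad A_m(\theta)=\int_\triangle\varphi_m f_\theta .$$ **Theorem.** Let $f^0$ be a probability density on $\triangle$ of product form: there are bounded measurable functions $\ell^0_i$ on $I$ with $\int_I\ell_i^0\,q_i=0$, $1\le i\le d$, such that $f^0(x)=\exp\big(\sum_{i}\ell^0_i(x_i)-\mathrm a_0\big)$ for a.e. $x\in\triangle$, where $\mathrm a_0=\log\int_\triangle\exp\big(\sum_i\ell_i^0(x_i)\big)dx$. Assume $\ell^0_i\in W^2_{r_i}(q_i)$ with $r_i\in\mathbb N$, $r_i>d$, for all $i$. Let $X^1,X^2,\dots$ be i.i.d. random vectors with density $f^0$, and let $m=m(n)\in(\mathbb N^*)^d$, $n\ge1$, satisfy $m_i(n)\to\infty$ for every $i$, $$|m|^{2d}\sum_{i=1}^d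 m_i^{-2r_i}\to0\qquad\text{and}\qquad \frac{|m|^{2d+1}}{n}\to0\qquad(n\to\infty).$$ Then: 1. For all sufficiently large $n$, almost surely, the likelihood equations $A_m(\theta)=\frac1n\sum_{j=1}^n\varphi_m(X^j)$ have exactly one solution $\theta=\hat\theta_{m,n}\in\mathbb R^{|m|}$. Put $\hat f_{m,n}=f_{\hat\theta_{m,n}}$, with the convention $\hat\theta_{m,n}=0$ whenever the equations have no solution. 2. The Kullback--Leibler divergence $\mathrm{KL}(f^0\|\hat f_{m,n})=\int_\triangle f^0\log(f^0/\hat f_{m,n})\in[0,\infty]$ converges to $0$ in probability, with the rate $$\mathrm{KL}(f^0\|\hat f_{m,n})=O_{\mathbb P}\Big(\sum_{i=1}^d m_i^{-2r_i}+\frac{|m|}{n}\Big).$$ Here $Y_n=O_{\mathbb P}(a_n)$ means that for every $\varepsilon>0$ there is $C_\varepsilon>0$ with $\mathbb P(|Y_n/a_n|>C_\varepsilon)<\varepsilon$ for all $n\ge1$. -/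

import Mathlib

open MeasureTheory ProbabilityTheory Filter Topology Set
open scoped ENNReal Nat

noncomputable section

namespace AdditiveExpSeries

/-! ### The simplex, its marginals and product-form densities.
Coordinates are indexed by `Fin d`, so `i : Fin d` is the coordinate of number `i + 1`. -/

/-- The simplex `{x ∈ [0,1]^d : x_1 ≤ ... ≤ x_d}`. -/
def simplex (d : ℕ) : Set (Fin d → ℝ) :=
  {x | (∀ i, x i ∈ Icc (0 : ℝ) 1) ∧ Monotone x}

/-- Lebesgue measure on the simplex (total mass `1 / d!`). -/
def leb (d : ℕ) : Measure (Fin d → ℝ) := volume.restrict (simplex d)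

/-- The one-dimensional marginal, in coordinate `i`, of Lebesgue measure on the simplex:
`(1 - t)^(d - (i+1)) t^((i+1) - 1) / ((d - (i+1))! ((i+1) - 1)!) dt` on `[0,1]`. -/
def marginal (d : ℕ) (i : Fin d) : Measure ℝ :=
  (volume.restrict (Icc (0 : ℝ) 1)).withDensity fun t =>
    ENNReal.ofReal ((1 - t) ^ (d - 1 - (i : ℕ)) * t ^ (i : ℕ) / ((d - 1 - (i : ℕ))! * (i : ℕ)!))

/-- `f` is a probability density on the simplex (with respect to Lebesgue measure). -/
structure IsProbDensity {d : ℕ} (f : (Fin d → ℝ) → ℝ) : Prop where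
  aemeasurable : AEMeasurable f (leb d)
  nonneg : ∀ᵐ x ∂(leb d), 0 ≤ f x
  lintegral_eq_one : ∫⁻ x, ENNReal.ofReal (f x) ∂(leb d) = 1

/-- The measure with density `f` on the simplex. -/
def densityMeasure {d : ℕ} (f : (Fin d → ℝ) → ℝ) : Measure (Fin d → ℝ) :=
  (leb d).withDensity fun x => ENNReal.ofReal (f x)

/-- The probability density `f` on the simplex has the product form
`f(x) = exp(∑ i, ℓ_i(x_i) - a)` for almost every `x` in the simplex, where the `ℓ_i` are bounded
measurable functions on `[0,1]`, centred for the marginals, and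
`a = log ∫ exp(∑ i, ℓ_i(x_i)) dx` is the normalising constant. -/
structure IsProductForm {d : ℕ} (f : (Fin d → ℝ) → ℝ) (ℓ : Fin d → ℝ → ℝ) : Prop where
  isProbDensity : IsProbDensity f
  measurable : ∀ i, Measurable ((Icc (0 : ℝ) 1).domRestrict (ℓ i))
  bounded : ∀ i, ∃ C : ℝ, ∀ t ∈ Icc (0 : ℝ) 1, |ℓ i t| ≤ C
  centered : ∀ i, ∫ t, ℓ i t ∂(marginal d i) = 0
  eq_exp : ∀ᵐ x ∂(leb d),
    f x = Real.exp ((∑ i, ℓ i (x i)) - Real.log (∫ y, Real.exp (∑ i, ℓ i (y i)) ∂(leb d)))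

/-- The Sobolev space `W^2_r(q)` on `[0,1]`, for `r ≥ 1`: functions `h` in `L^2(q)` which have
(as a class modulo null sets) a version `g` on `[0,1]` whose derivative of order `r - 1` exists
and is absolutely continuous, and whose derivative of order `r`, which then exists almost
everywhere, is in `L^2(q)`. -/
def sobolev (q : Measure ℝ) (r : ℕ) : Set (ℝ → ℝ) :=
  {h | MemLp h 2 q ∧ ∃ g : ℝ → ℝ, h =ᵐ[volume.restrict (Icc (0 : ℝ) 1)] g ∧
    ContDiffOn ℝ (r - 1 : ℕ) g (Icc 0 1) ∧
    AbsolutelyContinuousOnInterval (iteratedDerivWithin (r - 1) g (Icc 0 1)) 0 1 ∧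
    MemLp (iteratedDerivWithin r g (Icc 0 1)) 2 q}

/-! ### Jacobi polynomials and the orthonormal basis. -/

open Polynomial in
/-- The Jacobi polynomial `P_k^(α,β)` for natural `α, β`, by Rodrigues' formula
`P_k(t) = (-1)^k / (2^k k! w(t)) * (d/dt)^k [w(t) (1 - t^2)^k]` with
`w(t) = (1 - t)^α (1 + t)^β`; the division by `w` is exact, see `jacobi_rodrigues`. -/
def jacobi (α β k : ℕ) : ℝ[X] :=
  C ((-1) ^ k / (2 ^ k * (k ! : ℝ))) *
    ((derivative^[k] ((1 - X) ^ α * (1 + X) ^ β * (1 - X ^ 2) ^ k)) /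
      ((1 - X) ^ α * (1 + X) ^ β))

open Polynomial in
theorem jacobi_rodrigues (α β k : ℕ) :
    ((1 - X) ^ α * (1 + X) ^ β) * jacobi α β k =
      C ((-1) ^ k / (2 ^ k * (k ! : ℝ))) *
        derivative^[k] ((1 - X) ^ α * (1 + X) ^ β * (1 - X ^ 2) ^ k) := by
  have hfac : ((1 - X) ^ α * (1 + X) ^ β * (1 - X ^ 2) ^ k : ℝ[X]) =
      (1 - X) ^ (α + k) * (1 + X) ^ (β + k) := by
    have : (1 - X ^ 2 : ℝ[X]) = (1 - X) * (1 + X) := by ring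
    rw [this, mul_pow]; ring
  have hcop : IsCoprime ((1 - X) ^ α : ℝ[X]) ((1 + X) ^ β) := by
    apply IsCoprime.pow
    refine ⟨C (1 / 2), C (1 / 2), ?_⟩
    have h2 : (C (1 / 2) : ℝ[X]) * 2 = 1 := by
      rw [show (2 : ℝ[X]) = C 2 from rfl, ← C_mul]; norm_num
    linear_combination h2
  have hdvd : ((1 - X) ^ α * (1 + X) ^ β : ℝ[X]) ∣
      derivative^[k] ((1 - X) ^ α * (1 + X) ^ β * (1 - X ^ 2) ^ k) := by
    apply hcop.mul_dvd
    · have := pow_sub_dvd_iterate_derivative_of_pow_dvd k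
        (Dvd.intro _ hfac.symm : ((1 - X : ℝ[X])) ^ (α + k) ∣ _)
      simpa using this
    · have := pow_sub_dvd_iterate_derivative_of_pow_dvd k
        (Dvd.intro_left _ hfac.symm : ((1 + X : ℝ[X])) ^ (β + k) ∣ _)
      simpa using this
  rw [jacobi, mul_left_comm, EuclideanDomain.mul_div_cancel' _ hdvd]
  intro h0
  have := congrArg (Polynomial.eval 0) h0
  simp at this

/-- `φ_{i,k}(t) = ρ_{i,k} √((d-i)! (i-1)!) P_k^(d-i,i-1)(2t - 1)` with
`ρ_{i,k} = √((2k+d) k! (k+d-1)! / ((k+d-i)! (k+i-1)!))` (`i` numbered from `1` here):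
the polynomials orthonormal for the marginal. -/
def phi (d : ℕ) (i : Fin d) (k : ℕ) (t : ℝ) : ℝ :=
  √((2 * k + d : ℝ) * (k ! : ℝ) * ((k + d - 1)! : ℝ) /
      (((k + (d - 1 - (i : ℕ)))! : ℝ) * ((k + (i : ℕ))! : ℝ))) *
    √(((d - 1 - (i : ℕ))! : ℝ) * ((i : ℕ)! : ℝ)) *
    (jacobi (d - 1 - (i : ℕ)) (i : ℕ) k).eval (2 * t - 1)

/-! ### The additive exponential series model and its maximum likelihood estimator. -/

/-- Index set of the parameter: pairs `(i, k)`, where `k : Fin (m i)` stands for degree `k + 1`. -/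
abbrev Idx {d : ℕ} (m : Fin d → ℕ) : Type := (i : Fin d) × Fin (m i)

/-- The vector `φ_m(x) = (φ_{i,k}(x_i))`, for `1 ≤ k ≤ m_i`. -/
def phiVec {d : ℕ} (m : Fin d → ℕ) (x : Fin d → ℝ) : Idx m → ℝ :=
  fun p => phi d p.1 ((p.2 : ℕ) + 1) (x p.1)

/-- `ψ(θ) = log ∫ exp(θ · φ_m)`, the integral being over the simplex. -/
def psi {d : ℕ} (m : Fin d → ℕ) (θ : Idx m → ℝ) : ℝ :=
  Real.log (∫ x, Real.exp (θ ⬝ᵥ phiVec m x) ∂(leb d))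

/-- The density `f_θ = exp(θ · φ_m - ψ(θ))` on the simplex, extended by zero. -/
def expDensity {d : ℕ} (m : Fin d → ℕ) (θ : Idx m → ℝ) : (Fin d → ℝ) → ℝ :=
  (simplex d).indicator fun x => Real.exp (θ ⬝ᵥ phiVec m x - psi m θ)

/-- The mean map `A_m(θ) = ∫ φ_m f_θ`. -/
def meanMap {d : ℕ} (m : Fin d → ℕ) (θ : Idx m → ℝ) : Idx m → ℝ :=
  fun p => ∫ x, phiVec m x p * expDensity m θ x ∂(leb d)

open Classical in
/-- The inverse of `A_m` on its range, extended by `0` outside the range. -/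
def meanMapInv {d : ℕ} (m : Fin d → ℕ) (α : Idx m → ℝ) : Idx m → ℝ :=
  if h : ∃ θ, meanMap m θ = α then h.choose else 0

/-- The empirical mean of `φ_m` over a sample of size `n`. -/
def empMean {d : ℕ} (m : Fin d → ℕ) {n : ℕ} (x : Fin n → Fin d → ℝ) : Idx m → ℝ :=
  (n : ℝ)⁻¹ • ∑ j, phiVec m (x j)

/-- The parameter of the maximum likelihood estimator: the solution `θ` of the likelihood
equations `A_m(θ) = (empirical mean)`, and `0` by convention if there is none. -/
def mleParam {d : ℕ} (m : Fin d → ℕ) {n : ℕ} (x : Fin n → Fin d → ℝ) : Idx m → ℝ :=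
  meanMapInv m (empMean m x)

/-- The maximum likelihood estimator of the density. -/
def mleDensity {d : ℕ} (m : Fin d → ℕ) {n : ℕ} (x : Fin n → Fin d → ℝ) : (Fin d → ℝ) → ℝ :=
  expDensity m (mleParam m x)

/-- Kullback-Leibler divergence of two densities on the simplex, with values in `[0,∞]`. -/
def klDensity {d : ℕ} (g h : (Fin d → ℝ) → ℝ) : ℝ≥0∞ :=
  InformationTheory.klDiv (densityMeasure g) (densityMeasure h)

/-- `Y_n = O_P(a_n)`, `n ≥ 1`, for `[0,∞]`-valued `Y_n` and a positive sequence `a`. -/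
def IsBigOInProbability {Ω : Type*} [MeasurableSpace Ω] (P : Measure Ω)
    (Y : ℕ → Ω → ℝ≥0∞) (a : ℕ → ℝ) : Prop :=
  ∀ ε : ℝ, 0 < ε → ∃ C : ℝ, 0 < C ∧ ∀ n : ℕ, 1 ≤ n →
    P {ω | ENNReal.ofReal C < Y n ω / ENNReal.ofReal (a n)} < ENNReal.ofReal ε

end AdditiveExpSeries

end

open AdditiveExpSeries

/-! The model is an exponential family over Lebesgue measure on the simplex. Hence any solution of
the likelihood equations minimises the convex function ψ(θ) - θ·α, with α the empirical mean, while
the divergence of the true law ν from f_θ equals, up to a constant, the same function with α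
replaced by the mean of φ_m under ν. The solution is compared with a deterministic θ̄ whose
log-density approximates ∑ ℓ_i. Let δ be the L²(ν) approximation error and ζ the noise in u·α
relative to the standard deviation of u·φ_m, uniformly in u. While a centred log-density ratio stays
below 1 in absolute value, divergence and variance are comparable (`tiltDiv_bounds`). On the L²(ν)
sphere of radius 20(δ + ζ) about θ̄ the quadratic growth then beats the linear noise, and convexity
traps the minimiser inside (`tiltDiv_minimiser_le`). The argument needs B(δ + ζ) small, where B
compares uniform and L² norms on the model.

Three estimates supply the constants.

B is of order |m|^d (`exists_oscillation_le`). The ordering constraint makes the coordinates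
dependent, so the L² norm of an additive function does not split into norms of its components.
However, two points of the simplex that differ only in coordinate i see only the increment of
component i, and the slices at heights s and t share a set of volume at least a constant times
w(s)w(t) (`le_volume_slice_inter`). A Nikolskii inequality for the weight w then turns mean square
increments into uniform ones.

δ² is of order ∑ m_i^(-2r_i) (`exists_polynomial_approx`). Expansion in eigenpolynomials of the
Jacobi operator gains a factor 1/m per derivative, and each derivative is measured in a weight whose
two exponents have grown by one. Uniform smallness of the error follows by summing dyadic
differences with Nikolskii's inequality, which converges because r_i > d.

ζ² is of order |m|/n (`measure_exists_deviation_le`), by Markov's inequality for the quadratic form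
of the inverse covariance matrix. With these values, smallness of B²(δ² + ζ²) is what the two limit
assumptions on m provide.

Solvability (`existsUnique_meanMap_eq`): a direction separating α from the support would make every
observation an interior maximum of an additive polynomial, so derivatives of degree below n would
have n distinct roots. The features φ_{i,k} enter only through their degrees: with the constants
they span all polynomials of degree at most m_i. Finally, the bound in probability is required for
every n, so the finitely many small n are handled by tightness (`exists_measure_klDensity_lt`). -/

namespace AdditiveExpSeries

/-! ### Markov and Nikolskii inequalities -/

open Polynomial in
/-- Markov's inequality at an end point of a segment. -/
theorem abs_eval_derivative_mul_le {p : ℝ[X]} {n : ℕ} (hp : p.natDegree ≤ n) {M x y : ℝ}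
    (hM : 0 < M) (hb : ∀ t ∈ uIcc x y, |p.eval t| ≤ M) :
    |p.derivative.eval y| * |y - x| ≤ 2 * n ^ 2 * M := by
  set l : ℝ[X] := C ((y - x) / 2) * X + C ((x + y) / 2)
  -- The affine map l sends -1 to x and 1 to y, and T_n has the largest derivative at 1, namely n²,
  -- among polynomials of degree at most n bounded by 1 on [-1,1]. The two signs s give both halves
  -- of the absolute value; the factor 2 in the result comes from l' = (y - x)/2.
  have key : ∀ s : ℝ, |s| = 1 →
      (C (s / M) * p.comp l).derivative.eval 1 ≤ (n : ℝ) ^ 2 := by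
    intro s hs
    have h := Polynomial.Chebyshev.eval_iterate_derivative_le_of_forall_abs_le_one (n := n)
      (P := C (s / M) * p.comp l) (k := 1) (x := 1) le_rfl ?_ ?_
    · simpa [Polynomial.Chebyshev.derivative_T_eval_one] using h
    · apply degree_le_of_natDegree_le
      refine (natDegree_C_mul_le _ _).trans (natDegree_comp_le.trans ?_)
      have : l.natDegree ≤ 1 := natDegree_linear_le
      nlinarith
    · intro t ht
      have hmem : (y - x) / 2 * t + (x + y) / 2 ∈ uIcc x y := by
        have h1 : (y - x) / 2 * t + (x + y) / 2 = x + ((1 + t) / 2) • (y - x) := by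
          simp only [smul_eq_mul]; ring
        rw [h1, ← segment_eq_uIcc]
        exact segment_eq_image' ℝ x y ▸ ⟨(1 + t) / 2, ⟨by linarith [ht.1], by linarith [ht.2]⟩, rfl⟩
      have := hb _ hmem
      simp only [l, eval_mul, eval_C, eval_comp, eval_add, eval_X, abs_mul, abs_div, hs,
        abs_of_pos hM]
      rw [div_mul_eq_mul_div, one_mul, div_le_one hM]
      exact this
  have e : ∀ s : ℝ, (C (s / M) * p.comp l).derivative.eval 1 =
      s / M * (p.derivative.eval y * ((y - x) / 2)) := by
    intro s
    have hl : l.eval 1 = y := by simp [l]; ring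
    have hl' : l.derivative = C ((y - x) / 2) := by simp [l]
    rw [derivative_C_mul, derivative_comp, hl']
    simp only [eval_mul, eval_C, eval_comp, hl]
    ring
  have h1 := key 1 (by simp)
  have h2 := key (-1) (by simp)
  rw [e] at h1 h2
  rw [← abs_mul, abs_le]
  have e1 : 1 / M * (p.derivative.eval y * ((y - x) / 2)) * (2 * M) =
      p.derivative.eval y * (y - x) := by field_simp
  have h1' := mul_le_mul_of_nonneg_right h1 (by positivity : 0 ≤ 2 * M)
  have h2' := mul_le_mul_of_nonneg_right h2 (by positivity : 0 ≤ 2 * M)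
  have e2 : -1 / M * (p.derivative.eval y * ((y - x) / 2)) * (2 * M) =
      -(p.derivative.eval y * (y - x)) := by field_simp
  constructor <;> nlinarith

open Polynomial in
/-- Markov's inequality on `[0,1]`. -/
theorem abs_eval_derivative_le {p : ℝ[X]} {n : ℕ} (hp : p.natDegree ≤ n) {M : ℝ}
    (hM : 0 < M) (hb : ∀ t ∈ Icc (0 : ℝ) 1, |p.eval t| ≤ M) {t : ℝ} (ht : t ∈ Icc (0 : ℝ) 1) :
    |p.derivative.eval t| ≤ 4 * n ^ 2 * M := by
  -- Every t is an end point of a subsegment of [0,1] of length at least 1/2, which costs a factor 2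
  -- in the end point inequality.
  have key : ∀ x ∈ Icc (0 : ℝ) 1, 1 / 2 ≤ |t - x| → |p.derivative.eval t| ≤ 4 * n ^ 2 * M := by
    intro x hx hxt
    have h := abs_eval_derivative_mul_le hp (x := x) (y := t) hM fun s hs =>
      hb s (uIcc_subset_Icc hx ht hs)
    nlinarith [abs_nonneg (p.derivative.eval t)]
  rcases le_total t (1 / 2) with h | h
  · exact key 1 (by simp) (by rw [abs_of_nonpos] <;> linarith)
  · exact key 0 (by simp) (by rw [abs_of_nonneg] <;> linarith)

/-- The Jacobi weight on `[0,1]`. -/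
def wt (a b : ℕ) (t : ℝ) : ℝ := t ^ a * (1 - t) ^ b

theorem continuous_wt (a b : ℕ) : Continuous (wt a b) := by unfold wt; fun_prop

theorem wt_nonneg {a b : ℕ} {t : ℝ} (ht : t ∈ Icc (0 : ℝ) 1) : 0 ≤ wt a b t :=
  mul_nonneg (pow_nonneg ht.1 _) (pow_nonneg (by linarith [ht.2]) _)

theorem wt_le_one {a b : ℕ} {t : ℝ} (ht : t ∈ Icc (0 : ℝ) 1) : wt a b t ≤ 1 :=
  mul_le_one₀ (pow_le_one₀ ht.1 ht.2) (pow_nonneg (by linarith [ht.2]) _)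
    (pow_le_one₀ (by linarith [ht.2]) (by linarith [ht.1]))

theorem wt_pos {a b : ℕ} {t : ℝ} (ht : t ∈ Ioo (0 : ℝ) 1) : 0 < wt a b t :=
  mul_pos (pow_pos ht.1 _) (pow_pos (by linarith [ht.2]) _)

theorem wt_one_sub (a b : ℕ) (t : ℝ) : wt a b (1 - t) = wt b a t := by
  simp [wt, mul_comm]

open Polynomial in
theorem exists_forall_abs_eval_le (p : ℝ[X]) :
    ∃ t₀ ∈ Icc (0 : ℝ) 1, ∀ t ∈ Icc (0 : ℝ) 1, |p.eval t| ≤ |p.eval t₀| := by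
  obtain ⟨t₀, h₀, h⟩ := isCompact_Icc.exists_isMaxOn (nonempty_Icc.2 zero_le_one)
    (p.continuous.abs.continuousOn (s := Icc (0 : ℝ) 1))
  exact ⟨t₀, h₀, fun t ht => h ht⟩

open Polynomial in
-- By Markov's inequality p keeps half of its maximal size on an interval of length of order n⁻²
-- beside the maximum point. Taking this interval to the right of t₀ ≤ 1/2 keeps it away from 1; the
-- weight there is at worst of order n^(-2a), and the length contributes the remaining n⁻².
theorem nikolskii_aux {p : ℝ[X]} {n a b D : ℕ} (hn : 1 ≤ n) (hp : p.natDegree ≤ n)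
    (ha : a + 1 ≤ D) (hb : b + 1 ≤ D) {t₀ : ℝ} (h₀ : t₀ ∈ Icc (0 : ℝ) 1) (h₀' : t₀ ≤ 1 / 2)
    (hmax : ∀ t ∈ Icc (0 : ℝ) 1, |p.eval t| ≤ |p.eval t₀|) :
    p.eval t₀ ^ 2 ≤ 4 * 64 ^ D * (n : ℝ) ^ (2 * D) *
      ∫ t in (0 : ℝ)..1, p.eval t ^ 2 * wt a b t := by
  set M := |p.eval t₀| with hM
  have hn' : (1 : ℝ) ≤ n := by exact_mod_cast hn
  have hn2 : (1 : ℝ) ≤ (n : ℝ) ^ 2 := one_le_pow₀ hn'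
  rcases (abs_nonneg (p.eval t₀)).eq_or_lt with h0 | hpos
  · rw [abs_eq_zero.1 h0.symm]
    have : 0 ≤ ∫ t in (0 : ℝ)..1, p.eval t ^ 2 * wt a b t :=
      intervalIntegral.integral_nonneg zero_le_one fun t ht =>
        mul_nonneg (sq_nonneg _) (wt_nonneg ht)
    rw [zero_pow two_ne_zero]
    positivity
  set η : ℝ := 1 / (8 * (n : ℝ) ^ 2) with hη
  have hη0 : 0 < η := by positivity
  have hη8 : η ≤ 1 / 8 := by
    rw [hη]; gcongr; linarith
  have hηn : 4 * (n : ℝ) ^ 2 * M * η = M / 2 := by rw [hη]; field_simp; ring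
  -- Only the right half of [t₀, t₀ + η] is used: t₀ may be 0, where t^a vanishes, whereas here t ≥
  -- η/2.
  have hsub : Icc (t₀ + η / 2) (t₀ + η) ⊆ Icc (0 : ℝ) 1 := fun t ht =>
    ⟨by linarith [h₀.1, ht.1], by linarith [ht.2]⟩
  have hlow : ∀ t ∈ Icc (t₀ + η / 2) (t₀ + η),
      (M / 2) ^ 2 * ((η / 2) ^ a * (1 / 4) ^ b) ≤ p.eval t ^ 2 * wt a b t := by
    intro t ht
    have hd : |p.eval t - p.eval t₀| ≤ 4 * n ^ 2 * M * |t - t₀| := by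
      have := (convex_Icc (0 : ℝ) 1).norm_image_sub_le_of_norm_deriv_le (f := fun x => p.eval x)
        (C := 4 * n ^ 2 * M) (fun x _ => p.differentiableAt) (fun x hx => by
          rw [Polynomial.deriv]; exact abs_eval_derivative_le hp hpos hmax hx) h₀ (hsub ht)
      simpa using this
    have h1 : |t - t₀| ≤ η := by
      rw [abs_of_nonneg] <;> linarith [ht.1, ht.2]
    have h2 : M / 2 ≤ |p.eval t| := by
      have h3 : |p.eval t₀| - |p.eval t| ≤ |p.eval t - p.eval t₀| := by
        rw [abs_sub_comm]; exact abs_sub_abs_le_abs_sub _ _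
      have h4 : 4 * n ^ 2 * M * |t - t₀| ≤ 4 * n ^ 2 * M * η := by gcongr
      linarith
    rw [← sq_abs (p.eval t), wt]
    have : η / 2 ≤ t := by linarith [ht.1, h₀.1]
    have : 1 / 4 ≤ 1 - t := by linarith [ht.2]
    gcongr
    · have := hsub ht; exact pow_nonneg this.1 _
  have hint : (η / 2) * ((M / 2) ^ 2 * ((η / 2) ^ a * (1 / 4) ^ b)) ≤
      ∫ t in (0 : ℝ)..1, p.eval t ^ 2 * wt a b t := by
    have hc : Continuous fun t => p.eval t ^ 2 * wt a b t :=
      (p.continuous.pow 2).mul (continuous_wt a b)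
    calc (η / 2) * ((M / 2) ^ 2 * ((η / 2) ^ a * (1 / 4) ^ b))
        = ∫ _ in (t₀ + η / 2)..(t₀ + η), (M / 2) ^ 2 * ((η / 2) ^ a * (1 / 4) ^ b) := by
          rw [intervalIntegral.integral_const, smul_eq_mul]; ring
      _ ≤ ∫ t in (t₀ + η / 2)..(t₀ + η), p.eval t ^ 2 * wt a b t :=
          intervalIntegral.integral_mono_on (by linarith) (by simp)
            (hc.intervalIntegrable _ _) hlow
      _ ≤ _ := intervalIntegral.integral_mono_interval (by linarith [h₀.1]) (by linarith)
            (by linarith) (by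
              filter_upwards [ae_restrict_mem measurableSet_Ioc] with t ht
              exact mul_nonneg (sq_nonneg _) (wt_nonneg ⟨ht.1.le, ht.2⟩))
            (hc.intervalIntegrable _ _)
  -- The exponents a + 1 and b are both at most D and the bases are below 1, so one D serves for
  -- both ends; 64 is 16 · 4.
  have hw : (1 / (16 * (n : ℝ) ^ 2)) ^ D * (1 / 4) ^ D ≤ (η / 2) * ((η / 2) ^ a * (1 / 4) ^ b) := by
    have e : η / 2 = 1 / (16 * (n : ℝ) ^ 2) := by rw [hη]; field_simp; norm_num
    rw [← e, ← mul_assoc, ← pow_succ']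
    exact mul_le_mul (pow_le_pow_of_le_one (by linarith) (by linarith) ha)
      (pow_le_pow_of_le_one (by norm_num) (by norm_num) (by omega)) (by positivity) (by positivity)
  have e3 : (1 / (16 * (n : ℝ) ^ 2)) ^ D * (1 / 4) ^ D * (64 ^ D * (n : ℝ) ^ (2 * D)) = 1 := by
    rw [pow_mul, ← mul_pow, ← mul_pow, ← mul_pow]
    have : 1 / (16 * (n : ℝ) ^ 2) * (1 / 4) * (64 * (n : ℝ) ^ 2) = 1 := by field_simp; norm_num
    rw [this, one_pow]
  calc p.eval t₀ ^ 2 = M ^ 2 := (sq_abs _).symm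
    _ = 4 * (64 ^ D * (n : ℝ) ^ (2 * D)) *
        ((M / 2) ^ 2 * ((1 / (16 * (n : ℝ) ^ 2)) ^ D * (1 / 4) ^ D)) := by
        linear_combination (-M ^ 2) * e3
    _ ≤ 4 * (64 ^ D * (n : ℝ) ^ (2 * D)) *
        ((M / 2) ^ 2 * ((η / 2) * ((η / 2) ^ a * (1 / 4) ^ b))) := by gcongr
    _ ≤ 4 * (64 ^ D * (n : ℝ) ^ (2 * D)) *
        ∫ t in (0 : ℝ)..1, p.eval t ^ 2 * wt a b t := by
        gcongr
        refine le_trans (le_of_eq ?_) hint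
        ring
    _ = _ := by ring

theorem integral_comp_one_sub (f : ℝ → ℝ) :
    ∫ t in (0 : ℝ)..1, f (1 - t) = ∫ t in (0 : ℝ)..1, f t := by
  rw [intervalIntegral.integral_comp_sub_left]; simp

open Polynomial in
/-- A Nikolskii inequality for Jacobi weights. -/
theorem sq_eval_le_integral {p : ℝ[X]} {n a b D : ℕ} (hn : 1 ≤ n) (hp : p.natDegree ≤ n)
    (ha : a + 1 ≤ D) (hb : b + 1 ≤ D) {t : ℝ} (ht : t ∈ Icc (0 : ℝ) 1) :
    p.eval t ^ 2 ≤ 4 * 64 ^ D * (n : ℝ) ^ (2 * D) *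
      ∫ t in (0 : ℝ)..1, p.eval t ^ 2 * wt a b t := by
  obtain ⟨t₀, h₀, hmax⟩ := exists_forall_abs_eval_le p
  refine (sq_le_sq.2 (hmax t ht)).trans ?_
  rcases le_total t₀ (1 / 2) with h | h
  · exact nikolskii_aux hn hp ha hb h₀ h hmax
  -- Reflection t ↦ 1 - t brings the maximum point to the left half and exchanges the exponents.
  · set q : ℝ[X] := p.comp (1 - X)
    have hq : ∀ s, q.eval s = p.eval (1 - s) := fun s => by simp [q]
    have hqd : q.natDegree ≤ n := by
      refine natDegree_comp_le.trans ?_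
      have : (1 - X : ℝ[X]).natDegree ≤ 1 := by compute_degree
      nlinarith
    have := nikolskii_aux (p := q) (t₀ := 1 - t₀) hn hqd hb ha
      ⟨by linarith [h₀.2], by linarith [h₀.1]⟩ (by linarith) (fun s hs => by
        rw [hq, hq]; simpa using hmax (1 - s) ⟨by linarith [hs.2], by linarith [hs.1]⟩)
    rw [← integral_comp_one_sub]
    simpa [hq, wt_one_sub] using this

end AdditiveExpSeries

namespace AdditiveExpSeries

/-! ### Jacobi eigenpolynomials and weighted approximation of Sobolev functions -/

/-- Eigenvalues of the Jacobi operator on `[0,1]`. -/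
noncomputable def jacEig (a b k : ℕ) : ℝ := k * (k + a + b + 1)

theorem jacEig_lt {a b j k : ℕ} (h : j < k) : jacEig a b j < jacEig a b k := by
  have : (j : ℝ) < k := by exact_mod_cast h
  unfold jacEig
  have hj : (0 : ℝ) ≤ j := by positivity
  have ha : (0 : ℝ) ≤ a := by positivity
  have hb : (0 : ℝ) ≤ b := by positivity
  nlinarith

/-- Coefficients of the eigenpolynomials of the Jacobi operator. -/
noncomputable def jacCoeff (a b k : ℕ) : ℕ → ℝ
  | 0 => 1
  | j + 1 => jacCoeff a b k j * (jacEig a b j - jacEig a b k) / ((j + 1) * (j + 1 + a))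

theorem jacCoeff_ne_zero {a b k j : ℕ} (h : j ≤ k) : jacCoeff a b k j ≠ 0 := by
  induction j with
  | zero => simp [jacCoeff]
  | succ j ih =>
    have h1 := sub_ne_zero.2 (jacEig_lt (a := a) (b := b) (show j < k by omega)).ne
    have h2 := ih (by omega)
    rw [jacCoeff]
    positivity

theorem jacCoeff_eq_zero {a b k j : ℕ} (h : k < j) : jacCoeff a b k j = 0 := by
  induction j with
  | zero => omega
  | succ j ih =>
    rw [jacCoeff]
    rcases (Nat.lt_succ_iff.1 h).eq_or_lt with h | h
    · simp [h]
    · simp [ih h]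

open Polynomial in
/-- Eigenpolynomial of degree `k` of the Jacobi operator on `[0,1]`. -/
noncomputable def jacPoly (a b k : ℕ) : ℝ[X] := ∑ j ∈ Finset.range (k + 1), monomial j (jacCoeff a b k j)

open Polynomial in
theorem coeff_jacPoly (a b k n : ℕ) : (jacPoly a b k).coeff n = jacCoeff a b k n := by
  simp only [jacPoly, finsetSum_coeff, coeff_monomial, Finset.sum_ite_eq', Finset.mem_range]
  split_ifs with h
  · rfl
  · exact (jacCoeff_eq_zero (by omega)).symm

open Polynomial in
theorem natDegree_jacPoly (a b k : ℕ) : (jacPoly a b k).natDegree = k := by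
  apply le_antisymm
  · rw [natDegree_le_iff_coeff_eq_zero]
    intro n hn
    rw [coeff_jacPoly, jacCoeff_eq_zero hn]
  · apply le_natDegree_of_ne_zero
    rw [coeff_jacPoly]
    exact jacCoeff_ne_zero le_rfl

open Polynomial in
theorem jacPoly_ne_zero (a b k : ℕ) : jacPoly a b k ≠ 0 := fun h => by
  have := coeff_jacPoly a b k k
  rw [h, coeff_zero] at this
  exact jacCoeff_ne_zero le_rfl this.symm

open Polynomial in
-- The hypergeometric equation t(1-t)y'' + (a+1 - (a+b+2)t)y' + λ_k y = 0. Comparing coefficients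
-- gives exactly the recursion defining `jacCoeff`; the degrees 0 and 1 are separate because of the
-- shifts by X and X².
theorem jacPoly_ode (a b k : ℕ) :
    X * derivative (derivative (jacPoly a b k)) -
      X * (X * derivative (derivative (jacPoly a b k))) +
      (C (a + 1 : ℝ) * derivative (jacPoly a b k) -
        C (a + b + 2 : ℝ) * (X * derivative (jacPoly a b k))) +
      C (jacEig a b k) * jacPoly a b k = 0 := by
  have hrec : ∀ n : ℕ, (n + 1) * (n + 1 + a) * jacCoeff a b k (n + 1) =
      jacCoeff a b k n * (jacEig a b n - jacEig a b k) := by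
    intro n
    rw [jacCoeff]
    field_simp
  ext n
  rcases n with _ | _ | n
  · have := hrec 0
    simp only [coeff_add, coeff_sub, coeff_C_mul, coeff_X_mul_zero, coeff_derivative,
      coeff_jacPoly, coeff_zero]
    simp [jacEig] at this ⊢
    linear_combination this
  · have := hrec 1
    simp only [coeff_add, coeff_sub, coeff_C_mul, coeff_X_mul, coeff_X_mul_zero, coeff_derivative,
      coeff_jacPoly, coeff_zero]
    simp [jacEig] at this ⊢
    linear_combination this
  · have := hrec (n + 2)
    simp only [coeff_add, coeff_sub, coeff_C_mul, coeff_X_mul, coeff_derivative,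
      coeff_jacPoly, coeff_zero]
    simp [jacEig] at this ⊢
    linear_combination this

open Polynomial in
-- Sturm-Liouville form of the equation, obtained by multiplying `jacPoly_ode` by the weight.
theorem derivative_wt_mul_derivative_jacPoly (a b k : ℕ) :
    derivative (X ^ (a + 1) * (1 - X) ^ (b + 1) * derivative (jacPoly a b k)) =
      -(C (jacEig a b k) * (X ^ a * (1 - X) ^ b * jacPoly a b k)) := by
  have h := jacPoly_ode a b k
  simp only [derivative_mul, derivative_pow, derivative_sub, derivative_one,
    derivative_X]
  simp only [map_add, map_natCast, map_one, map_ofNat, Nat.add_sub_cancel, Nat.cast_add,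
    Nat.cast_one] at h ⊢
  linear_combination (X ^ a * (1 - X) ^ b) * h

theorem absolutelyContinuousOnInterval_eval (p : Polynomial ℝ) :
    AbsolutelyContinuousOnInterval (fun t => p.eval t) 0 1 := by
  have h : ContDiff ℝ 1 fun t : ℝ => Polynomial.aeval t p := Polynomial.contDiff_aeval p 1
  simp only [← Polynomial.coe_aeval_eq_eval]
  exact h.contDiffOn.absolutelyContinuousOnInterval

/-- Integration by parts against an eigenpolynomial. -/
theorem jacEig_mul_integral {a b : ℕ} (k : ℕ) {u : ℝ → ℝ}
    (hu : AbsolutelyContinuousOnInterval u 0 1) :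
    jacEig a b k * ∫ t in (0 : ℝ)..1, u t * (jacPoly a b k).eval t * wt a b t =
      ∫ t in (0 : ℝ)..1, deriv u t * (jacPoly a b k).derivative.eval t * wt (a + 1) (b + 1) t := by
  set F : Polynomial ℝ := Polynomial.X ^ (a + 1) * (1 - Polynomial.X) ^ (b + 1) *
    (jacPoly a b k).derivative with hF
  have hFac : AbsolutelyContinuousOnInterval (fun t => F.eval t) 0 1 :=
    absolutelyContinuousOnInterval_eval F
  have h := hu.integral_mul_deriv_eq_deriv_mul hFac
  -- The weight with raised exponents vanishes at both ends, so there is no boundary term and u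
  -- needs no boundary condition.
  have h0 : F.eval 0 = 0 := by simp [hF]
  have h1 : F.eval 1 = 0 := by simp [hF]
  rw [h0, h1] at h
  have e1 : ∀ t, u t * deriv (fun t => F.eval t) t =
      -(jacEig a b k) * (u t * (jacPoly a b k).eval t * wt a b t) := by
    intro t
    rw [Polynomial.deriv, hF, derivative_wt_mul_derivative_jacPoly]
    simp [wt]
    ring
  have e2 : ∀ t, deriv u t * F.eval t =
      deriv u t * (jacPoly a b k).derivative.eval t * wt (a + 1) (b + 1) t := by
    intro t; simp [hF, wt]; ring
  simp_rw [e1, e2] at h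
  rw [intervalIntegral.integral_const_mul] at h
  linarith

/-- Integration by parts against either factor gives the same symmetric form in the derivatives, and
the eigenvalues differ. -/
theorem integral_jacPoly_mul_eq_zero {a b j k : ℕ} (hjk : j ≠ k) :
    ∫ t in (0 : ℝ)..1, (jacPoly a b j).eval t * (jacPoly a b k).eval t * wt a b t = 0 := by
  have h1 := jacEig_mul_integral (a := a) (b := b) k
    (absolutelyContinuousOnInterval_eval (jacPoly a b j))
  have h2 := jacEig_mul_integral (a := a) (b := b) j
    (absolutelyContinuousOnInterval_eval (jacPoly a b k))
  simp_rw [Polynomial.deriv] at h1 h2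
  have e1 : ∀ t, (jacPoly a b k).eval t * (jacPoly a b j).eval t * wt a b t =
    (jacPoly a b j).eval t * (jacPoly a b k).eval t * wt a b t := fun t => by ring
  have e2 : ∀ t, (jacPoly a b k).derivative.eval t * (jacPoly a b j).derivative.eval t *
      wt (a + 1) (b + 1) t = (jacPoly a b j).derivative.eval t *
      (jacPoly a b k).derivative.eval t * wt (a + 1) (b + 1) t := fun t => by ring
  simp_rw [e1, e2] at h2
  rw [← h2] at h1
  have : jacEig a b k - jacEig a b j ≠ 0 := by
    rcases lt_or_gt_of_ne hjk with h | h
    · exact sub_ne_zero.2 (jacEig_lt h).ne'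
    · exact sub_ne_zero.2 (jacEig_lt h).ne
  exact (mul_eq_zero.1 (by linear_combination h1 :
    (jacEig a b k - jacEig a b j) * ∫ t in (0 : ℝ)..1,
      (jacPoly a b j).eval t * (jacPoly a b k).eval t * wt a b t = 0)).resolve_left this

theorem integral_sq_mul_wt_pos {p : Polynomial ℝ} (hp : p ≠ 0) (a b : ℕ) :
    0 < ∫ t in (0 : ℝ)..1, p.eval t ^ 2 * wt a b t := by
  have hc : Continuous fun t => p.eval t ^ 2 * wt a b t :=
    (p.continuous.pow 2).mul (continuous_wt a b)
  refine intervalIntegral.integral_pos zero_lt_one hc.continuousOn (fun t ht =>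
    mul_nonneg (sq_nonneg _) (wt_nonneg ⟨ht.1.le, ht.2⟩)) ?_
  by_contra! h
  refine hp (Polynomial.eq_zero_of_infinite_isRoot p ((Ioo_infinite zero_lt_one).mono ?_))
  intro t ht
  have h1 := le_antisymm (h t ⟨ht.1.le, ht.2.le⟩)
    (mul_nonneg (sq_nonneg _) (wt_nonneg ⟨ht.1.le, ht.2.le⟩))
  rcases mul_eq_zero.1 h1 with h2 | h2
  · exact pow_eq_zero_iff two_ne_zero |>.1 h2
  · exact absurd h2 (wt_pos ht).ne'

/-- Orthonormal eigenpolynomials of the Jacobi operator. -/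
theorem exists_orthonormal_eigenpoly (a b : ℕ) : ∃ e : ℕ → Polynomial ℝ,
    (∀ k, (e k).natDegree = k ∧ e k ≠ 0) ∧
    (∀ j k, ∫ t in (0 : ℝ)..1, (e j).eval t * (e k).eval t * wt a b t = if j = k then 1 else 0) ∧
    ∀ k (u : ℝ → ℝ), AbsolutelyContinuousOnInterval u 0 1 →
      jacEig a b k * ∫ t in (0 : ℝ)..1, u t * (e k).eval t * wt a b t =
      ∫ t in (0 : ℝ)..1, deriv u t * (e k).derivative.eval t * wt (a + 1) (b + 1) t := by
  set N : ℕ → ℝ := fun k => ∫ t in (0 : ℝ)..1, (jacPoly a b k).eval t ^ 2 * wt a b t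
  have hN : ∀ k, 0 < N k := fun k => integral_sq_mul_wt_pos (jacPoly_ne_zero a b k) a b
  have hs : ∀ k, (√(N k))⁻¹ ≠ 0 := fun k => inv_ne_zero (Real.sqrt_pos.2 (hN k)).ne'
  refine ⟨fun k => Polynomial.C (√(N k))⁻¹ * jacPoly a b k, fun k => ⟨?_, ?_⟩, fun j k => ?_,
    fun k u hu => ?_⟩
  · rw [Polynomial.natDegree_C_mul (hs k), natDegree_jacPoly]
  · exact mul_ne_zero (Polynomial.C_ne_zero.2 (hs k)) (jacPoly_ne_zero a b k)
  · have e : ∀ t, (Polynomial.C (√(N j))⁻¹ * jacPoly a b j).eval t *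
        (Polynomial.C (√(N k))⁻¹ * jacPoly a b k).eval t * wt a b t =
        (√(N j))⁻¹ * (√(N k))⁻¹ * ((jacPoly a b j).eval t * (jacPoly a b k).eval t * wt a b t) := by
      intro t; simp; ring
    simp_rw [e, intervalIntegral.integral_const_mul]
    split_ifs with h
    · subst h
      simp_rw [← sq]
      rw [inv_pow, Real.sq_sqrt (hN j).le]
      exact inv_mul_cancel₀ (hN j).ne'
    · rw [integral_jacPoly_mul_eq_zero h, mul_zero]
  · have h := jacEig_mul_integral (a := a) (b := b) k hu
    have e1 : ∀ t, u t * (Polynomial.C (√(N k))⁻¹ * jacPoly a b k).eval t * wt a b t =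
        (√(N k))⁻¹ * (u t * (jacPoly a b k).eval t * wt a b t) := by
      intro t; simp; ring
    have e2 : ∀ t, deriv u t * (Polynomial.C (√(N k))⁻¹ * jacPoly a b k).derivative.eval t *
        wt (a + 1) (b + 1) t =
        (√(N k))⁻¹ * (deriv u t * (jacPoly a b k).derivative.eval t * wt (a + 1) (b + 1) t) := by
      intro t; simp; ring
    simp_rw [e1, e2, intervalIntegral.integral_const_mul]
    rw [← h]; ring

end AdditiveExpSeries

/-! ### First-order approximation by projection on the Jacobi eigenpolynomials. -/

namespace AdditiveExpSeries

/-- Serves two orthogonal systems: the eigenpolynomials with μ = 1, and their derivatives with μ the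
eigenvalues. Square integrability of f is asked only against w, since the derivative of an
absolutely continuous function need not be square integrable without weight. -/
theorem integral_sub_sum_sq_mul {f w : ℝ → ℝ} {g : ℕ → ℝ → ℝ} {μ : ℕ → ℝ}
    (hf : IntervalIntegrable f volume 0 1)
    (hf2 : IntervalIntegrable (fun t => f t ^ 2 * w t) volume 0 1) (hg : ∀ k, Continuous (g k))
    (hw : Continuous w)
    (horth : ∀ j k, ∫ t in (0 : ℝ)..1, g j t * g k t * w t = if j = k then μ k else 0)
    (s : Finset ℕ) (b : ℕ → ℝ) :
    ∫ t in (0 : ℝ)..1, (f t - ∑ k ∈ s, b k * g k t) ^ 2 * w t =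
      (∫ t in (0 : ℝ)..1, f t ^ 2 * w t) -
        2 * (∑ k ∈ s, b k * ∫ t in (0 : ℝ)..1, f t * g k t * w t) + ∑ k ∈ s, b k ^ 2 * μ k := by
  have hfg : ∀ k, IntervalIntegrable (fun t => f t * g k t * w t) volume 0 1 := fun k =>
    (hf.mul_continuousOn (hg k).continuousOn).mul_continuousOn hw.continuousOn
  have hgg : ∀ j k, IntervalIntegrable (fun t => g j t * g k t * w t) volume 0 1 := fun j k =>
    (((hg j).mul (hg k)).mul hw).intervalIntegrable _ _
  have e : ∀ t, (f t - ∑ k ∈ s, b k * g k t) ^ 2 * w t = f t ^ 2 * w t -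
      ∑ k ∈ s, 2 * b k * (f t * g k t * w t) +
      ∑ j ∈ s, ∑ k ∈ s, b j * b k * (g j t * g k t * w t) := by
    intro t
    have h1 : ∑ k ∈ s, 2 * b k * (f t * g k t * w t) =
        2 * f t * w t * ∑ k ∈ s, b k * g k t := by
      rw [Finset.mul_sum]; exact Finset.sum_congr rfl fun k _ => by ring
    have h2 : ∑ j ∈ s, ∑ k ∈ s, b j * b k * (g j t * g k t * w t) =
        (∑ j ∈ s, b j * g j t) * (∑ k ∈ s, b k * g k t) * w t := by
      rw [Finset.sum_mul_sum, Finset.sum_mul]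
      refine Finset.sum_congr rfl fun j _ => ?_
      rw [Finset.sum_mul]; exact Finset.sum_congr rfl fun k _ => by ring
    rw [h1, h2]; ring
  simp_rw [e]
  have i1 : IntervalIntegrable (fun t => ∑ k ∈ s, 2 * b k * (f t * g k t * w t)) volume 0 1 := by
    have := IntervalIntegrable.sum s (fun k _ => (hfg k).const_mul (2 * b k))
    simpa [Finset.sum_fn] using this
  have i2 : ∀ j, IntervalIntegrable
      (fun t => ∑ k ∈ s, b j * b k * (g j t * g k t * w t)) volume 0 1 := fun j => by
    have := IntervalIntegrable.sum s (fun k _ => (hgg j k).const_mul (b j * b k))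
    simpa [Finset.sum_fn] using this
  have i3 : IntervalIntegrable
      (fun t => ∑ j ∈ s, ∑ k ∈ s, b j * b k * (g j t * g k t * w t)) volume 0 1 := by
    have := IntervalIntegrable.sum s (fun j _ => i2 j)
    simpa [Finset.sum_fn] using this
  rw [intervalIntegral.integral_add (hf2.sub i1) i3, intervalIntegral.integral_sub hf2 i1,
    intervalIntegral.integral_finsetSum fun k _ => (hfg k).const_mul (2 * b k),
    intervalIntegral.integral_finsetSum fun j _ => i2 j]
  congr 1
  · rw [Finset.mul_sum]
    simp_rw [intervalIntegral.integral_const_mul, mul_assoc]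
  · refine Finset.sum_congr rfl fun j hj => ?_
    rw [intervalIntegral.integral_finsetSum fun k _ => (hgg j k).const_mul (b j * b k)]
    simp_rw [intervalIntegral.integral_const_mul, horth, mul_ite, mul_zero]
    rw [Finset.sum_ite_eq, if_pos hj, sq]

open Polynomial in
-- Triangularity: one element in each degree, so leading coefficients can be removed one at a time.
theorem exists_eq_sum_of_natDegree_eq {e : ℕ → ℝ[X]} (he : ∀ k, (e k).natDegree = k ∧ e k ≠ 0)
    (N : ℕ) (p : ℝ[X]) (hp : p.natDegree < N) :
    ∃ b : ℕ → ℝ, p = ∑ k ∈ Finset.range N, C (b k) * e k := by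
  suffices H : ∀ N (p : ℝ[X]), p.degree < (N : ℕ) →
      ∃ b : ℕ → ℝ, p = ∑ k ∈ Finset.range N, C (b k) * e k by
    exact H N p (degree_lt_iff_coeff_zero _ _ |>.2 fun m hm =>
      coeff_eq_zero_of_natDegree_lt (by omega))
  intro N
  induction N with
  | zero =>
    intro p hp
    refine ⟨0, ?_⟩
    rw [degree_lt_iff_coeff_zero] at hp
    ext n
    simpa using hp n (Nat.zero_le n)
  | succ N ih =>
    intro p hp
    have hlc : (e N).coeff N ≠ 0 := by
      have := leadingCoeff_ne_zero.2 (he N).2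
      rwa [leadingCoeff, (he N).1] at this
    obtain ⟨b, hb⟩ := ih (p - C (p.coeff N / (e N).coeff N) * e N) (by
      rw [degree_lt_iff_coeff_zero] at hp ⊢
      intro m hm
      rcases hm.eq_or_lt with rfl | hm
      · simp [hlc]
      · rw [coeff_sub, hp m hm, coeff_C_mul,
          coeff_eq_zero_of_natDegree_lt (p := e N) (n := m) (by rw [(he N).1]; exact hm)]
        simp)
    refine ⟨fun k => if k = N then p.coeff N / (e N).coeff N else b k, ?_⟩
    rw [Finset.sum_range_succ]
    simp only [if_true]
    have : ∑ k ∈ Finset.range N, C (if k = N then p.coeff N / (e N).coeff N else b k) * e k =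
        ∑ k ∈ Finset.range N, C (b k) * e k :=
      Finset.sum_congr rfl fun k hk => by rw [if_neg (Finset.mem_range.1 hk).ne]
    rw [this, ← hb]; ring

/-- First-order approximation of an absolutely continuous function in a Jacobi-weighted norm. -/
theorem exists_polynomial_integral_sq_le {a b : ℕ} (m : ℕ) {u : ℝ → ℝ}
    (hu : AbsolutelyContinuousOnInterval u 0 1)
    (hu2 : IntervalIntegrable (fun t => deriv u t ^ 2 * wt (a + 1) (b + 1) t) volume 0 1) :
    ∃ P : Polynomial ℝ, P.natDegree ≤ m ∧
      ∫ t in (0 : ℝ)..1, (u t - P.eval t) ^ 2 * wt a b t ≤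
        (1 / (m + 1 : ℝ)) ^ 2 * ∫ t in (0 : ℝ)..1, deriv u t ^ 2 * wt (a + 1) (b + 1) t := by
  obtain ⟨e, hdeg, horth, hibp⟩ := exists_orthonormal_eigenpoly a b
  set c : ℕ → ℝ := fun k => ∫ t in (0 : ℝ)..1, u t * (e k).eval t * wt a b t with hc
  set I := ∫ t in (0 : ℝ)..1, deriv u t ^ 2 * wt (a + 1) (b + 1) t with hI
  have hucont : ContinuousOn u (Icc 0 1) := by
    have := hu.continuousOn; rwa [uIcc_of_le zero_le_one] at this
  have hucont' := hu.continuousOn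
  have hui : IntervalIntegrable u volume 0 1 := hucont'.intervalIntegrable
  have hu2i : IntervalIntegrable (fun t => u t ^ 2 * wt a b t) volume 0 1 :=
    ((hucont'.pow 2).mul (continuous_wt a b).continuousOn).intervalIntegrable
  have expand := fun (s : Finset ℕ) (β : ℕ → ℝ) =>
    integral_sub_sum_sq_mul (μ := fun _ => 1) hui hu2i (fun k => (e k).continuous)
      (continuous_wt a b) horth s β
  -- Integration by parts shows that the derivatives are again orthogonal, for the raised weight,
  -- with squared norms the eigenvalues.
  have horth' : ∀ j k, ∫ t in (0 : ℝ)..1, (e j).derivative.eval t * (e k).derivative.eval t *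
      wt (a + 1) (b + 1) t = if j = k then jacEig a b k else 0 := by
    intro j k
    have h := hibp k _ (absolutelyContinuousOnInterval_eval (e j))
    simp_rw [Polynomial.deriv] at h
    rw [← h, horth]
    split_ifs <;> simp
  -- Bessel's inequality for the derivative
  have bessel : ∀ N, ∑ k ∈ Finset.range N, jacEig a b k * c k ^ 2 ≤ I := by
    intro N
    have h := integral_sub_sum_sq_mul hu.intervalIntegrable_deriv hu2
      (fun k => (e k).derivative.continuous) (continuous_wt _ _) horth' (Finset.range N) c
    have h0 : 0 ≤ ∫ t in (0 : ℝ)..1, (deriv u t - ∑ k ∈ Finset.range N,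
        c k * (e k).derivative.eval t) ^ 2 * wt (a + 1) (b + 1) t :=
      intervalIntegral.integral_nonneg zero_le_one fun t ht =>
        mul_nonneg (sq_nonneg _) (wt_nonneg ht)
    rw [h] at h0
    have e1 : ∑ k ∈ Finset.range N, c k * ∫ t in (0 : ℝ)..1, deriv u t *
        (e k).derivative.eval t * wt (a + 1) (b + 1) t =
        ∑ k ∈ Finset.range N, jacEig a b k * c k ^ 2 :=
      Finset.sum_congr rfl fun k _ => by rw [← hibp k u hu, hc]; ring
    have e2 : ∑ k ∈ Finset.range N, c k ^ 2 * jacEig a b k =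
        ∑ k ∈ Finset.range N, jacEig a b k * c k ^ 2 :=
      Finset.sum_congr rfl fun k _ => mul_comm _ _
    rw [e1, e2] at h0
    linarith
  have hproj : ∀ N, ∫ t in (0 : ℝ)..1, (u t - ∑ k ∈ Finset.range N,
      c k * (e k).eval t) ^ 2 * wt a b t =
      (∫ t in (0 : ℝ)..1, u t ^ 2 * wt a b t) - ∑ k ∈ Finset.range N, c k ^ 2 := by
    intro N
    rw [expand]
    have e1 : ∑ k ∈ Finset.range N, c k * ∫ t in (0 : ℝ)..1, u t * (e k).eval t * wt a b t =
        ∑ k ∈ Finset.range N, c k ^ 2 := Finset.sum_congr rfl fun k _ => by rw [hc]; ring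
    rw [e1]; simp only [mul_one]; ring
  have hbest : ∀ N (W : Polynomial ℝ), W.natDegree < N →
      (∫ t in (0 : ℝ)..1, u t ^ 2 * wt a b t) - ∑ k ∈ Finset.range N, c k ^ 2 ≤
      ∫ t in (0 : ℝ)..1, (u t - W.eval t) ^ 2 * wt a b t := by
    intro N W hW
    obtain ⟨β, hβ⟩ := exists_eq_sum_of_natDegree_eq hdeg N W hW
    have e1 : ∀ t, W.eval t = ∑ k ∈ Finset.range N, β k * (e k).eval t := by
      intro t; rw [hβ]; simp [Polynomial.eval_finsetSum]
    simp_rw [e1]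
    rw [expand]
    have : 0 ≤ ∑ k ∈ Finset.range N, (β k - c k) ^ 2 := Finset.sum_nonneg fun _ _ => sq_nonneg _
    have e2 : ∑ k ∈ Finset.range N, (β k - c k) ^ 2 = ∑ k ∈ Finset.range N, β k ^ 2 * 1 -
        2 * (∑ k ∈ Finset.range N, β k * ∫ t in (0 : ℝ)..1, u t * (e k).eval t * wt a b t) +
        ∑ k ∈ Finset.range N, c k ^ 2 := by
      rw [Finset.mul_sum, ← Finset.sum_sub_distrib, ← Finset.sum_add_distrib]
      exact Finset.sum_congr rfl fun k _ => by rw [hc]; ring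
    linarith
  refine ⟨∑ k ∈ Finset.range (m + 1), Polynomial.C (c k) * e k, ?_, ?_⟩
  · refine Polynomial.natDegree_sum_le_of_forall_le _ _ fun k hk => ?_
    refine (Polynomial.natDegree_C_mul_le _ _).trans ?_
    rw [(hdeg k).1]; exact Nat.lt_succ_iff.1 (Finset.mem_range.1 hk)
  · have e0 : ∀ t, (∑ k ∈ Finset.range (m + 1), Polynomial.C (c k) * e k).eval t =
        ∑ k ∈ Finset.range (m + 1), c k * (e k).eval t := by
      intro t; simp [Polynomial.eval_finsetSum]
    simp_rw [e0]
    rw [hproj]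
    refine le_of_forall_pos_le_add fun ε hε => ?_
    -- Weierstrass approximation replaces Parseval: a partial sum long enough to contain W does at
    -- least as well as W. The minimum with 1 makes the squared error at most ε.
    obtain ⟨W, hW⟩ := exists_polynomial_near_of_continuousOn 0 1 u hucont (min ε 1)
      (lt_min hε one_pos)
    have hWle : ∫ t in (0 : ℝ)..1, (u t - W.eval t) ^ 2 * wt a b t ≤ ε := by
      have : ∫ t in (0 : ℝ)..1, (u t - W.eval t) ^ 2 * wt a b t ≤ ∫ _ in (0 : ℝ)..1, ε := by
        refine intervalIntegral.integral_mono_on zero_le_one ?_ (by simp) fun t ht => ?_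
        · exact (((hucont'.sub W.continuous.continuousOn).pow 2).mul
            (continuous_wt a b).continuousOn).intervalIntegrable
        · have h1 := (hW t ht).le
          rw [abs_sub_comm] at h1
          have h2 : |u t - W.eval t| ^ 2 ≤ ε := by
            have h3 := le_min_iff.1 h1
            nlinarith [abs_nonneg (u t - W.eval t)]
          rw [sq_abs] at h2
          calc _ ≤ ε * 1 := mul_le_mul h2 (wt_le_one ht) (wt_nonneg ht) hε.le
            _ = ε := mul_one _
      simpa using this
    set N := max (m + 1) (W.natDegree + 1)
    have h1 := hbest N W (lt_of_lt_of_le (Nat.lt_succ_self _) (le_max_right _ _))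
    have hsplit : ∑ k ∈ Finset.range N, c k ^ 2 =
        ∑ k ∈ Finset.range (m + 1), c k ^ 2 + ∑ k ∈ Finset.Ico (m + 1) N, c k ^ 2 :=
      (Finset.sum_range_add_sum_Ico _ (le_max_left _ _)).symm
    -- The eigenvalues of index k ≥ m + 1 are at least (m + 1)², so Bessel's inequality for u'
    -- controls the tail of u.
    have htail : ((m + 1 : ℝ)) ^ 2 * ∑ k ∈ Finset.Ico (m + 1) N, c k ^ 2 ≤ I := by
      refine le_trans ?_ (bessel N)
      rw [← Finset.sum_range_add_sum_Ico _ (le_max_left (m + 1) (W.natDegree + 1)), Finset.mul_sum]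
      refine le_trans ?_ (le_add_of_nonneg_left (Finset.sum_nonneg fun k _ =>
        mul_nonneg (by unfold jacEig; positivity) (sq_nonneg _)))
      refine Finset.sum_le_sum fun k hk => mul_le_mul_of_nonneg_right ?_ (sq_nonneg _)
      have : (m + 1 : ℝ) ≤ k := by exact_mod_cast (Finset.mem_Ico.1 hk).1
      unfold jacEig
      have ha : (0 : ℝ) ≤ a := by positivity
      have hb : (0 : ℝ) ≤ b := by positivity
      have hm : (0 : ℝ) ≤ m := by positivity
      nlinarith
    have h2 : ∑ k ∈ Finset.Ico (m + 1) N, c k ^ 2 ≤ (1 / (m + 1 : ℝ)) ^ 2 * I := by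
      rw [one_div, inv_pow, inv_mul_eq_div, le_div_iff₀ (by positivity)]
      linarith
    linarith

end AdditiveExpSeries

/-! ### Higher-order and uniform polynomial approximation of Sobolev functions. -/

namespace AdditiveExpSeries

open Polynomial in
theorem exists_antiderivative (q : ℝ[X]) :
    ∃ Q : ℝ[X], derivative Q = q ∧ Q.natDegree ≤ q.natDegree + 1 := by
  refine ⟨∑ j ∈ Finset.range (q.natDegree + 1), monomial (j + 1) (q.coeff j / (j + 1)), ?_, ?_⟩
  · rw [derivative_sum]
    conv_rhs => rw [q.as_sum_range]
    refine Finset.sum_congr rfl fun j _ => ?_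
    have : (j + 1 : ℝ) ≠ 0 := by positivity
    rw [derivative_monomial]
    congr 1
    push_cast
    field_simp
  · refine natDegree_sum_le_of_forall_le _ _ fun j hj => ?_
    exact (natDegree_monomial_le _).trans (by have := Finset.mem_range.1 hj; omega)

/-- Approximation by polynomials in Jacobi-weighted norms, of order the number of derivatives. -/
theorem exists_polynomial_integral_sq_le_iterate (r : ℕ) : ∀ (a b m : ℕ) (D : ℕ → ℝ → ℝ), r ≤ m →
    (∀ j < r, AbsolutelyContinuousOnInterval (D j) 0 1) →
    (∀ j < r, ∀ t ∈ Ioo (0 : ℝ) 1, deriv (D j) t = D (j + 1) t) →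
    IntervalIntegrable (fun t => D r t ^ 2 * wt (a + r) (b + r) t) volume 0 1 →
    ∃ P : Polynomial ℝ, P.natDegree ≤ m ∧
      IntervalIntegrable (fun t => (D 0 t - P.eval t) ^ 2 * wt a b t) volume 0 1 ∧
      ∫ t in (0 : ℝ)..1, (D 0 t - P.eval t) ^ 2 * wt a b t ≤
        (1 / (m + 1 - r : ℝ)) ^ (2 * r) * ∫ t in (0 : ℝ)..1, D r t ^ 2 * wt (a + r) (b + r) t := by
  induction r with
  | zero =>
    intro a b m D _ _ _ hI
    exact ⟨0, by simp, by simpa using hI, by simp⟩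
  | succ r ih =>
    intro a b m D hrm hac hder hI
    have e1 : ∀ c : ℕ, c + 1 + r = c + (r + 1) := fun c => by ring
    -- First the derivative is approximated, in the raised weight and one degree lower. Subtracting
    -- an antiderivative of q leaves a function whose derivative is that error, and the first-order
    -- result gains the last factor.
    obtain ⟨q, hq, hqi, hqle⟩ := ih (a + 1) (b + 1) (m - 1) (fun j => D (j + 1)) (by omega)
      (fun j hj => hac _ (by omega)) (fun j hj => hder _ (by omega)) (by simpa only [e1] using hI)
    simp only [zero_add, e1] at hqi hqle
    obtain ⟨Q, hQ, hQd⟩ := exists_antiderivative q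
    set u : ℝ → ℝ := fun t => D 0 t - Q.eval t with hu
    have hD0 := hac 0 (by omega)
    have huac : AbsolutelyContinuousOnInterval u 0 1 :=
      hD0.sub (absolutelyContinuousOnInterval_eval Q)
    -- The family D gives the two-sided derivative only in the open interval, so the point 1 is
    -- discarded as a null set.
    have hderiv : ∀ᵐ t, t ∈ uIoc (0 : ℝ) 1 →
        (D 1 t - q.eval t) ^ 2 * wt (a + 1) (b + 1) t =
        deriv u t ^ 2 * wt (a + 1) (b + 1) t := by
      filter_upwards [hD0.ae_differentiableAt, compl_mem_ae_iff.2 (measure_singleton (1 : ℝ))]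
        with t ht ht1 htI
      rw [uIoc_of_le zero_le_one] at htI
      have h1 : t ≠ 1 := ht1
      rw [hu, deriv_fun_sub (ht (by rw [uIcc_of_le zero_le_one]; exact ⟨htI.1.le, htI.2⟩))
        Q.differentiableAt, Polynomial.deriv, hQ,
        hder 0 (by omega) t ⟨htI.1, lt_of_le_of_ne htI.2 h1⟩]
    have hui : IntervalIntegrable (fun t => deriv u t ^ 2 * wt (a + 1) (b + 1) t) volume 0 1 :=
      hqi.congr_ae (by
        rw [Filter.EventuallyEq, ae_restrict_iff' measurableSet_uIoc]; exact hderiv)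
    obtain ⟨P, hP, hPle⟩ := exists_polynomial_integral_sq_le m huac hui
    rw [← intervalIntegral.integral_congr_ae hderiv] at hPle
    have e2 : ∀ t, D 0 t - (Q + P).eval t = u t - P.eval t := fun t => by simp [hu]; ring
    refine ⟨Q + P, ?_, ?_, ?_⟩
    · exact Polynomial.natDegree_add_le_of_degree_le (by omega) hP
    · have := ((hD0.continuousOn.sub (Q + P).continuous.continuousOn).pow 2).mul
        (continuous_wt a b).continuousOn
      exact this.intervalIntegrable
    · simp_rw [e2]
      refine hPle.trans ?_
      refine (mul_le_mul_of_nonneg_left hqle (by positivity)).trans ?_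
      rw [← mul_assoc]
      refine mul_le_mul_of_nonneg_right ?_ (intervalIntegral.integral_nonneg zero_le_one
        fun t ht => mul_nonneg (sq_nonneg _) (wt_nonneg ht))
      have hm1 : ((m - 1 : ℕ) : ℝ) = m - 1 := by
        rw [Nat.cast_sub (by omega)]; simp
      have hr : (r : ℝ) + 1 ≤ m := by exact_mod_cast hrm
      have hr0 : (0 : ℝ) ≤ r := by positivity
      have e3 : ((m - 1 : ℕ) : ℝ) + 1 - r = m + 1 - (r + 1 : ℕ) := by push_cast; rw [hm1]; ring
      rw [e3, show 2 * (r + 1) = 2 + 2 * r by ring, pow_add]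
      refine mul_le_mul_of_nonneg_right ?_ ?_
      · have : (0 : ℝ) < m + 1 - (r + 1 : ℕ) := by push_cast; linarith
        gcongr
        push_cast; linarith
      · rw [pow_mul]; positivity

theorem marginal_apply_wt (d : ℕ) (i : Fin d) :
    marginal d i = (volume.restrict (Icc (0 : ℝ) 1)).withDensity fun t =>
      ENNReal.ofReal (wt (i : ℕ) (d - 1 - (i : ℕ)) t / ((d - 1 - (i : ℕ))! * (i : ℕ)!)) := by
  unfold marginal wt
  simp_rw [mul_comm]

theorem integrable_marginal_iff (d : ℕ) (i : Fin d) (h : ℝ → ℝ) :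
    Integrable h (marginal d i) ↔
      IntervalIntegrable (fun t => h t * wt (i : ℕ) (d - 1 - (i : ℕ)) t) volume 0 1 := by
  have hm : Measurable fun t : ℝ =>
      ENNReal.ofReal (wt (i : ℕ) (d - 1 - (i : ℕ)) t / ((d - 1 - (i : ℕ))! * (i : ℕ)!)) :=
    ((continuous_wt _ _).div_const _).measurable.ennreal_ofReal
  rw [marginal_apply_wt, integrable_withDensity_iff hm (by simp),
    intervalIntegrable_iff_integrableOn_Icc_of_le zero_le_one, IntegrableOn]
  have hc : ((((d - 1 - (i : ℕ))! * (i : ℕ)! : ℝ))⁻¹ ≠ 0) := by positivity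
  rw [← integrable_mul_const_iff (IsUnit.mk0 _ hc) (fun t => h t * wt (i : ℕ) (d - 1 - (i : ℕ)) t)]
  refine integrable_congr ?_
  filter_upwards [ae_restrict_mem measurableSet_Icc] with t ht
  rw [ENNReal.toReal_ofReal (div_nonneg (wt_nonneg ht) (by positivity))]
  ring

/-- The Sobolev condition bounds the r-th derivative in the weight of the marginal, whereas the
approximation asks only for the smaller weight with exponents raised by r. -/
theorem intervalIntegrable_sq_mul_wt_add {f : ℝ → ℝ} {a b : ℕ} (r : ℕ)
    (h : IntervalIntegrable (fun t => f t ^ 2 * wt a b t) volume 0 1) :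
    IntervalIntegrable (fun t => f t ^ 2 * wt (a + r) (b + r) t) volume 0 1 := by
  have := h.mul_continuousOn (continuous_wt r r).continuousOn
  refine this.congr fun t _ => ?_
  simp only [wt, pow_add]; ring

/-- Rates of polynomial approximation for Sobolev functions: in mean square for the marginal, and
uniformly. -/
theorem exists_polynomial_approx {d : ℕ} (i : Fin d) {r : ℕ} (hr : d < r) {l : ℝ → ℝ}
    (hl : l ∈ sobolev (marginal d i) r) :
    ∃ C : ℝ, 0 < C ∧ ∀ m : ℕ, 2 * r ≤ m → ∃ P : Polynomial ℝ, P.natDegree ≤ m ∧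
      ∫ t in (0 : ℝ)..1, (l t - P.eval t) ^ 2 * wt (i : ℕ) (d - 1 - (i : ℕ)) t ≤ C * ((m : ℝ) ^ (2 * r))⁻¹ ∧
      ∀ᵐ t ∂(volume.restrict (Icc (0 : ℝ) 1)), |l t - P.eval t| ≤ C / m := by
  obtain ⟨-, g, hlg, hgc, hgac, hg2⟩ := hl
  set a : ℕ := (i : ℕ) with ha
  set b : ℕ := d - 1 - a with hb
  have had : a + 1 ≤ d := i.2
  have hbd : b + 1 ≤ d := by have := i.2; omega
  set D : ℕ → ℝ → ℝ := fun j => iteratedDerivWithin j g (Icc 0 1) with hD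
  have hD0 : D 0 = g := iteratedDerivWithin_zero
  have hDac : ∀ j < r, AbsolutelyContinuousOnInterval (D j) 0 1 := by
    intro j hj
    rcases (show j ≤ r - 1 by omega).eq_or_lt with h | h
    · rw [h]; exact hgac
    · have h1 : ContDiffOn ℝ (j + 1 : ℕ) g (Icc 0 1) := hgc.of_le (by exact_mod_cast h)
      have := ((contDiffOn_nat_succ_iff_contDiffOn_one_iteratedDerivWithin
        (uniqueDiffOn_Icc zero_lt_one)).1 h1).2
      exact ContDiffOn.absolutelyContinuousOnInterval (by rwa [uIcc_of_le zero_le_one])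
  have hDder : ∀ j < r, ∀ t ∈ Ioo (0 : ℝ) 1, deriv (D j) t = D (j + 1) t := by
    intro j _ t ht
    rw [hD]
    simp only
    rw [iteratedDerivWithin_succ, derivWithin_of_mem_nhds (Icc_mem_nhds ht.1 ht.2)]
  have hDr : IntervalIntegrable (fun t => D r t ^ 2 * wt (a + r) (b + r) t) volume 0 1 :=
    intervalIntegrable_sq_mul_wt_add r ((integrable_marginal_iff d i _).1 hg2.integrable_sq)
  set A := ∫ t in (0 : ℝ)..1, D r t ^ 2 * wt (a + r) (b + r) t
  have hA : 0 ≤ A := intervalIntegral.integral_nonneg zero_le_one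
    fun t ht => mul_nonneg (sq_nonneg _) (wt_nonneg ht)
  have hgcont : ContinuousOn g (Icc 0 1) := hgc.continuousOn
  set B := 4 ^ r * A with hB
  have hB0 : 0 ≤ B := by positivity
  have hex : ∀ m : ℕ, 2 * r ≤ m → ∃ P : Polynomial ℝ, P.natDegree ≤ m ∧
      ∫ t in (0 : ℝ)..1, (g t - P.eval t) ^ 2 * wt a b t ≤ B * ((m : ℝ) ^ (2 * r))⁻¹ := by
    intro m hm
    obtain ⟨P, hP, -, hle⟩ := exists_polynomial_integral_sq_le_iterate r a b m D (by omega)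
      hDac hDder hDr
    rw [hD0] at hle
    refine ⟨P, hP, hle.trans ?_⟩
    have hm' : (2 * r : ℝ) ≤ m := by exact_mod_cast hm
    have hr0 : (0 : ℝ) < r := by exact_mod_cast (by omega : 0 < r)
    -- Here m ≥ 2r enters; it produces the factor 4^r in B.
    have h1 : (1 / (m + 1 - r : ℝ)) ≤ 2 / m := by
      rw [div_le_div_iff₀ (by linarith) (by linarith)]; linarith
    have h2 : 0 ≤ (1 / (m + 1 - r : ℝ)) := one_div_nonneg.2 (by linarith)
    have h3 : (1 / (m + 1 - r : ℝ)) ^ (2 * r) ≤ (2 / m) ^ (2 * r) := pow_le_pow_left₀ h2 h1 _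
    refine (mul_le_mul_of_nonneg_right h3 hA).trans (le_of_eq ?_)
    rw [div_pow, pow_mul 2, hB]; norm_num; ring
  choose! P hPd hPle using hex
  have hint : ∀ Q : Polynomial ℝ,
      IntervalIntegrable (fun t => (g t - Q.eval t) ^ 2 * wt a b t) volume 0 1 := fun Q => by
    refine ContinuousOn.intervalIntegrable ?_
    rw [uIcc_of_le zero_le_one]
    exact ((hgcont.sub Q.continuous.continuousOn).pow 2).mul (continuous_wt a b).continuousOn
  -- consecutive dyadic differences
  set K := √(16 * 256 ^ d * B) with hK
  have hdiff : ∀ M : ℕ, 2 * r ≤ M → ∀ s ∈ Icc (0 : ℝ) 1,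
      |(P (2 * M)).eval s - (P M).eval s| ≤ K / M := by
    intro M hM s hs
    have hM0 : (0 : ℝ) < M := by exact_mod_cast (by omega : 0 < M)
    have hM1 : (1 : ℝ) ≤ M := by exact_mod_cast (by omega : 1 ≤ M)
    have h1 := sq_eval_le_integral (p := P (2 * M) - P M) (n := 2 * M) (a := a) (b := b)
      (by omega) ((Polynomial.natDegree_sub_le _ _).trans
        (max_le (hPd _ (by omega)) ((hPd M hM).trans (by omega)))) had hbd hs
    simp only [Polynomial.eval_sub] at h1
    have h2 : ∫ t in (0 : ℝ)..1, ((P (2 * M)).eval t - (P M).eval t) ^ 2 * wt a b t ≤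
        4 * (B * ((M : ℝ) ^ (2 * r))⁻¹) := by
      have h3 : ∫ t in (0 : ℝ)..1, ((P (2 * M)).eval t - (P M).eval t) ^ 2 * wt a b t ≤
          ∫ t in (0 : ℝ)..1, (2 * ((g t - (P (2 * M)).eval t) ^ 2 * wt a b t) +
            2 * ((g t - (P M).eval t) ^ 2 * wt a b t)) := by
        refine intervalIntegral.integral_mono_on zero_le_one ?_
          (((hint _).const_mul 2).add ((hint _).const_mul 2)) fun t ht => ?_
        · exact ((((P (2 * M)).continuous.sub (P M).continuous).pow 2).mul
            (continuous_wt a b)).intervalIntegrable _ _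
        · have := wt_nonneg (a := a) (b := b) ht
          nlinarith [mul_nonneg this (sq_nonneg ((g t - (P (2 * M)).eval t) +
            (g t - (P M).eval t)))]
      rw [intervalIntegral.integral_add ((hint _).const_mul 2) ((hint _).const_mul 2),
        intervalIntegral.integral_const_mul, intervalIntegral.integral_const_mul] at h3
      have h4 := hPle M hM
      have h5 := hPle (2 * M) (by omega)
      have h6 : (((2 * M : ℕ) : ℝ) ^ (2 * r))⁻¹ ≤ ((M : ℝ) ^ (2 * r))⁻¹ := by
        gcongr; linarith
      have h7 := mul_le_mul_of_nonneg_left h6 hB0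
      linarith
    have h8 : ((P (2 * M)).eval s - (P M).eval s) ^ 2 ≤ (K / M) ^ 2 := by
      refine h1.trans ((mul_le_mul_of_nonneg_left h2 (by positivity)).trans ?_)
      rw [div_pow, hK, Real.sq_sqrt (by positivity)]
      -- This is where r > d is used: the loss M^(2d) in Nikolskii's inequality leaves at least M⁻²,
      -- hence summable dyadic differences.
      have h9 : (M : ℝ) ^ (2 * d) * ((M : ℝ) ^ (2 * r))⁻¹ ≤ ((M : ℝ) ^ 2)⁻¹ := by
        rw [← div_eq_mul_inv, ← one_div, div_le_div_iff₀ (by positivity) (by positivity), one_mul,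
          ← pow_add]
        exact pow_le_pow_right₀ hM1 (by omega)
      have h10 : (4 * 64 ^ d * ((2 * M : ℕ) : ℝ) ^ (2 * d) * (4 * (B * ((M : ℝ) ^ (2 * r))⁻¹))) =
          16 * 256 ^ d * B * ((M : ℝ) ^ (2 * d) * ((M : ℝ) ^ (2 * r))⁻¹) := by
        push_cast
        rw [mul_pow, pow_mul 2 2 d, show (256 : ℝ) = 64 * 4 by norm_num, mul_pow (64 : ℝ) 4]
        norm_num; ring
      rw [h10, div_eq_mul_inv]
      exact mul_le_mul_of_nonneg_left h9 (by positivity)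
    exact abs_le_of_sq_le_sq h8 (by positivity)
  -- Geometric summation of K/(2^j m), with the exact partial sum kept so that the induction closes.
  have htel : ∀ m : ℕ, 2 * r ≤ m → ∀ J : ℕ, ∀ s ∈ Icc (0 : ℝ) 1,
      |(P (2 ^ J * m)).eval s - (P m).eval s| ≤ 2 * K / m * (1 - (1 / 2) ^ J) := by
    intro m hm J s hs
    have hm0 : (0 : ℝ) < m := by exact_mod_cast (by omega : 0 < m)
    induction J with
    | zero => simp
    | succ J ih =>
      have hJ : 1 ≤ 2 ^ J := Nat.one_le_two_pow
      have h1 := hdiff (2 ^ J * m) (by nlinarith) s hs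
      rw [← mul_assoc, ← pow_succ'] at h1
      have h2 := abs_sub_le ((P (2 ^ (J + 1) * m)).eval s) ((P (2 ^ J * m)).eval s) ((P m).eval s)
      have h3 : K / ((2 ^ J * m : ℕ) : ℝ) = 2 * K / m * ((1 / 2) ^ J - (1 / 2) ^ (J + 1)) := by
        push_cast
        rw [pow_succ, one_div, inv_pow]
        field_simp; ring
      rw [h3] at h1
      linarith
  have hK0 : 0 ≤ K := Real.sqrt_nonneg _
  have hunif : ∀ m : ℕ, 2 * r ≤ m → ∀ t ∈ Ioo (0 : ℝ) 1, |g t - (P m).eval t| ≤ 2 * K / m := by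
    intro m hm
    have hm0 : (0 : ℝ) < m := by exact_mod_cast (by omega : 0 < m)
    -- The excess over the desired bound is dominated by |g - P_(2^J m)| for every J, hence has zero
    -- weighted norm; by continuity it vanishes wherever the weight is positive. This avoids
    -- identifying a pointwise limit of the polynomials.
    set x : ℝ → ℝ := fun t => max (|g t - (P m).eval t| - 2 * K / m) 0 with hx
    have hxc : ContinuousOn (fun t => x t ^ 2 * wt a b t) (Icc 0 1) := by
      refine ContinuousOn.mul (ContinuousOn.pow ?_ 2) (continuous_wt a b).continuousOn
      exact (((hgcont.sub (P m).continuous.continuousOn).abs).sub continuousOn_const).sup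
        continuousOn_const
    have hxi : IntervalIntegrable (fun t => x t ^ 2 * wt a b t) volume 0 1 :=
      ContinuousOn.intervalIntegrable (by rwa [uIcc_of_le zero_le_one])
    have hxJ : ∀ J : ℕ, ∫ t in (0 : ℝ)..1, x t ^ 2 * wt a b t ≤ B * (1 / 2) ^ J := by
      intro J
      have hJ : 1 ≤ 2 ^ J := Nat.one_le_two_pow
      have h1 : ∫ t in (0 : ℝ)..1, x t ^ 2 * wt a b t ≤
          ∫ t in (0 : ℝ)..1, (g t - (P (2 ^ J * m)).eval t) ^ 2 * wt a b t := by
        refine intervalIntegral.integral_mono_on zero_le_one hxi (hint _) fun t ht => ?_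
        refine mul_le_mul_of_nonneg_right ?_ (wt_nonneg ht)
        rw [← sq_abs (g t - _)]
        refine pow_le_pow_left₀ (le_max_right _ _) ?_ 2
        refine max_le ?_ (abs_nonneg _)
        have h2 := htel m hm J t ht
        have h3 := abs_sub_le (g t) ((P (2 ^ J * m)).eval t) ((P m).eval t)
        have h4 : 2 * K / m * (1 - (1 / 2) ^ J) ≤ 2 * K / m := by
          have : 0 ≤ 2 * K / m * (1 / 2) ^ J := by positivity
          linarith
        linarith
      refine h1.trans ((hPle _ (by nlinarith)).trans ?_)
      refine mul_le_mul_of_nonneg_left ?_ hB0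
      rw [one_div, inv_pow]
      gcongr
      have : (2 : ℝ) ^ J ≤ ((2 ^ J * m : ℕ) : ℝ) := by
        push_cast
        have : (1 : ℝ) ≤ m := by exact_mod_cast (by omega : 1 ≤ m)
        nlinarith [pow_pos (two_pos (α := ℝ)) J]
      refine this.trans (le_self_pow₀ ?_ (by omega))
      exact le_trans (one_le_pow₀ one_le_two) this
    have hx0 : ∫ t in (0 : ℝ)..1, x t ^ 2 * wt a b t ≤ 0 := by
      have hlim : Tendsto (fun J : ℕ => B * (1 / 2 : ℝ) ^ J) atTop (𝓝 (B * 0)) :=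
        (tendsto_pow_atTop_nhds_zero_of_lt_one (by norm_num) (by norm_num)).const_mul B
      rw [mul_zero] at hlim
      exact ge_of_tendsto' hlim hxJ
    intro t ht
    by_contra! hlt
    have hxt : 0 < x t := lt_max_of_lt_left (by linarith)
    have := intervalIntegral.integral_pos zero_lt_one hxc (fun s hs =>
      mul_nonneg (sq_nonneg _) (wt_nonneg ⟨hs.1.le, hs.2⟩))
      ⟨t, ⟨ht.1.le, ht.2.le⟩, mul_pos (pow_pos hxt 2) (wt_pos ht)⟩
    linarith
  refine ⟨max (max B (2 * K)) 1, by positivity, fun m hm => ⟨P m, hPd m hm, ?_, ?_⟩⟩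
  · have : ∫ t in (0 : ℝ)..1, (l t - (P m).eval t) ^ 2 * wt a b t =
        ∫ t in (0 : ℝ)..1, (g t - (P m).eval t) ^ 2 * wt a b t := by
      rw [intervalIntegral.integral_of_le zero_le_one, intervalIntegral.integral_of_le zero_le_one,
        ← integral_Icc_eq_integral_Ioc, ← integral_Icc_eq_integral_Ioc]
      refine integral_congr_ae ?_
      filter_upwards [hlg] with t ht
      rw [ht]
    rw [this]
    refine (hPle m hm).trans (mul_le_mul_of_nonneg_right ?_ (by positivity))
    exact (le_max_left _ _).trans (le_max_left _ _)
  · rw [← restrict_Ioo_eq_restrict_Icc] at hlg ⊢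
    filter_upwards [hlg, ae_restrict_mem measurableSet_Ioo] with t ht hti
    rw [ht]
    refine (hunif m hm t hti).trans ?_
    gcongr
    exact (le_max_right _ _).trans (le_max_left _ _)

end AdditiveExpSeries

namespace AdditiveExpSeries

/-! ### Slices of the simplex -/

theorem isClosed_simplex (d : ℕ) : IsClosed (simplex d) := by
  have : simplex d = (⋂ i, {x : Fin d → ℝ | x i ∈ Icc (0 : ℝ) 1}) ∩
      ⋂ i, ⋂ j, ⋂ (_ : i ≤ j), {x | x i ≤ x j} := by
    ext x; simp [simplex, Monotone]
  rw [this]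
  refine (isClosed_iInter fun i => isClosed_Icc.preimage (continuous_apply i)).inter ?_
  exact isClosed_iInter fun i => isClosed_iInter fun j => isClosed_iInter fun _ =>
    isClosed_le (continuous_apply i) (continuous_apply j)

theorem measurableSet_simplex (d : ℕ) : MeasurableSet (simplex d) := (isClosed_simplex d).measurableSet

theorem simplex_subset_Icc (d : ℕ) : simplex d ⊆ Icc 0 1 :=
  fun _ hx => ⟨fun i => (hx.1 i).1, fun i => (hx.1 i).2⟩

theorem lintegral_insertNth {n : ℕ} (i : Fin (n + 1)) {F : (Fin (n + 1) → ℝ) → ℝ≥0∞}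
    (hF : Measurable F) :
    ∫⁻ x, F x = ∫⁻ s : ℝ, ∫⁻ y : Fin n → ℝ, F (i.insertNth s y) := by
  have h := (volume_preserving_piFinSuccAbove (fun _ : Fin (n + 1) => ℝ) i).symm
  rw [← h.lintegral_comp hF, Measure.volume_eq_prod]
  exact lintegral_prod (fun p : ℝ × (Fin n → ℝ) =>
    F ((MeasurableEquiv.piFinSuccAbove (fun _ : Fin (n + 1) => ℝ) i).symm p))
    (hF.comp (MeasurableEquiv.measurable _)).aemeasurable

theorem measurable_insertNth {n : ℕ} (i : Fin (n + 1)) :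
    Measurable fun p : ℝ × (Fin n → ℝ) => (i.insertNth p.1 p.2 : Fin (n + 1) → ℝ) :=
  (MeasurableEquiv.piFinSuccAbove (fun _ : Fin (n + 1) => ℝ) i).symm.measurable

theorem prod_ite_val_lt {n : ℕ} (i : Fin (n + 1)) (x y : ℝ) :
    ∏ k : Fin n, ENNReal.ofReal (if (k : ℕ) < i then x else y) =
      ENNReal.ofReal x ^ (i : ℕ) * ENNReal.ofReal y ^ (n - i : ℕ) := by
  have hi : (i : ℕ) ≤ n := Nat.lt_succ_iff.1 i.2
  have hcard : (Finset.univ.filter fun k : Fin n => (k : ℕ) < i).card = i := by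
    rw [Fin.card_filter_val_lt, min_eq_right hi]
  have h2 : (Finset.univ.filter fun k : Fin n => ¬ (k : ℕ) < i).card = n - i := by
    have := Finset.card_filter_add_card_filter_not (s := (Finset.univ : Finset (Fin n)))
      (fun k : Fin n => (k : ℕ) < i)
    rw [hcard, Finset.card_univ, Fintype.card_fin] at this
    omega
  simp_rw [apply_ite ENNReal.ofReal]
  rw [Finset.prod_ite, Finset.prod_const, Finset.prod_const, hcard, h2]

theorem ofReal_wt {a b : ℕ} {t : ℝ} (ht : t ∈ Icc (0 : ℝ) 1) :
    ENNReal.ofReal (wt a b t) = ENNReal.ofReal t ^ a * ENNReal.ofReal (1 - t) ^ b := by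
  rw [wt, ENNReal.ofReal_mul (pow_nonneg ht.1 _), ENNReal.ofReal_pow ht.1,
    ENNReal.ofReal_pow (by linarith [ht.2])]

/-- The slice lies in a box: coordinates before i are in [0,s], those after it in [s,1]. The
factorials of the exact marginal density are irrelevant here. -/
theorem volume_slice_le {n : ℕ} (i : Fin (n + 1)) {s : ℝ} (hs : s ∈ Icc (0 : ℝ) 1) :
    volume {y : Fin n → ℝ | (i.insertNth s y : Fin (n + 1) → ℝ) ∈ simplex (n + 1)} ≤
      ENNReal.ofReal (wt i (n - i) s) := by
  have hsub : {y : Fin n → ℝ | (i.insertNth s y : Fin (n + 1) → ℝ) ∈ simplex (n + 1)} ⊆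
      Icc (fun k => if (k : ℕ) < i then 0 else s) (fun k => if (k : ℕ) < i then s else 1) := by
    intro y hy
    have hb : ∀ k : Fin n, y k ∈ Icc (0 : ℝ) 1 := fun k => by
      have := hy.1 (i.succAbove k); rwa [Fin.insertNth_apply_succAbove] at this
    refine ⟨fun k => ?_, fun k => ?_⟩ <;> dsimp only <;> split_ifs with h
    · exact (hb k).1
    · have : i ≤ i.succAbove k := by
        refine ((Fin.lt_succAbove_iff_le_castSucc i k).2 ?_).le
        rw [Fin.le_def]; simpa using h
      simpa using hy.2 this
    · have : i.succAbove k ≤ i := by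
        refine ((Fin.succAbove_lt_iff_castSucc_lt i k).2 ?_).le
        rw [Fin.lt_def]; simpa using h
      simpa using hy.2 this
    · exact (hb k).2
  refine (measure_mono hsub).trans (le_of_eq ?_)
  rw [Real.volume_Icc_pi, ofReal_wt hs, ← prod_ite_val_lt]
  refine Finset.prod_congr rfl fun k _ => ?_
  split_ifs <;> simp

theorem lintegral_apply_leb_le {n : ℕ} (i : Fin (n + 1)) {F : ℝ → ℝ≥0∞} (hF : Measurable F) :
    ∫⁻ x, F (x i) ∂(leb (n + 1)) ≤
      ∫⁻ s in Icc (0 : ℝ) 1, F s * ENNReal.ofReal (wt i (n - i) s) := by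
  have hm : Measurable ((simplex (n + 1)).indicator fun x => F (x i)) :=
    (hF.comp (measurable_pi_apply i)).indicator (measurableSet_simplex _)
  rw [leb, ← lintegral_indicator (measurableSet_simplex _), lintegral_insertNth i hm,
    ← lintegral_indicator measurableSet_Icc]
  refine lintegral_mono fun s => ?_
  have hms : MeasurableSet {y : Fin n → ℝ | (i.insertNth s y : Fin (n + 1) → ℝ) ∈ simplex (n + 1)} :=
    (measurable_insertNth i).comp (measurable_const.prodMk measurable_id) (measurableSet_simplex _)
  have e : ∀ y : Fin n → ℝ, (simplex (n + 1)).indicator (fun x => F (x i)) (i.insertNth s y) =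
      {y : Fin n → ℝ | (i.insertNth s y : Fin (n + 1) → ℝ) ∈ simplex (n + 1)}.indicator
        (fun _ => F s) y := by
    intro y
    by_cases h : (i.insertNth s y : Fin (n + 1) → ℝ) ∈ simplex (n + 1)
    · rw [indicator_of_mem h, indicator_of_mem (by exact h)]; simp
    · rw [indicator_of_notMem h, indicator_of_notMem (by exact h)]
  simp_rw [e]
  rw [lintegral_indicator_const hms]
  by_cases hs : s ∈ Icc (0 : ℝ) 1
  · rw [indicator_of_mem hs]
    exact mul_le_mul_right (volume_slice_le i hs) _
  · rw [indicator_of_notMem hs]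
    have : {y : Fin n → ℝ | (i.insertNth s y : Fin (n + 1) → ℝ) ∈ simplex (n + 1)} = ∅ := by
      refine eq_empty_of_forall_notMem fun y hy => hs ?_
      simpa using hy.1 i
    rw [this]; simp

/-- The other coordinates lie in consecutive intervals, which forces their order; those before i
stay below α and those after it above β. The same y therefore works for every u in [α,β]. -/
theorem insertNth_mem_simplex {n : ℕ} (i : Fin (n + 1)) {α β u : ℝ} (hα : 0 ≤ α) (hβ : β ≤ 1)
    (hu : u ∈ Icc α β) {y : Fin n → ℝ}
    (hy : ∀ k : Fin n, y k ∈ if (k : ℕ) < i then Icc (k * α / (n + 1)) ((k + 1) * α / (n + 1))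
      else Icc (1 - (n - k) * (1 - β) / (n + 1)) (1 - (n - k - 1) * (1 - β) / (n + 1))) :
    (i.insertNth u y : Fin (n + 1) → ℝ) ∈ simplex (n + 1) := by
  have hn : (0 : ℝ) < n + 1 := by positivity
  have hk : ∀ k : Fin n, ((k : ℕ) : ℝ) + 1 ≤ n := fun k => by exact_mod_cast k.2
  have hβ' : 0 ≤ 1 - β := by linarith
  have low : ∀ k : Fin n, (k : ℕ) < i → 0 ≤ y k ∧ y k ≤ α := by
    intro k h
    have := hy k
    rw [if_pos h] at this
    refine ⟨le_trans (by positivity) this.1, this.2.trans ?_⟩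
    rw [div_le_iff₀ hn]
    nlinarith [hk k]
  have high : ∀ k : Fin n, ¬ (k : ℕ) < i → β ≤ y k ∧ y k ≤ 1 := by
    intro k h
    have := hy k
    rw [if_neg h] at this
    have h0 : (0 : ℝ) ≤ (k : ℕ) := by positivity
    refine ⟨le_trans ?_ this.1, this.2.trans ?_⟩
    · have : (n - k : ℝ) * (1 - β) / (n + 1) ≤ 1 - β := by
        rw [div_le_iff₀ hn]; nlinarith
      linarith
    · have : 0 ≤ (n - k - 1 : ℝ) * (1 - β) / (n + 1) :=
        div_nonneg (mul_nonneg (by linarith [hk k]) hβ') hn.le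
      linarith
  have hu1 := hu.1
  have hu2 := hu.2
  refine ⟨fun j => ?_, fun p q hpq => ?_⟩
  · rcases Fin.eq_self_or_eq_succAbove i j with rfl | ⟨k, rfl⟩
    · simp only [Fin.insertNth_apply_same]; exact ⟨by linarith, by linarith⟩
    · simp only [Fin.insertNth_apply_succAbove]
      by_cases h : (k : ℕ) < i
      · have := low k h; exact ⟨this.1, by linarith⟩
      · have := high k h; exact ⟨by linarith, this.2⟩
  · rcases Fin.eq_self_or_eq_succAbove i p with rfl | ⟨k, rfl⟩
    · rcases Fin.eq_self_or_eq_succAbove p q with rfl | ⟨l, rfl⟩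
      · exact le_rfl
      · simp only [Fin.insertNth_apply_same, Fin.insertNth_apply_succAbove]
        have hlt := lt_of_le_of_ne hpq (Fin.ne_succAbove _ _)
        rw [Fin.lt_succAbove_iff_le_castSucc, Fin.le_def, Fin.val_castSucc] at hlt
        linarith [(high l (by omega)).1]
    · rcases Fin.eq_self_or_eq_succAbove i q with rfl | ⟨l, rfl⟩
      · simp only [Fin.insertNth_apply_same, Fin.insertNth_apply_succAbove]
        have hlt := lt_of_le_of_ne hpq (Fin.succAbove_ne _ _)
        rw [Fin.succAbove_lt_iff_castSucc_lt, Fin.lt_def, Fin.val_castSucc] at hlt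
        linarith [(low k hlt).2]
      · simp only [Fin.insertNth_apply_succAbove]
        rw [Fin.succAbove_le_succAbove_iff] at hpq
        rcases hpq.eq_or_lt with rfl | hlt
        · exact le_rfl
        have hkl : ((k : ℕ) : ℝ) + 1 ≤ (l : ℕ) := by exact_mod_cast hlt
        by_cases hl : (l : ℕ) < i
        · have hk' : (k : ℕ) < i := by have : (k : ℕ) < l := hlt; omega
          have h1 := hy k
          have h2 := hy l
          rw [if_pos hk'] at h1
          rw [if_pos hl] at h2
          refine h1.2.trans (le_trans ?_ h2.1)
          gcongr
        · by_cases hk' : (k : ℕ) < i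
          · linarith [(low k hk').2, (high l hl).1]
          · have h1 := hy k
            have h2 := hy l
            rw [if_neg hk'] at h1
            rw [if_neg hl] at h2
            refine h1.2.trans (le_trans ?_ h2.1)
            have : (n - l : ℝ) * (1 - β) / (n + 1) ≤ (n - k - 1 : ℝ) * (1 - β) / (n + 1) := by
              gcongr ?_ / _
              exact mul_le_mul_of_nonneg_right (by linarith) hβ'
            linarith

/-- For s ≤ t the boxes of `insertNth_mem_simplex` have total volume s^i (1-t)^(n-i) / (n+1)^n, and
the missing factors (1-s)^(n-i) and t^i of the two weights are at most 1. -/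
theorem le_volume_slice_inter {n : ℕ} (i : Fin (n + 1)) {s t : ℝ} (hs : s ∈ Icc (0 : ℝ) 1)
    (ht : t ∈ Icc (0 : ℝ) 1) :
    ENNReal.ofReal (wt i (n - i) s * wt i (n - i) t) ≤ (n + 1 : ℝ≥0∞) ^ n *
      volume {y : Fin n → ℝ | (i.insertNth s y : Fin (n + 1) → ℝ) ∈ simplex (n + 1) ∧
        (i.insertNth t y : Fin (n + 1) → ℝ) ∈ simplex (n + 1)} := by
  wlog hst : s ≤ t generalizing s t
  · have := this ht hs (by linarith)
    rw [mul_comm (wt _ _ t)] at this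
    refine this.trans (le_of_eq ?_)
    congr 2
    ext y; exact and_comm
  have hn : (0 : ℝ) < n + 1 := by positivity
  set lo : Fin n → ℝ := fun k => if (k : ℕ) < i then k * s / (n + 1)
    else 1 - (n - k) * (1 - t) / (n + 1) with hlo
  set hi : Fin n → ℝ := fun k => if (k : ℕ) < i then (k + 1) * s / (n + 1)
    else 1 - (n - k - 1) * (1 - t) / (n + 1) with hhi
  have hsub : Icc lo hi ⊆ {y : Fin n → ℝ | (i.insertNth s y : Fin (n + 1) → ℝ) ∈ simplex (n + 1) ∧
        (i.insertNth t y : Fin (n + 1) → ℝ) ∈ simplex (n + 1)} := by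
    intro y hy
    have hy' : ∀ k : Fin n, y k ∈ if (k : ℕ) < i then Icc (k * s / (n + 1)) ((k + 1) * s / (n + 1))
      else Icc (1 - (n - k) * (1 - t) / (n + 1)) (1 - (n - k - 1) * (1 - t) / (n + 1)) := by
      intro k
      have h1 := hy.1 k
      have h2 := hy.2 k
      simp only [hlo, hhi] at h1 h2
      split_ifs with h
      · rw [if_pos h] at h1 h2; exact ⟨h1, h2⟩
      · rw [if_neg h] at h1 h2; exact ⟨h1, h2⟩
    exact ⟨insertNth_mem_simplex i hs.1 ht.2 ⟨le_rfl, hst⟩ hy',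
      insertNth_mem_simplex i hs.1 ht.2 ⟨hst, le_rfl⟩ hy'⟩
  have hvol : (n + 1 : ℝ≥0∞) ^ n * volume (Icc lo hi) =
      ENNReal.ofReal s ^ (i : ℕ) * ENNReal.ofReal (1 - t) ^ (n - i : ℕ) := by
    rw [Real.volume_Icc_pi, ← prod_ite_val_lt]
    have : (n + 1 : ℝ≥0∞) ^ n = ∏ _k : Fin n, (n + 1 : ℝ≥0∞) := by simp
    rw [this, ← Finset.prod_mul_distrib]
    refine Finset.prod_congr rfl fun k _ => ?_
    have e : (n + 1 : ℝ≥0∞) = ENNReal.ofReal (n + 1) := by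
      rw [ENNReal.ofReal_add (by positivity) zero_le_one]; simp
    rw [e, ← ENNReal.ofReal_mul hn.le]
    congr 1
    simp only [hlo, hhi]
    split_ifs <;> field_simp <;> ring
  refine le_trans ?_ (mul_le_mul_right (measure_mono hsub) _)
  have e0 : ENNReal.ofReal s ^ (i : ℕ) * ENNReal.ofReal (1 - t) ^ (n - i : ℕ) =
      ENNReal.ofReal (s ^ (i : ℕ) * (1 - t) ^ (n - i : ℕ)) := by
    rw [ENNReal.ofReal_mul (pow_nonneg hs.1 _), ENNReal.ofReal_pow hs.1,
      ENNReal.ofReal_pow (by linarith [ht.2])]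
  rw [hvol, e0]
  apply ENNReal.ofReal_le_ofReal
  have h1 : 0 ≤ 1 - t := by linarith [ht.2]
  have h2 : 0 ≤ 1 - s := by linarith [hs.2]
  have h3 : (1 - s) ^ (n - i : ℕ) ≤ 1 := pow_le_one₀ h2 (by linarith [hs.1])
  have h4 : t ^ (i : ℕ) ≤ 1 := pow_le_one₀ ht.1 ht.2
  have h5 : 0 ≤ s ^ (i : ℕ) := pow_nonneg hs.1 _
  have h6 : 0 ≤ (1 - t) ^ (n - i : ℕ) := pow_nonneg h1 _
  calc wt i (n - i) s * wt i (n - i) t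
      = (s ^ (i : ℕ) * (1 - t) ^ (n - i : ℕ)) * ((1 - s) ^ (n - i : ℕ) * t ^ (i : ℕ)) := by
        unfold wt; ring
    _ ≤ (s ^ (i : ℕ) * (1 - t) ^ (n - i : ℕ)) * 1 := by
        refine mul_le_mul_of_nonneg_left ?_ (mul_nonneg h5 h6)
        exact mul_le_one₀ h3 (pow_nonneg ht.1 _) h4
    _ = _ := mul_one _

/-- A function on the simplex controls its increments in each coordinate. -/
theorem lintegral_increment_le {n : ℕ} (i : Fin (n + 1)) {h : ℝ → ℝ}
    {g : (Fin (n + 1) → ℝ) → ℝ} (hg : Measurable g)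
    (hgh : ∀ s t y, g (i.insertNth s y) - g (i.insertNth t y) = h s - h t) :
    ∫⁻ t in Icc (0 : ℝ) 1, ∫⁻ s in Icc (0 : ℝ) 1,
      ENNReal.ofReal ((h s - h t) ^ 2) * ENNReal.ofReal (wt i (n - i) s * wt i (n - i) t) ≤
    4 * (n + 1 : ℝ≥0∞) ^ n * ∫⁻ x, ENNReal.ofReal (g x ^ 2) ∂(leb (n + 1)) := by
  set G : (Fin (n + 1) → ℝ) → ℝ≥0∞ :=
    (simplex (n + 1)).indicator fun x => ENNReal.ofReal (g x ^ 2) with hG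
  have hGm : Measurable G := (hg.pow_const 2).ennreal_ofReal.indicator (measurableSet_simplex _)
  set Γ : ℝ → ℝ≥0∞ := fun s => ∫⁻ y : Fin n → ℝ, G (i.insertNth s y) with hΓ
  have hsec : ∀ s, Measurable fun y : Fin n → ℝ => (i.insertNth s y : Fin (n + 1) → ℝ) := fun s =>
    (measurable_insertNth i).comp (measurable_const.prodMk measurable_id)
  have hΓm : Measurable Γ := (hGm.comp (measurable_insertNth i)).lintegral_prod_right'
  have htot : ∫⁻ x, ENNReal.ofReal (g x ^ 2) ∂(leb (n + 1)) = ∫⁻ s, Γ s := by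
    rw [leb, ← lintegral_indicator (measurableSet_simplex _), lintegral_insertNth i hGm]
  -- For each y admissible at both heights the increment of h is the increment of g, so its square
  -- is at most 2g² + 2g². Integration over these y replaces the volume by the slice integrals Γ.
  have hpt : ∀ s ∈ Icc (0 : ℝ) 1, ∀ t ∈ Icc (0 : ℝ) 1,
      ENNReal.ofReal ((h s - h t) ^ 2) * ENNReal.ofReal (wt i (n - i) s * wt i (n - i) t) ≤
      (n + 1 : ℝ≥0∞) ^ n * (2 * Γ s + 2 * Γ t) := by
    intro s hs t ht
    set S := {y : Fin n → ℝ | (i.insertNth s y : Fin (n + 1) → ℝ) ∈ simplex (n + 1) ∧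
        (i.insertNth t y : Fin (n + 1) → ℝ) ∈ simplex (n + 1)}
    have hS : MeasurableSet S :=
      (hsec s (measurableSet_simplex _)).inter (hsec t (measurableSet_simplex _))
    refine (mul_le_mul_right (le_volume_slice_inter i hs ht) _).trans ?_
    rw [mul_left_comm]
    refine mul_le_mul_right ?_ _
    have hGs : ∀ s, Measurable fun y : Fin n → ℝ => G (i.insertNth s y) :=
      fun s => hGm.comp (hsec s)
    simp only [hΓ]
    rw [← lintegral_indicator_const hS, ← lintegral_const_mul _ (hGs s),
      ← lintegral_const_mul _ (hGs t), ← lintegral_add_left ((hGs s).const_mul 2)]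
    refine lintegral_mono fun y => ?_
    by_cases hy : y ∈ S
    · rw [indicator_of_mem hy, hG, indicator_of_mem hy.1, indicator_of_mem hy.2, ← hgh s t y]
      have e2 : (2 : ℝ≥0∞) = ENNReal.ofReal 2 := by simp
      rw [e2, ← ENNReal.ofReal_mul zero_le_two, ← ENNReal.ofReal_mul zero_le_two,
        ← ENNReal.ofReal_add (by positivity) (by positivity)]
      apply ENNReal.ofReal_le_ofReal
      nlinarith [sq_nonneg (g (i.insertNth s y) + g (i.insertNth t y))]
    · rw [indicator_of_notMem hy]; exact zero_le
  have hI : ∫⁻ _ in Icc (0 : ℝ) 1, (1 : ℝ≥0∞) = 1 := by simp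
  have hvI : volume (Icc (0 : ℝ) 1) = 1 := by simp
  set T := ∫⁻ s, Γ s
  have hTle : ∫⁻ s in Icc (0 : ℝ) 1, Γ s ≤ T := setLIntegral_le_lintegral _ _
  calc _ ≤ ∫⁻ t in Icc (0 : ℝ) 1, ∫⁻ s in Icc (0 : ℝ) 1,
        (n + 1 : ℝ≥0∞) ^ n * (2 * Γ s + 2 * Γ t) :=
        setLIntegral_mono' measurableSet_Icc fun t ht =>
          setLIntegral_mono' measurableSet_Icc fun s hs => hpt s hs t ht
    _ ≤ ∫⁻ t in Icc (0 : ℝ) 1, (n + 1 : ℝ≥0∞) ^ n * (2 * T + 2 * Γ t) := by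
        refine lintegral_mono fun t => ?_
        rw [lintegral_const_mul _ ((hΓm.const_mul 2).add_const _),
          lintegral_add_left (hΓm.const_mul 2), lintegral_const_mul _ hΓm, lintegral_const,
          Measure.restrict_apply_univ, hvI, mul_one]
        gcongr
    _ ≤ (n + 1 : ℝ≥0∞) ^ n * (2 * T + 2 * T) := by
        rw [lintegral_const_mul _ ((hΓm.const_mul 2).const_add _),
          lintegral_add_left measurable_const, lintegral_const_mul _ hΓm, lintegral_const,
          Measure.restrict_apply_univ, hvI, mul_one]
        gcongr
    _ = _ := by rw [htot]; ring

end AdditiveExpSeries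

/-! ### Marginal domination and oscillation bounds for additive polynomials. -/

namespace AdditiveExpSeries

instance isFiniteMeasure_leb (d : ℕ) : IsFiniteMeasure (leb d) := by
  constructor
  rw [leb, Measure.restrict_apply_univ]
  refine (measure_mono (simplex_subset_Icc d)).trans_lt ?_
  exact (isCompact_Icc (a := (0 : Fin d → ℝ)) (b := 1)).measure_lt_top

theorem ae_mem_simplex (d : ℕ) : ∀ᵐ x ∂(leb d), x ∈ simplex d :=
  ae_restrict_mem (measurableSet_simplex d)

theorem ae_leb_of_ae {d : ℕ} (i : Fin d) {Q : ℝ → Prop}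
    (h : ∀ᵐ t ∂(volume.restrict (Icc (0 : ℝ) 1)), Q t) : ∀ᵐ x ∂(leb d), Q (x i) := by
  obtain ⟨n, rfl⟩ : ∃ n, d = n + 1 := ⟨d - 1, by have := i.2; omega⟩
  have hac : (leb (n + 1)).map (fun x => x i) ≪ volume.restrict (Icc (0 : ℝ) 1) := by
    refine Measure.AbsolutelyContinuous.mk fun s hs h0 => ?_
    rw [Measure.map_apply (measurable_pi_apply i) hs,
      ← lintegral_indicator_one (measurable_pi_apply i hs)]
    have := lintegral_apply_leb_le i (measurable_one.indicator hs : Measurable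
      (s.indicator (1 : ℝ → ℝ≥0∞)))
    refine le_antisymm (this.trans (le_of_eq ?_)) zero_le
    refine (lintegral_congr_ae ?_).trans lintegral_zero
    filter_upwards [measure_eq_zero_iff_ae_notMem.1 h0] with t ht
    simp [ht]
  exact ae_of_ae_map (measurable_pi_apply i).aemeasurable (hac.ae_le h)

theorem ofReal_intervalIntegral_eq {f : ℝ → ℝ} (hf : IntervalIntegrable f volume 0 1)
    (h0 : ∀ t ∈ Icc (0 : ℝ) 1, 0 ≤ f t) :
    ENNReal.ofReal (∫ t in (0 : ℝ)..1, f t) = ∫⁻ t in Icc (0 : ℝ) 1, ENNReal.ofReal (f t) := by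
  rw [intervalIntegral.integral_of_le zero_le_one, ← integral_Icc_eq_integral_Ioc,
    ofReal_integral_eq_lintegral_ofReal
      ((intervalIntegrable_iff_integrableOn_Icc_of_le zero_le_one).1 hf)
      ((ae_restrict_iff' measurableSet_Icc).2 (ae_of_all _ h0))]

theorem integral_sq_apply_leb_le {d : ℕ} (i : Fin d) {u : ℝ → ℝ} (hu : Measurable u) {K : ℝ}
    (hK : ∀ t ∈ Icc (0 : ℝ) 1, |u t| ≤ K) :
    ∫ x, u (x i) ^ 2 ∂(leb d) ≤ ∫ t in (0 : ℝ)..1, u t ^ 2 * wt (i : ℕ) (d - 1 - (i : ℕ)) t := by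
  obtain ⟨n, rfl⟩ : ∃ n, d = n + 1 := ⟨d - 1, by have := i.2; omega⟩
  have hi : IntervalIntegrable (fun t => u t ^ 2 * wt (i : ℕ) (n - (i : ℕ)) t) volume 0 1 := by
    rw [intervalIntegrable_iff_integrableOn_Icc_of_le zero_le_one]
    refine Measure.integrableOn_of_bounded (M := K ^ 2) (by simp)
      ((hu.pow_const 2).mul (continuous_wt _ _).measurable).aestronglyMeasurable ?_
    refine (ae_restrict_iff' measurableSet_Icc).2 (ae_of_all _ fun t ht => ?_)
    rw [Real.norm_eq_abs, abs_mul, abs_of_nonneg (wt_nonneg ht), abs_pow]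
    have h1 := pow_le_pow_left₀ (abs_nonneg _) (hK t ht) 2
    calc |u t| ^ 2 * wt _ _ t ≤ K ^ 2 * 1 :=
          mul_le_mul h1 (wt_le_one ht) (wt_nonneg ht) (sq_nonneg K)
      _ = K ^ 2 := mul_one _
  have h0 : ∀ t ∈ Icc (0 : ℝ) 1, 0 ≤ u t ^ 2 * wt (i : ℕ) (n - (i : ℕ)) t := fun t ht =>
    mul_nonneg (sq_nonneg _) (wt_nonneg ht)
  simp only [Nat.add_sub_cancel]
  have hum : Measurable fun x : Fin (n + 1) → ℝ => u (x i) ^ 2 :=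
    (hu.comp (measurable_pi_apply i)).pow_const 2
  rw [integral_eq_lintegral_of_nonneg_ae (ae_of_all _ fun x => sq_nonneg _)
    hum.aestronglyMeasurable]
  refine ENNReal.toReal_le_of_le_ofReal (intervalIntegral.integral_nonneg zero_le_one h0) ?_
  rw [ofReal_intervalIntegral_eq hi h0]
  refine (lintegral_apply_leb_le i (hu.pow_const 2).ennreal_ofReal).trans (le_of_eq ?_)
  refine lintegral_congr fun t => ?_
  rw [← ENNReal.ofReal_mul (sq_nonneg _)]

/-- A polynomial additive function on the simplex controls the oscillation of its components. -/
theorem sq_sub_eval_le (d : ℕ) : ∃ C : ℝ, 0 < C ∧ ∀ (p : Fin d → Polynomial ℝ) (m : Fin d → ℕ),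
    (∀ i, 1 ≤ m i) → (∀ i, (p i).natDegree ≤ m i) → ∀ (c : ℝ) (i : Fin d),
    ∀ s ∈ Icc (0 : ℝ) 1, ∀ t ∈ Icc (0 : ℝ) 1, ((p i).eval s - (p i).eval t) ^ 2 ≤
      C * (m i : ℝ) ^ (2 * d) * ∫ x, (∑ j, (p j).eval (x j) - c) ^ 2 ∂(leb d) := by
  rcases d with _ | n
  · exact ⟨1, one_pos, fun _ _ _ _ _ i => i.elim0⟩
  set K : ℝ := 4 * 64 ^ (n + 1) with hK
  set w : Fin (n + 1) → ℝ := fun i => ∫ t in (0 : ℝ)..1, wt (i : ℕ) (n - (i : ℕ)) t with hw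
  have hw0 : ∀ i, 0 < w i := fun i => by
    simpa using integral_sq_mul_wt_pos one_ne_zero (i : ℕ) (n - (i : ℕ))
  set C : ℝ := ∑ i, 4 * K * (4 * (n + 1) ^ n) / w i with hC
  have hCi : ∀ i, 4 * K * (4 * (n + 1) ^ n) / w i ≤ C := fun i =>
    Finset.single_le_sum (f := fun i => 4 * K * (4 * (n + 1) ^ n) / w i)
      (fun j _ => by have := hw0 j; positivity) (Finset.mem_univ i)
  have hC0 : 0 < C := lt_of_lt_of_le (by have := hw0 0; positivity) (hCi 0)
  refine ⟨C, hC0, fun p m hm hp c i s hs t ht => ?_⟩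
  set g : (Fin (n + 1) → ℝ) → ℝ := fun x => ∑ j, (p j).eval (x j) - c with hg
  have hgc : Continuous g :=
    (continuous_finsetSum _ fun j _ => (p j).continuous.comp (continuous_apply j)).sub
      continuous_const
  have hinc := lintegral_increment_le i (h := fun t => (p i).eval t) (g := g) hgc.measurable (by
    intro s t y
    simp only [hg]
    rw [Fin.sum_univ_succAbove _ i, Fin.sum_univ_succAbove _ i]
    simp)
  have hgint : Integrable (fun x => g x ^ 2) (leb (n + 1)) :=
    ((hgc.pow 2).continuousOn.integrableOn_compact isCompact_Icc).mono_set (simplex_subset_Icc _)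
  rw [← ofReal_integral_eq_lintegral_ofReal hgint (ae_of_all _ fun x => sq_nonneg _)] at hinc
  set J := ∫ x, g x ^ 2 ∂(leb (n + 1)) with hJ
  have hJ0 : 0 ≤ J := integral_nonneg fun x => sq_nonneg _
  set a : ℕ := (i : ℕ)
  have hai : a + 1 ≤ n + 1 := i.2
  set M : ℝ := 4 * K * (m i : ℝ) ^ (2 * (n + 1)) with hM
  have hM0 : 0 ≤ M := by positivity
  -- Nikolskii's inequality with D = d is applied to p_i - p_i(t₀) for every base point t₀, and
  -- later averaged over t₀ against the weight. Only increments occur, so additive constants in the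
  -- components play no role.
  have hpt : ∀ t₀ ∈ Icc (0 : ℝ) 1,
      ENNReal.ofReal (((p i).eval s - (p i).eval t) ^ 2) * ENNReal.ofReal (wt a (n - a) t₀) ≤
      ENNReal.ofReal M * ∫⁻ s in Icc (0 : ℝ) 1, ENNReal.ofReal (((p i).eval s - (p i).eval t₀) ^ 2)
        * ENNReal.ofReal (wt a (n - a) s * wt a (n - a) t₀) := by
    intro t₀ ht₀
    set H := ∫ s in (0 : ℝ)..1, ((p i).eval s - (p i).eval t₀) ^ 2 * wt a (n - a) s with hH
    have hnik : ∀ s ∈ Icc (0 : ℝ) 1, ((p i).eval s - (p i).eval t₀) ^ 2 ≤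
        K * (m i : ℝ) ^ (2 * (n + 1)) * H := by
      intro s hs
      have := sq_eval_le_integral (p := p i - Polynomial.C ((p i).eval t₀)) (a := a) (b := n - a)
        (D := n + 1) (hm i) (by rw [Polynomial.natDegree_sub_C]; exact hp i) hai (by omega) hs
      simpa using this
    have h1 : ((p i).eval s - (p i).eval t) ^ 2 ≤ M * H := by
      have h2 := hnik s hs
      have h3 := hnik t ht
      rw [hM]
      nlinarith [sq_nonneg (((p i).eval s - (p i).eval t₀) + ((p i).eval t - (p i).eval t₀))]
    have h4 : ENNReal.ofReal H = ∫⁻ s in Icc (0 : ℝ) 1,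
        ENNReal.ofReal (((p i).eval s - (p i).eval t₀) ^ 2 * wt a (n - a) s) := by
      refine ofReal_intervalIntegral_eq (Continuous.intervalIntegrable ?_ _ _)
        fun s hs => mul_nonneg (sq_nonneg _) (wt_nonneg hs)
      exact (((p i).continuous.sub continuous_const).pow 2).mul (continuous_wt _ _)
    have h5 : ∫⁻ s in Icc (0 : ℝ) 1, ENNReal.ofReal (((p i).eval s - (p i).eval t₀) ^ 2)
        * ENNReal.ofReal (wt a (n - a) s * wt a (n - a) t₀) =
        ENNReal.ofReal H * ENNReal.ofReal (wt a (n - a) t₀) := by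
      rw [h4, ← lintegral_mul_const]
      · refine setLIntegral_congr_fun measurableSet_Icc fun s hs => ?_
        rw [ENNReal.ofReal_mul (wt_nonneg hs), ENNReal.ofReal_mul (sq_nonneg _), mul_assoc]
      · exact ((((p i).continuous.sub continuous_const).pow 2).mul
          (continuous_wt _ _)).measurable.ennreal_ofReal
    rw [h5, ← mul_assoc, ← ENNReal.ofReal_mul hM0]
    exact mul_le_mul_left (ENNReal.ofReal_le_ofReal h1) _
  have hmeas : Measurable fun t₀ => ∫⁻ s in Icc (0 : ℝ) 1,
      ENNReal.ofReal (((p i).eval s - (p i).eval t₀) ^ 2) *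
        ENNReal.ofReal (wt a (n - a) s * wt a (n - a) t₀) := by
    have : Measurable fun q : ℝ × ℝ => ENNReal.ofReal (((p i).eval q.2 - (p i).eval q.1) ^ 2) *
        ENNReal.ofReal (wt a (n - a) q.2 * wt a (n - a) q.1) := by
      have h1 : Continuous fun q : ℝ × ℝ => ((p i).eval q.2 - (p i).eval q.1) ^ 2 :=
        (((p i).continuous.comp continuous_snd).sub ((p i).continuous.comp continuous_fst)).pow 2
      have h2 : Continuous fun q : ℝ × ℝ => wt a (n - a) q.2 * wt a (n - a) q.1 :=
        ((continuous_wt _ _).comp continuous_snd).mul ((continuous_wt _ _).comp continuous_fst)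
      exact h1.measurable.ennreal_ofReal.mul h2.measurable.ennreal_ofReal
    exact this.lintegral_prod_right'
  have h6 : ENNReal.ofReal (((p i).eval s - (p i).eval t) ^ 2) * ENNReal.ofReal (w i) ≤
      ENNReal.ofReal M * (4 * (n + 1 : ℝ≥0∞) ^ n * ENNReal.ofReal J) := by
    rw [hw, ofReal_intervalIntegral_eq ((continuous_wt _ _).intervalIntegrable _ _)
      fun t ht => wt_nonneg ht, ← lintegral_const_mul _ (continuous_wt _ _).measurable.ennreal_ofReal]
    refine le_trans (setLIntegral_mono' measurableSet_Icc hpt) ?_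
    rw [lintegral_const_mul _ hmeas]
    exact mul_le_mul_right hinc _
  have e1 : (4 * (n + 1 : ℝ≥0∞) ^ n) = ENNReal.ofReal (4 * (n + 1) ^ n) := by
    rw [ENNReal.ofReal_mul (by norm_num), ENNReal.ofReal_pow (by positivity),
      ENNReal.ofReal_add (by positivity) zero_le_one]; simp
  rw [e1, ← ENNReal.ofReal_mul (sq_nonneg _), ← ENNReal.ofReal_mul (by positivity),
    ← ENNReal.ofReal_mul hM0, ENNReal.ofReal_le_ofReal_iff (by positivity)] at h6
  have h7 : ((p i).eval s - (p i).eval t) ^ 2 ≤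
      4 * K * (4 * (n + 1) ^ n) / w i * (m i : ℝ) ^ (2 * (n + 1)) * J := by
    rw [← div_le_div_iff_of_pos_right (inv_pos.2 (hw0 i)), div_inv_eq_mul]
    refine h6.trans (le_of_eq ?_)
    have := (hw0 i).ne'
    rw [hM]; field_simp
  refine h7.trans ?_
  have := hCi i
  gcongr

/-- Uniform oscillation bound for polynomial additive functions on the simplex. -/
theorem sq_sub_sum_eval_le (d : ℕ) : ∃ C : ℝ, 0 < C ∧
    ∀ (p : Fin d → Polynomial ℝ) (m : Fin d → ℕ),
    (∀ i, 1 ≤ m i) → (∀ i, (p i).natDegree ≤ m i) → ∀ (c : ℝ),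
    ∀ x ∈ simplex d, ∀ y ∈ simplex d, (∑ j, (p j).eval (x j) - ∑ j, (p j).eval (y j)) ^ 2 ≤
      C * (∑ i, (m i : ℝ)) ^ (2 * d) * ∫ x, (∑ j, (p j).eval (x j) - c) ^ 2 ∂(leb d) := by
  obtain ⟨C, hC, h⟩ := sq_sub_eval_le d
  refine ⟨d ^ 2 * C + 1, by positivity, fun p m hm hp c x hx y hy => ?_⟩
  set J := ∫ x, (∑ j, (p j).eval (x j) - c) ^ 2 ∂(leb d)
  have hJ0 : 0 ≤ J := integral_nonneg fun x => sq_nonneg _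
  have hS : 0 ≤ ∑ i, (m i : ℝ) := Finset.sum_nonneg fun _ _ => by positivity
  rw [← Finset.sum_sub_distrib]
  refine (sq_sum_le_card_mul_sum_sq).trans ?_
  have h1 : ∀ i : Fin d, ((p i).eval (x i) - (p i).eval (y i)) ^ 2 ≤
      C * (∑ i, (m i : ℝ)) ^ (2 * d) * J := by
    intro i
    refine (h p m hm hp c i _ (hx.1 i) _ (hy.1 i)).trans ?_
    have : (m i : ℝ) ≤ ∑ i, (m i : ℝ) :=
      Finset.single_le_sum (f := fun i => (m i : ℝ)) (fun _ _ => by positivity) (Finset.mem_univ i)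
    gcongr
  have h2 := Finset.sum_le_sum fun i (_ : i ∈ Finset.univ) => h1 i
  rw [Finset.sum_const, Finset.card_univ, Fintype.card_fin, nsmul_eq_mul] at h2
  rw [Finset.card_univ, Fintype.card_fin]
  calc _ ≤ (d : ℝ) * (d * (C * (∑ i, (m i : ℝ)) ^ (2 * d) * J)) := by gcongr
    _ = (d ^ 2 * C) * (∑ i, (m i : ℝ)) ^ (2 * d) * J := by ring
    _ ≤ _ := by gcongr; linarith

end AdditiveExpSeries

namespace AdditiveExpSeries

/-! ### Essentially bounded functions and exponential families -/

/-- Almost everywhere measurable and essentially bounded real functions. -/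
structure IsAEBounded {E : Type*} [MeasurableSpace E] (μ : Measure E) (g : E → ℝ) : Prop where
  aemeasurable : AEMeasurable g μ
  bounded : ∃ B : ℝ, ∀ᵐ x ∂μ, |g x| ≤ B

namespace IsAEBounded

variable {E : Type*} [MeasurableSpace E] {μ ν : Measure E} {f g : E → ℝ}

theorem const (c : ℝ) : IsAEBounded μ fun _ => c :=
  ⟨aemeasurable_const, |c|, ae_of_all _ fun _ => le_rfl⟩

theorem add (hf : IsAEBounded μ f) (hg : IsAEBounded μ g) : IsAEBounded μ fun x => f x + g x := by
  obtain ⟨A, hA⟩ := hf.bounded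
  obtain ⟨B, hB⟩ := hg.bounded
  refine ⟨hf.aemeasurable.add hg.aemeasurable, A + B, ?_⟩
  filter_upwards [hA, hB] with x h1 h2
  exact (abs_add_le _ _).trans (add_le_add h1 h2)

theorem mul (hf : IsAEBounded μ f) (hg : IsAEBounded μ g) : IsAEBounded μ fun x => f x * g x := by
  obtain ⟨A, hA⟩ := hf.bounded
  obtain ⟨B, hB⟩ := hg.bounded
  refine ⟨hf.aemeasurable.mul hg.aemeasurable, A * B, ?_⟩
  filter_upwards [hA, hB] with x h1 h2
  rw [abs_mul]
  exact mul_le_mul h1 h2 (abs_nonneg _) ((abs_nonneg _).trans h1)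

theorem const_mul (c : ℝ) (hf : IsAEBounded μ f) : IsAEBounded μ fun x => c * f x :=
  (const c).mul hf

theorem neg (hf : IsAEBounded μ f) : IsAEBounded μ fun x => -f x := by
  simpa using hf.const_mul (-1)

theorem sub (hf : IsAEBounded μ f) (hg : IsAEBounded μ g) : IsAEBounded μ fun x => f x - g x := by
  simpa [sub_eq_add_neg] using hf.add hg.neg

theorem sq (hf : IsAEBounded μ f) : IsAEBounded μ fun x => f x ^ 2 := by
  simpa [pow_two] using hf.mul hf

theorem exp (hf : IsAEBounded μ f) : IsAEBounded μ fun x => Real.exp (f x) := by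
  obtain ⟨A, hA⟩ := hf.bounded
  refine ⟨hf.aemeasurable.exp, Real.exp A, ?_⟩
  filter_upwards [hA] with x hx
  rw [abs_of_pos (Real.exp_pos _)]
  exact Real.exp_le_exp.2 ((le_abs_self _).trans hx)

theorem sum {ι : Type*} (s : Finset ι) {F : ι → E → ℝ} (hF : ∀ i ∈ s, IsAEBounded μ (F i)) :
    IsAEBounded μ fun x => ∑ i ∈ s, F i x := by
  classical
  induction s using Finset.induction_on with
  | empty => simpa using const (μ := μ) 0
  | insert a s ha ih =>
    simp_rw [Finset.sum_insert ha]
    exact (hF a (Finset.mem_insert_self _ _)).add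
      (ih fun i hi => hF i (Finset.mem_insert_of_mem hi))

theorem dotProduct {ι : Type*} [Fintype ι] {Φ : E → ι → ℝ}
    (hΦ : ∀ p, IsAEBounded μ fun x => Φ x p) (θ : ι → ℝ) :
    IsAEBounded μ fun x => θ ⬝ᵥ Φ x :=
  sum _ fun p _ => (hΦ p).const_mul (θ p)

theorem integrable [IsFiniteMeasure μ] (hf : IsAEBounded μ f) : Integrable f μ := by
  obtain ⟨A, hA⟩ := hf.bounded
  exact Integrable.of_bound hf.aemeasurable.aestronglyMeasurable A hA

theorem mono (h : ν ≪ μ) (hf : IsAEBounded μ f) : IsAEBounded ν f :=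
  ⟨hf.aemeasurable.mono_ac h, hf.bounded.imp fun _ hA => h.ae_le hA⟩

end IsAEBounded

section ExpFamily

variable {E : Type*} [MeasurableSpace E] {μ : Measure E} [IsFiniteMeasure μ]

theorem isProbabilityMeasure_tilted_of_isAEBounded [NeZero μ] {g : E → ℝ} (hg : IsAEBounded μ g) :
    IsProbabilityMeasure (μ.tilted g) := isProbabilityMeasure_tilted hg.exp.integrable

/-- The gradient inequality for the log-Laplace functional, by Jensen's inequality. -/
theorem integral_tilted_sub_le [NeZero μ] {f g : E → ℝ} (hf : IsAEBounded μ f)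
    (hg : IsAEBounded μ g) :
    ∫ x, (g x - f x) ∂(μ.tilted f) ≤
      Real.log (∫ x, Real.exp (g x) ∂μ) - Real.log (∫ x, Real.exp (f x) ∂μ) := by
  have := isProbabilityMeasure_tilted_of_isAEBounded hf
  have hb := (hg.sub hf).mono (tilted_absolutelyContinuous μ f)
  have hpf := integral_exp_pos hf.exp.integrable
  have hpg := integral_exp_pos hg.exp.integrable
  have hj : Real.exp (∫ x, (g x - f x) ∂(μ.tilted f)) ≤ ∫ x, Real.exp (g x - f x) ∂(μ.tilted f) :=
    convexOn_exp.map_integral_le Real.continuous_exp.continuousOn isClosed_univ (by simp)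
      hb.integrable hb.exp.integrable
  rw [integral_exp_tilted f (fun x => g x - f x)] at hj
  simp only [Pi.add_apply, add_sub_cancel] at hj
  rw [← Real.log_div hpg.ne' hpf.ne', Real.le_log_iff_exp_le (div_pos hpg hpf)]
  exact hj

/-- Equality in Jensen: with Y = g - f - c, the nonnegative function exp Y - 1 - Y has zero
integral, hence vanishes almost everywhere, which forces Y = 0. -/
theorem ae_eq_const_of_integral_tilted_sub_eq [NeZero μ] {f g : E → ℝ} (hf : IsAEBounded μ f)
    (hg : IsAEBounded μ g) (h : ∫ x, (g x - f x) ∂(μ.tilted f) =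
      Real.log (∫ x, Real.exp (g x) ∂μ) - Real.log (∫ x, Real.exp (f x) ∂μ)) :
    ∀ᵐ x ∂μ, g x - f x = ∫ x, (g x - f x) ∂(μ.tilted f) := by
  have := isProbabilityMeasure_tilted_of_isAEBounded hf
  have hb := (hg.sub hf).mono (tilted_absolutelyContinuous μ f)
  have hpf := integral_exp_pos hf.exp.integrable
  have hpg := integral_exp_pos hg.exp.integrable
  set c := ∫ x, (g x - f x) ∂(μ.tilted f) with hc
  have hE : ∫ x, Real.exp (g x - f x) ∂(μ.tilted f) = Real.exp c := by
    rw [integral_exp_tilted f (fun x => g x - f x)]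
    simp only [Pi.add_apply, add_sub_cancel]
    rw [h, Real.exp_sub, Real.exp_log hpg, Real.exp_log hpf]
  have hcb : IsAEBounded (μ.tilted f) fun x => (g x - f x) - c := hb.sub (.const c)
  have h0 : ∫ x, (Real.exp (g x - f x - c) - (1 + (g x - f x - c))) ∂(μ.tilted f) = 0 := by
    rw [integral_sub hcb.exp.integrable ((IsAEBounded.const 1).add hcb).integrable,
      integral_add (integrable_const _) hcb.integrable,
      integral_sub hb.integrable (integrable_const _)]
    simp_rw [Real.exp_sub _ c]
    rw [integral_div, hE, ← hc]
    simp
  have h1 := (integral_eq_zero_iff_of_nonneg (μ := μ.tilted f) (fun x => by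
    simp only [Pi.zero_apply]
    linarith [Real.add_one_le_exp (g x - f x - c)])
    (hcb.exp.sub ((IsAEBounded.const 1).add hcb)).integrable).1 h0
  refine (absolutelyContinuous_tilted hf.exp.integrable).ae_le ?_
  filter_upwards [h1] with x hx
  by_contra hne
  have := Real.add_one_lt_exp (sub_ne_zero.2 hne)
  simp only [Pi.zero_apply] at hx
  linarith

variable {ι : Type*} [Fintype ι] {Φ : E → ι → ℝ}

/-- The mean map of the exponential family with statistic `Φ`. -/
noncomputable def expMean (μ : Measure E) (Φ : E → ι → ℝ) (θ : ι → ℝ) : ι → ℝ :=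
  fun p => ∫ x, Φ x p ∂(μ.tilted fun x => θ ⬝ᵥ Φ x)

/-- The log-partition function of the exponential family with statistic `Φ`. -/
noncomputable def logPartition (μ : Measure E) (Φ : E → ι → ℝ) (θ : ι → ℝ) : ℝ :=
  Real.log (∫ x, Real.exp (θ ⬝ᵥ Φ x) ∂μ)

theorem integral_dotProduct_eq {ν : Measure E} [IsFiniteMeasure ν]
    (hΦ : ∀ p, IsAEBounded ν fun x => Φ x p) (u : ι → ℝ) :
    ∫ x, u ⬝ᵥ Φ x ∂ν = u ⬝ᵥ fun p => ∫ x, Φ x p ∂ν := by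
  simp only [dotProduct]
  rw [integral_finsetSum _ fun p _ => ((hΦ p).const_mul (u p)).integrable]
  simp_rw [integral_const_mul]

theorem integral_tilted_dotProduct [NeZero μ] (hΦ : ∀ p, IsAEBounded μ fun x => Φ x p)
    (θ θ' : ι → ℝ) :
    ∫ x, (θ' ⬝ᵥ Φ x - θ ⬝ᵥ Φ x) ∂(μ.tilted fun x => θ ⬝ᵥ Φ x) = (θ' - θ) ⬝ᵥ expMean μ Φ θ := by
  have := isProbabilityMeasure_tilted_of_isAEBounded (IsAEBounded.dotProduct hΦ θ)
  simp_rw [← sub_dotProduct]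
  exact integral_dotProduct_eq (fun p => (hΦ p).mono (tilted_absolutelyContinuous _ _)) _

theorem dotProduct_expMean_le [NeZero μ] (hΦ : ∀ p, IsAEBounded μ fun x => Φ x p)
    (θ θ' : ι → ℝ) :
    (θ' - θ) ⬝ᵥ expMean μ Φ θ ≤ logPartition μ Φ θ' - logPartition μ Φ θ := by
  rw [← integral_tilted_dotProduct hΦ]
  exact integral_tilted_sub_le (IsAEBounded.dotProduct hΦ θ) (IsAEBounded.dotProduct hΦ θ')

/-- Equal means at θ and θ' turn the two gradient inequalities into equalities, so (θ' - θ)·Φ is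
almost everywhere constant. -/
theorem expMean_injective [NeZero μ] (hΦ : ∀ p, IsAEBounded μ fun x => Φ x p)
    (hnd : ∀ (u : ι → ℝ) (c : ℝ), (∀ᵐ x ∂μ, u ⬝ᵥ Φ x = c) → u = 0) :
    Function.Injective (expMean μ Φ) := by
  intro θ θ' h
  have h1 := dotProduct_expMean_le hΦ θ θ'
  have h2 := dotProduct_expMean_le hΦ θ' θ
  rw [← h, ← neg_sub, neg_dotProduct] at h2
  have h3 := ae_eq_const_of_integral_tilted_sub_eq (IsAEBounded.dotProduct hΦ θ)
    (IsAEBounded.dotProduct hΦ θ') (by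
      rw [integral_tilted_dotProduct hΦ]
      exact le_antisymm h1 (by linarith : logPartition μ Φ θ' - logPartition μ Φ θ ≤ _))
  simp_rw [← sub_dotProduct] at h3
  exact (sub_eq_zero.1 (hnd _ _ h3)).symm

/-- A point where the mean map takes the value `α` minimises `ψ(θ) - θ · α`. -/
theorem logPartition_sub_le [NeZero μ] (hΦ : ∀ p, IsAEBounded μ fun x => Φ x p)
    {θ α : ι → ℝ} (h : expMean μ Φ θ = α) (θ' : ι → ℝ) :
    logPartition μ Φ θ - θ ⬝ᵥ α ≤ logPartition μ Φ θ' - θ' ⬝ᵥ α := by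
  have := dotProduct_expMean_le hΦ θ θ'
  rw [h, sub_dotProduct] at this
  linarith

/-- Dominated convergence on a bounded set of parameters. A general H covers both the exponential
and the positive part needed for coercivity. -/
theorem continuous_integral_mul_comp_dotProduct (hΦ : ∀ p, IsAEBounded μ fun x => Φ x p)
    {G : E → ℝ} (hG : IsAEBounded μ G) {H : ℝ → ℝ} (hH : Continuous H) :
    Continuous fun θ : ι → ℝ => ∫ x, G x * H (θ ⬝ᵥ Φ x) ∂μ := by
  rw [continuous_iff_continuousAt]
  intro θ₀
  choose B hB using fun p => (hΦ p).bounded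
  obtain ⟨A, hA⟩ := hG.bounded
  set R := ∑ p, (‖θ₀‖ + 1) * B p with hR
  obtain ⟨K, hK⟩ := (isCompact_Icc (a := -R) (b := R)).exists_bound_of_continuousOn hH.continuousOn
  refine continuousAt_of_dominated (bound := fun _ => A * K) ?_ ?_ (integrable_const _) ?_
  · refine Eventually.of_forall fun θ => (hG.aemeasurable.mul ?_).aestronglyMeasurable
    exact hH.measurable.comp_aemeasurable (IsAEBounded.dotProduct hΦ θ).aemeasurable
  · filter_upwards [Metric.ball_mem_nhds θ₀ one_pos] with θ hθ
    filter_upwards [hA, ae_all_iff.2 hB] with x hx hxB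
    rw [norm_mul]
    refine mul_le_mul hx (hK _ ?_) (norm_nonneg _) ((abs_nonneg _).trans hx)
    rw [mem_Icc, ← abs_le]
    refine (Finset.abs_sum_le_sum_abs _ _).trans (Finset.sum_le_sum fun p _ => ?_)
    rw [abs_mul]
    have h1 : ‖θ‖ ≤ ‖θ₀‖ + 1 := by
      have := norm_sub_norm_le θ θ₀
      rw [Metric.mem_ball, dist_eq_norm] at hθ
      linarith
    exact mul_le_mul ((norm_le_pi_norm θ p).trans h1) (hxB p) (abs_nonneg _) (by positivity)
  · exact ae_of_all _ fun x => by
      have : Continuous fun θ : ι → ℝ => θ ⬝ᵥ Φ x :=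
        continuous_finsetSum _ fun p _ => (continuous_apply p).mul continuous_const
      exact (continuous_const.mul (hH.comp this)).continuousAt

theorem continuous_expMean [NeZero μ] (hΦ : ∀ p, IsAEBounded μ fun x => Φ x p) :
    Continuous (expMean μ Φ) := by
  refine continuous_pi fun p => ?_
  have h1 := continuous_integral_mul_comp_dotProduct hΦ (hΦ p) Real.continuous_exp
  have h2 := continuous_integral_mul_comp_dotProduct hΦ (IsAEBounded.const (μ := μ) 1)
    Real.continuous_exp
  simp only [one_mul] at h2
  have h3 : ∀ θ, expMean μ Φ θ p =
      (∫ x, Φ x p * Real.exp (θ ⬝ᵥ Φ x) ∂μ) / ∫ x, Real.exp (θ ⬝ᵥ Φ x) ∂μ := by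
    intro θ
    rw [expMean, integral_tilted, ← integral_div]
    refine integral_congr_ae (ae_of_all _ fun x => ?_)
    simp only [smul_eq_mul]; ring
  simp_rw [h3]
  exact h1.div h2 fun θ => (integral_exp_pos (IsAEBounded.dotProduct hΦ θ).exp.integrable).ne'

/-- Coercivity: e^t ≥ max(t,0), and the integral of max(u·Φ,0) is positively homogeneous in u, with
a positive minimum on the unit sphere by compactness. -/
theorem exists_isMin_integral_exp (hΦ : ∀ p, IsAEBounded μ fun x => Φ x p)
    (hpos : ∀ u : ι → ℝ, u ≠ 0 → ¬ ∀ᵐ x ∂μ, u ⬝ᵥ Φ x ≤ 0) :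
    ∃ θ : ι → ℝ, ∀ θ', ∫ x, Real.exp (θ ⬝ᵥ Φ x) ∂μ ≤ ∫ x, Real.exp (θ' ⬝ᵥ Φ x) ∂μ := by
  rcases isEmpty_or_nonempty ι with hι | hι
  · exact ⟨0, fun θ' => by rw [Subsingleton.elim θ' 0]⟩
  have hF := continuous_integral_mul_comp_dotProduct hΦ (IsAEBounded.const (μ := μ) 1)
    Real.continuous_exp
  have hh := continuous_integral_mul_comp_dotProduct hΦ (IsAEBounded.const (μ := μ) 1)
    (H := fun t => max t 0) (by fun_prop)
  simp only [one_mul] at hF hh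
  have hmax : ∀ θ : ι → ℝ, IsAEBounded μ fun x => max (θ ⬝ᵥ Φ x) 0 := fun θ => by
    have h := IsAEBounded.dotProduct hΦ θ
    refine ⟨h.aemeasurable.max aemeasurable_const, h.bounded.imp fun B hB => ?_⟩
    filter_upwards [hB] with x hx
    rw [abs_of_nonneg (le_max_right _ _)]
    exact max_le ((le_abs_self _).trans hx) ((abs_nonneg _).trans hx)
  obtain ⟨u₀, hu₀, hmin⟩ := (isCompact_sphere (0 : ι → ℝ) 1).exists_isMinOn
    (NormedSpace.sphere_nonempty.2 zero_le_one) hh.continuousOn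
  set h₀ := ∫ x, max (u₀ ⬝ᵥ Φ x) 0 ∂μ with hh₀
  have hu₀' : u₀ ≠ 0 := by
    rintro rfl; simp at hu₀
  have h₀pos : 0 < h₀ := by
    refine lt_of_le_of_ne (integral_nonneg fun x => le_max_right _ _) fun h0 => hpos u₀ hu₀' ?_
    have := (integral_eq_zero_iff_of_nonneg (fun x => le_max_right _ _)
      (hmax u₀).integrable).1 h0.symm
    filter_upwards [this] with x hx
    simpa using hx
  refine hF.exists_forall_le ?_
  refine tendsto_atTop_mono (fun θ => ?_)
    ((tendsto_norm_cocompact_atTop (E := ι → ℝ)).const_mul_atTop h₀pos)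
  rcases eq_or_ne θ 0 with rfl | hθ
  · rw [norm_zero, mul_zero]
    exact integral_nonneg fun x => (Real.exp_pos _).le
  · have hn := norm_pos_iff.2 hθ
    have h1 : h₀ ≤ ∫ x, max ((‖θ‖⁻¹ • θ) ⬝ᵥ Φ x) 0 ∂μ :=
      hmin (by rw [mem_sphere_zero_iff_norm, norm_smul, norm_inv, norm_norm,
        inv_mul_cancel₀ hn.ne'])
    have h2 : ∫ x, max ((‖θ‖⁻¹ • θ) ⬝ᵥ Φ x) 0 ∂μ ≤ ∫ x, ‖θ‖⁻¹ * Real.exp (θ ⬝ᵥ Φ x) ∂μ := by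
      refine integral_mono (hmax _).integrable
        ((IsAEBounded.dotProduct hΦ θ).exp.integrable.const_mul _) fun x => ?_
      dsimp only
      rw [smul_dotProduct, smul_eq_mul]
      refine max_le ?_ (by positivity)
      refine mul_le_mul_of_nonneg_left ?_ (by positivity)
      linarith [Real.add_one_le_exp (θ ⬝ᵥ Φ x)]
    rw [integral_const_mul] at h2
    have h3 := mul_le_mul_of_nonneg_right (h1.trans h2) hn.le
    rwa [mul_comm (‖θ‖⁻¹ * _), ← mul_assoc, mul_inv_cancel₀ hn.ne', one_mul] at h3

/-- First-order condition: moving θ in direction p multiplies the integral by the moment generating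
function of Φ_p under the tilt, whose derivative at 0 is the mean. -/
theorem integral_tilted_eq_zero_of_isMin [NeZero μ] (hΦ : ∀ p, IsAEBounded μ fun x => Φ x p)
    {θ : ι → ℝ} (hmin : ∀ θ', ∫ x, Real.exp (θ ⬝ᵥ Φ x) ∂μ ≤ ∫ x, Real.exp (θ' ⬝ᵥ Φ x) ∂μ)
    (p : ι) : ∫ x, Φ x p ∂(μ.tilted fun x => θ ⬝ᵥ Φ x) = 0 := by
  classical
  set ν := μ.tilted fun x => θ ⬝ᵥ Φ x with hν
  have hθ := IsAEBounded.dotProduct hΦ θ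
  have : IsProbabilityMeasure ν := isProbabilityMeasure_tilted_of_isAEBounded hθ
  have hb : IsAEBounded ν fun x => Φ x p := (hΦ p).mono (tilted_absolutelyContinuous _ _)
  have hset : integrableExpSet (fun x => Φ x p) ν = univ :=
    eq_univ_of_forall fun t => (hb.const_mul t).exp.integrable
  have hd := hasDerivAt_mgf (X := fun x => Φ x p) (μ := ν) (t := 0) (by rw [hset]; simp)
  have hlm : IsLocalMin (mgf (fun x => Φ x p) ν) 0 := by
    refine Eventually.of_forall fun t => ?_
    have h0 := integral_exp_pos hθ.exp.integrable
    rw [mgf_zero, mgf, hν, integral_exp_tilted, one_le_div h0]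
    have e : ∀ x, ((fun x => θ ⬝ᵥ Φ x) + fun x => t * Φ x p) x =
        (θ + Pi.single p t) ⬝ᵥ Φ x := by
      intro x; simp [add_dotProduct]
    simp_rw [e]
    exact hmin _
  simpa using hlm.hasDerivAt_eq_zero hd

/-- Existence of a solution of the mean equation when `α` is not separated from the support of the
statistic. -/
theorem exists_expMean_eq [NeZero μ] (hΦ : ∀ p, IsAEBounded μ fun x => Φ x p) (α : ι → ℝ)
    (hpos : ∀ u : ι → ℝ, u ≠ 0 → ¬ ∀ᵐ x ∂μ, u ⬝ᵥ Φ x ≤ u ⬝ᵥ α) :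
    ∃ θ, expMean μ Φ θ = α := by
  -- Centring at α changes the exponent only by a constant, so the tilted measure is unchanged and
  -- the minimiser solves the mean equation.
  set Ψ : E → ι → ℝ := fun x => Φ x - α with hΨ
  have hΨb : ∀ p, IsAEBounded μ fun x => Ψ x p := fun p => (hΦ p).sub (.const _)
  obtain ⟨θ, hθ⟩ := exists_isMin_integral_exp hΨb fun u hu => by
    simpa only [hΨ, dotProduct_sub, sub_nonpos] using hpos u hu
  refine ⟨θ, funext fun p => ?_⟩
  have h := integral_tilted_eq_zero_of_isMin hΨb hθ p
  have hb := IsAEBounded.dotProduct hΦ θ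
  have := isProbabilityMeasure_tilted_of_isAEBounded hb
  have e : (μ.tilted fun x => θ ⬝ᵥ Ψ x) = μ.tilted fun x => θ ⬝ᵥ Φ x := by
    rw [← tilted_const (μ.tilted fun x => θ ⬝ᵥ Φ x) (-(θ ⬝ᵥ α)), tilted_tilted hb.exp.integrable]
    congr 1
    ext x
    simp [hΨ, sub_eq_add_neg]
  rw [e] at h
  simp only [hΨ, Pi.sub_apply] at h
  rw [integral_sub ((hΦ p).mono (tilted_absolutelyContinuous _ _)).integrable
    (integrable_const _)] at h
  simp at h
  rw [expMean]
  linarith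

end ExpFamily

end AdditiveExpSeries

namespace AdditiveExpSeries

/-! ### Kullback-Leibler divergence along exponential tilts -/

section Divergence

variable {E : Type*} [MeasurableSpace E] {ν : Measure E} [IsProbabilityMeasure ν]

/-- The divergence of `ν` from its exponential tilt by `h`. -/
noncomputable def tiltDiv (ν : Measure E) (h : E → ℝ) : ℝ :=
  Real.log (∫ x, Real.exp (h x) ∂ν) - ∫ x, h x ∂ν

theorem klDiv_tilted_right {h : E → ℝ} (hb : IsAEBounded ν h) :
    InformationTheory.klDiv ν (ν.tilted h) = ENNReal.ofReal (tiltDiv ν h) := by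
  have hac := absolutelyContinuous_tilted (μ := ν) hb.exp.integrable
  have := isProbabilityMeasure_tilted_of_isAEBounded hb
  have hself : llr ν ν =ᵐ[ν] 0 := llr_self ν
  have hint : Integrable (llr ν ν) ν := (integrable_congr hself).2 (integrable_zero _ _ _)
  have hll := integrable_llr_tilted_right Measure.AbsolutelyContinuous.rfl hb.integrable hint
    hb.exp.integrable
  rw [InformationTheory.klDiv_of_ac_of_integrable hac hll,
    integral_llr_tilted_right Measure.AbsolutelyContinuous.rfl hb.integrable hb.exp.integrable hint,
    integral_congr_ae hself]
  simp only [Pi.zero_apply, integral_zero, probReal_univ, tiltDiv]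
  congr 1; ring

/-- A crude bound without smallness, used for fixed sample sizes. -/
theorem tiltDiv_le_of_abs_le {h : E → ℝ} (hb : IsAEBounded ν h) {B : ℝ}
    (hB : ∀ᵐ x ∂ν, |h x| ≤ B) : tiltDiv ν h ≤ 2 * B := by
  have h1 : ∫ x, Real.exp (h x) ∂ν ≤ Real.exp B := by
    have := integral_mono_ae hb.exp.integrable (integrable_const (Real.exp B)) (by
      filter_upwards [hB] with x hx
      exact Real.exp_le_exp.2 ((le_abs_self _).trans hx))
    simpa using this
  have h2 : -B ≤ ∫ x, h x ∂ν := by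
    have := integral_mono_ae (integrable_const (-B)) hb.integrable (by
      filter_upwards [hB] with x hx
      exact (abs_le.1 hx).1)
    simpa using this
  have h3 := Real.log_le_log (integral_exp_pos hb.exp.integrable) h1
  rw [Real.log_exp] at h3
  unfold tiltDiv
  linarith

theorem tiltDiv_eq_log_integral {h : E → ℝ} (hb : IsAEBounded ν h) :
    tiltDiv ν h = Real.log (∫ x, Real.exp (h x - ∫ y, h y ∂ν) ∂ν) := by
  simp_rw [Real.exp_sub]
  rw [integral_div, Real.log_div (integral_exp_pos hb.exp.integrable).ne' (Real.exp_pos _).ne',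
    Real.log_exp, tiltDiv]

theorem quadratic_le_exp {y : ℝ} (hy : |y| ≤ 1) : 1 + y + y ^ 2 / 4 ≤ Real.exp y := by
  have h := Real.exp_bound hy (n := 3) (by norm_num)
  norm_num [Finset.sum_range_succ, Nat.factorial] at h
  have h1 : |y| ^ 3 ≤ y ^ 2 := by
    rw [← sq_abs y]
    exact pow_le_pow_of_le_one (abs_nonneg _) hy (by norm_num)
  have h2 := (abs_le.1 h).1
  nlinarith [sq_nonneg y]

/-- Two-sided comparison of the divergence along a tilt with a variance. -/
theorem tiltDiv_bounds {h : E → ℝ} (hb : IsAEBounded ν h)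
    (h1 : ∀ᵐ x ∂ν, |h x - ∫ y, h y ∂ν| ≤ 1) :
    (∫ x, (h x - ∫ y, h y ∂ν) ^ 2 ∂ν) / 8 ≤ tiltDiv ν h ∧
      tiltDiv ν h ≤ ∫ x, (h x - ∫ y, h y ∂ν) ^ 2 ∂ν := by
  rw [tiltDiv_eq_log_integral hb]
  set Y : E → ℝ := fun x => h x - ∫ y, h y ∂ν with hY
  have hYb : IsAEBounded ν Y := hb.sub (.const _)
  have hY0 : ∫ x, Y x ∂ν = 0 := by
    rw [hY, integral_sub hb.integrable (integrable_const _)]; simp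
  set V := ∫ x, Y x ^ 2 ∂ν with hV
  have hV0 : 0 ≤ V := integral_nonneg fun x => sq_nonneg _
  have hV1 : V ≤ 1 := by
    have := integral_mono_ae hYb.sq.integrable (integrable_const (1 : ℝ)) (by
      filter_upwards [h1] with x hx
      rw [← sq_abs]; exact pow_le_one₀ (abs_nonneg _) hx)
    simpa using this
  have hup : ∫ x, Real.exp (Y x) ∂ν ≤ 1 + V := by
    have hi : IsAEBounded ν fun x => (1 + Y x) + Y x ^ 2 :=
      ((IsAEBounded.const 1).add hYb).add hYb.sq
    have := integral_mono_ae hYb.exp.integrable hi.integrable (by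
      filter_upwards [h1] with x hx
      have := (abs_le.1 (Real.abs_exp_sub_one_sub_id_le hx)).2
      linarith)
    rw [integral_add ((IsAEBounded.const 1).add hYb).integrable hYb.sq.integrable,
      integral_add (integrable_const _) hYb.integrable, hY0] at this
    simpa using this
  have hlow : 1 + V / 4 ≤ ∫ x, Real.exp (Y x) ∂ν := by
    have hi : IsAEBounded ν fun x => (1 + Y x) + 1 / 4 * Y x ^ 2 :=
      ((IsAEBounded.const 1).add hYb).add (hYb.sq.const_mul _)
    have := integral_mono_ae hi.integrable hYb.exp.integrable (by
      filter_upwards [h1] with x hx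
      have := quadratic_le_exp hx
      linarith)
    rw [integral_add ((IsAEBounded.const 1).add hYb).integrable (hYb.sq.const_mul _).integrable,
      integral_add (integrable_const _) hYb.integrable, hY0, integral_const_mul] at this
    simp only [integral_const, probReal_univ, smul_eq_mul, mul_one, add_zero] at this
    linarith
  constructor
  · have h2 : Real.log (1 + V / 4) ≤ Real.log (∫ x, Real.exp (Y x) ∂ν) :=
      Real.log_le_log (by linarith) hlow
    have h3 := Real.one_sub_inv_le_log_of_pos (show 0 < 1 + V / 4 by linarith)
    -- The right side is V/(4 + V), and V ≤ 1.
    have h4 : V / 8 ≤ 1 - (1 + V / 4)⁻¹ := by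
      rw [← one_div, le_sub_iff_add_le, ← le_sub_iff_add_le', div_le_iff₀ (by linarith)]
      nlinarith
    linarith
  · have h2 := Real.log_le_sub_one_of_pos (integral_exp_pos hYb.exp.integrable)
    linarith

variable {ι : Type*} [Fintype ι] {Φ : E → ι → ℝ}

/-- Deterministic bound for a minimum divergence estimator: `δ` bounds the approximation error and
`ζ` the stochastic error, and the comparison `B` of uniform and quadratic norms is such that both
are small. -/
theorem tiltDiv_minimiser_le (hΦ : ∀ p, IsAEBounded ν fun x => Φ x p) {L : E → ℝ}
    (hL : IsAEBounded ν L) {θh θb α : ι → ℝ} {B δ ζ : ℝ} (hB : 0 ≤ B) (hδ : 0 < δ) (hζ : 0 ≤ ζ)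
    (hmin : Real.log (∫ x, Real.exp (θh ⬝ᵥ Φ x - L x) ∂ν) - θh ⬝ᵥ α ≤
      Real.log (∫ x, Real.exp (θb ⬝ᵥ Φ x - L x) ∂ν) - θb ⬝ᵥ α)
    (hbar : ∀ᵐ x ∂ν, |(θb ⬝ᵥ Φ x - L x) - ∫ y, (θb ⬝ᵥ Φ y - L y) ∂ν| ≤ 1 / 2)
    (hbar2 : ∫ x, ((θb ⬝ᵥ Φ x - L x) - ∫ y, (θb ⬝ᵥ Φ y - L y) ∂ν) ^ 2 ∂ν ≤ δ ^ 2)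
    (hosc : ∀ u : ι → ℝ, ∀ᵐ x ∂ν, |u ⬝ᵥ Φ x - ∫ y, u ⬝ᵥ Φ y ∂ν| ≤
      B * √(∫ x, (u ⬝ᵥ Φ x - ∫ y, u ⬝ᵥ Φ y ∂ν) ^ 2 ∂ν))
    (hsto : ∀ u : ι → ℝ, |u ⬝ᵥ α - ∫ y, u ⬝ᵥ Φ y ∂ν| ≤
      ζ * √(∫ x, (u ⬝ᵥ Φ x - ∫ y, u ⬝ᵥ Φ y ∂ν) ^ 2 ∂ν))
    (hsmall : 20 * B * (δ + ζ) ≤ 1 / 2) :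
    tiltDiv ν (fun x => θh ⬝ᵥ Φ x - L x) ≤ 2000 * (δ ^ 2 + ζ ^ 2) := by
  have hΦb := fun u => IsAEBounded.dotProduct hΦ u
  set u := θh - θb with hu
  set hb : E → ℝ := fun x => θb ⬝ᵥ Φ x - L x with hhb
  have hbb : IsAEBounded ν hb := (hΦb θb).sub hL
  set a : E → ℝ := fun x => hb x - ∫ y, hb y ∂ν with ha
  set b : E → ℝ := fun x => u ⬝ᵥ Φ x - ∫ y, u ⬝ᵥ Φ y ∂ν with hbdef
  have hab : IsAEBounded ν a := hbb.sub (.const _)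
  have hbB : IsAEBounded ν b := (hΦb u).sub (.const _)
  set s := √(∫ x, b x ^ 2 ∂ν) with hs
  have hs2 : s ^ 2 = ∫ x, b x ^ 2 ∂ν := Real.sq_sqrt (integral_nonneg fun x => sq_nonneg _)
  have hs0 : 0 ≤ s := Real.sqrt_nonneg _
  -- The factor 20 makes the quadratic term win at the end: (ρ²/2 - δ²)/8 > δ² + ζρ. The smallness
  -- assumption says exactly Bρ ≤ 1/2.
  set ρ := 20 * (δ + ζ) with hρ
  have hρ0 : 0 < ρ := by positivity
  have hBρ : B * ρ ≤ 1 / 2 := by rw [hρ]; linarith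
  set hτ : ℝ → E → ℝ := fun τ x => hb x + τ * (u ⬝ᵥ Φ x) with hhτ
  have hτb : ∀ τ, IsAEBounded ν (hτ τ) := fun τ => hbb.add ((hΦb u).const_mul τ)
  have hτint : ∀ τ, ∫ x, hτ τ x ∂ν = ∫ x, hb x ∂ν + τ * ∫ x, u ⬝ᵥ Φ x ∂ν := fun τ => by
    rw [← integral_const_mul, ← integral_add hbb.integrable ((hΦb u).const_mul τ).integrable]
  have hτc : ∀ τ x, hτ τ x - ∫ y, hτ τ y ∂ν = a x + τ * b x := fun τ x => by
    rw [hτint]; simp only [hhτ, ha, hbdef]; ring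
  have hτle : ∀ τ, 0 ≤ τ → τ * s ≤ ρ → ∀ᵐ x ∂ν, |hτ τ x - ∫ y, hτ τ y ∂ν| ≤ 1 := by
    intro τ h0 hτs
    filter_upwards [hbar, hosc u] with x h1 h2
    rw [hτc]
    have h3 : |τ * b x| ≤ 1 / 2 := by
      rw [abs_mul, abs_of_nonneg h0]
      calc τ * |b x| ≤ τ * (B * s) := mul_le_mul_of_nonneg_left h2 h0
        _ = B * (τ * s) := by ring
        _ ≤ B * ρ := mul_le_mul_of_nonneg_left hτs hB
        _ ≤ 1 / 2 := hBρ
    have h4 : |a x| ≤ 1 / 2 := h1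
    linarith [abs_add_le (a x) (τ * b x)]
  have hh1 : (fun x => θh ⬝ᵥ Φ x - L x) = hτ 1 := by
    ext x; simp only [hhτ, hhb, hu, sub_dotProduct]; ring
  have hh0 : hb = hτ 0 := by ext x; simp [hhτ]
  rw [hh1]
  rcases le_or_gt s ρ with hle | hlt
  · refine (tiltDiv_bounds (hτb 1) (hτle 1 zero_le_one (by linarith))).2.trans ?_
    simp_rw [hτc]
    have h1 : ∫ x, (a x + 1 * b x) ^ 2 ∂ν ≤ ∫ x, (2 * a x ^ 2 + 2 * b x ^ 2) ∂ν :=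
      integral_mono (hab.add (hbB.const_mul 1)).sq.integrable
        ((hab.sq.const_mul 2).add (hbB.sq.const_mul 2)).integrable fun x => by
          simp only; nlinarith [sq_nonneg (a x - b x)]
    rw [integral_add (hab.sq.const_mul 2).integrable (hbB.sq.const_mul 2).integrable,
      integral_const_mul, integral_const_mul, ← hs2] at h1
    have h2 : s ^ 2 ≤ ρ ^ 2 := pow_le_pow_left₀ hs0 hle 2
    have h3 : ∫ x, a x ^ 2 ∂ν ≤ δ ^ 2 := hbar2
    have h4 : ρ ^ 2 ≤ 800 * (δ ^ 2 + ζ ^ 2) := by rw [hρ]; nlinarith [sq_nonneg (δ - ζ)]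
    nlinarith [sq_nonneg ζ]
  · exfalso
    -- If the minimiser were farther than ρ, its log-ratio might be uncontrolled; the point of the
    -- segment at distance exactly ρ is still in the range where divergence and variance are
    -- comparable.
    set τ := ρ / s with hτdef
    have hspos : 0 < s := hρ0.trans hlt
    have hτ0 : 0 ≤ τ := by positivity
    have hτ1 : τ ≤ 1 := (div_le_one hspos).2 hlt.le
    have hτs : τ * s = ρ := div_mul_cancel₀ _ hspos.ne'
    have hK1 := (tiltDiv_bounds (hτb τ) (hτle τ hτ0 hτs.le)).1
    have hK0 : tiltDiv ν hb ≤ δ ^ 2 := (tiltDiv_bounds hbb (by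
      filter_upwards [hbar] with x hx; exact hx.trans (by norm_num))).2.trans hbar2
    -- quadratic lower bound on the sphere
    have hlow : ρ ^ 2 / 2 - δ ^ 2 ≤ ∫ x, (hτ τ x - ∫ y, hτ τ y ∂ν) ^ 2 ∂ν := by
      simp_rw [hτc]
      have h1 : ∫ x, (τ ^ 2 / 2 * b x ^ 2 - a x ^ 2) ∂ν ≤ ∫ x, (a x + τ * b x) ^ 2 ∂ν :=
        integral_mono ((hbB.sq.const_mul _).sub hab.sq).integrable
          (hab.add (hbB.const_mul τ)).sq.integrable fun x => by
            simp only; nlinarith [sq_nonneg (2 * a x + τ * b x)]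
      rw [integral_sub (hbB.sq.const_mul _).integrable hab.sq.integrable, integral_const_mul,
        ← hs2] at h1
      have h2 : τ ^ 2 / 2 * s ^ 2 = ρ ^ 2 / 2 := by rw [← hτs]; ring
      have h3 : ∫ x, a x ^ 2 ∂ν ≤ δ ^ 2 := hbar2
      linarith
    -- convexity of the log-Laplace functional along the segment
    set N : ℝ → ℝ := fun τ => Real.log (∫ x, Real.exp (hτ τ x) ∂ν) with hN
    have hgrad : ∀ σ, (σ - τ) * ∫ x, u ⬝ᵥ Φ x ∂(ν.tilted (hτ τ)) ≤ N σ - N τ := by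
      intro σ
      have h1 := integral_tilted_sub_le (hτb τ) (hτb σ)
      have h2 : ∀ x, hτ σ x - hτ τ x = (σ - τ) * (u ⬝ᵥ Φ x) := fun x => by
        simp only [hhτ]; ring
      simp_rw [h2] at h1
      rwa [integral_const_mul] at h1
    -- The gradient inequalities at τ towards 0 and 1, weighted by 1 - τ and τ: the gradient terms
    -- cancel.
    have hconv : N τ ≤ (1 - τ) * N 0 + τ * N 1 := by
      have h1 := mul_le_mul_of_nonneg_left (hgrad 0) (sub_nonneg.2 hτ1)
      have h2 := mul_le_mul_of_nonneg_left (hgrad 1) hτ0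
      linear_combination h1 + h2
    have hmin' : N 1 - N 0 ≤ u ⬝ᵥ α := by
      have e1 : N 1 = Real.log (∫ x, Real.exp (θh ⬝ᵥ Φ x - L x) ∂ν) := by
        simp only [hN]; rw [← hh1]
      have e0 : N 0 = Real.log (∫ x, Real.exp (θb ⬝ᵥ Φ x - L x) ∂ν) := by
        simp only [hN]; rw [← hh0]
      rw [e1, e0, hu, sub_dotProduct]
      linarith
    have hdiff : tiltDiv ν (hτ τ) - tiltDiv ν hb ≤ ζ * ρ := by
      have h1 : tiltDiv ν (hτ τ) - tiltDiv ν hb = N τ - N 0 - τ * ∫ x, u ⬝ᵥ Φ x ∂ν := by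
        have e0 : N 0 = Real.log (∫ x, Real.exp (hb x) ∂ν) := by simp only [hN]; rw [← hh0]
        rw [tiltDiv, tiltDiv, hτint, e0]; ring
      have h2 := mul_le_mul_of_nonneg_left hmin' hτ0
      have h3 := mul_le_mul_of_nonneg_left ((le_abs_self _).trans (hsto u)) hτ0
      have h4 : τ * (ζ * s) = ζ * ρ := by rw [← hτs]; ring
      have h5 : √(∫ x, (u ⬝ᵥ Φ x - ∫ y, u ⬝ᵥ Φ y ∂ν) ^ 2 ∂ν) = s := rfl
      rw [h5, h4] at h3
      rw [h1]
      linear_combination hconv + h2 + h3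
    have h6 : ζ * ρ ≤ 20 * (δ + ζ) ^ 2 := by rw [hρ]; nlinarith
    have h7 : ρ ^ 2 = 400 * (δ + ζ) ^ 2 := by rw [hρ]; ring
    have h8 : δ ^ 2 ≤ (δ + ζ) ^ 2 := by nlinarith
    have h9 : 0 < (δ + ζ) ^ 2 := by positivity
    linarith

end Divergence

end AdditiveExpSeries

/-! ### Uniform deviation of the empirical mean through the covariance matrix. -/

namespace AdditiveExpSeries

section Covariance

variable {E : Type*} [MeasurableSpace E] {ν : Measure E} {ι : Type*} [Fintype ι]

/-- Cauchy-Schwarz for the inner product defined by S, applied to u and S⁻¹z. One random quantity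
then controls all directions u. -/
theorem sq_dotProduct_le_of_posDef [DecidableEq ι] {S : Matrix ι ι ℝ} (hS : S.PosDef)
    (u z : ι → ℝ) :
    (u ⬝ᵥ z) ^ 2 ≤ (z ⬝ᵥ S⁻¹.mulVec z) * (u ⬝ᵥ S.mulVec u) := by
  set v := S⁻¹.mulVec z with hv
  have hz : z = S.mulVec v := by
    rw [hv, Matrix.mulVec_mulVec, Matrix.mul_nonsing_inv _ ((Matrix.isUnit_iff_isUnit_det _).1
      hS.isUnit), Matrix.one_mulVec]
  have hsymm : ∀ a b : ι → ℝ, a ⬝ᵥ S.mulVec b = b ⬝ᵥ S.mulVec a := fun a b => by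
    have ht : S.transpose = S := by simpa using hS.isHermitian.eq
    rw [Matrix.dotProduct_mulVec, ← Matrix.mulVec_transpose, ht, dotProduct_comm]
  have hq : ∀ t : ℝ, 0 ≤ (u ⬝ᵥ S.mulVec u) * (t * t) + (2 * (u ⬝ᵥ S.mulVec v)) * t +
      v ⬝ᵥ S.mulVec v := fun t => by
    have h := hS.posSemidef.dotProduct_mulVec_nonneg (t • u + v)
    simp only [star_trivial, Matrix.mulVec_add, Matrix.mulVec_smul, dotProduct_add,
      add_dotProduct, smul_dotProduct, dotProduct_smul, smul_eq_mul] at h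
    rw [hsymm v u] at h
    linarith
  have hd := discrim_le_zero hq
  rw [discrim] at hd
  rw [dotProduct_comm z v, hz]
  nlinarith

theorem dotProduct_covariance_mulVec [IsFiniteMeasure ν] {Ψ : E → ι → ℝ}
    (hΨ : ∀ p, IsAEBounded ν fun x => Ψ x p) (u : ι → ℝ) :
    u ⬝ᵥ (Matrix.of fun p q => ∫ x, Ψ x p * Ψ x q ∂ν).mulVec u = ∫ x, (u ⬝ᵥ Ψ x) ^ 2 ∂ν := by
  simp only [dotProduct, Matrix.mulVec, Matrix.of_apply]
  have : ∀ x, (∑ p, u p * Ψ x p) ^ 2 = ∑ p, ∑ q, u p * u q * (Ψ x p * Ψ x q) := fun x => by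
    rw [sq, Finset.sum_mul_sum]
    exact Finset.sum_congr rfl fun p _ => Finset.sum_congr rfl fun q _ => by ring
  simp_rw [this]
  rw [integral_finsetSum _ fun p _ =>
    (IsAEBounded.sum _ fun q _ => ((hΨ p).mul (hΨ q)).const_mul _).integrable]
  refine Finset.sum_congr rfl fun p _ => ?_
  rw [integral_finsetSum _ fun q _ => (((hΨ p).mul (hΨ q)).const_mul _).integrable,
    Finset.mul_sum]
  refine Finset.sum_congr rfl fun q _ => ?_
  rw [integral_const_mul]
  ring

variable {Ω : Type*} [MeasurableSpace Ω] {P : Measure Ω} [IsProbabilityMeasure P]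

/-- Second moments of the empirical mean of a centred statistic. -/
theorem integral_mul_average_eq {X : ℕ → Ω → E} (hX : ∀ j, HasLaw (X j) ν P)
    (hindep : iIndepFun X P) {f g : E → ℝ} (hfm : Measurable f) (hgm : Measurable g)
    (hf : IsAEBounded ν f) (hg : IsAEBounded ν g) (hf0 : ∫ x, f x ∂ν = 0) {n : ℕ} (hn : 1 ≤ n) :
    Integrable (fun ω => ((n : ℝ)⁻¹ * ∑ j : Fin n, f (X j ω)) *
      ((n : ℝ)⁻¹ * ∑ j : Fin n, g (X j ω))) P ∧
    ∫ ω, ((n : ℝ)⁻¹ * ∑ j : Fin n, f (X j ω)) * ((n : ℝ)⁻¹ * ∑ j : Fin n, g (X j ω)) ∂P =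
      (∫ x, f x * g x ∂ν) / n := by
  have hcomp : ∀ {h : E → ℝ}, Measurable h → IsAEBounded ν h → ∀ j,
      IsAEBounded P fun ω => h (X j ω) := fun {h} hm hb j => by
    obtain ⟨B, hB⟩ := hb.bounded
    refine ⟨hm.comp_aemeasurable (hX j).aemeasurable, B, ?_⟩
    rw [← (hX j).map_eq] at hB
    exact ae_of_ae_map (hX j).aemeasurable hB
  have hlaw : ∀ {h : E → ℝ}, Measurable h → ∀ j, ∫ ω, h (X j ω) ∂P = ∫ x, h x ∂ν :=
    fun {h} hm j => by
      rw [← (hX j).map_eq, integral_map (hX j).aemeasurable hm.aestronglyMeasurable]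
  have heq : ∀ ω, ((n : ℝ)⁻¹ * ∑ j : Fin n, f (X j ω)) * ((n : ℝ)⁻¹ * ∑ j : Fin n, g (X j ω)) =
      (n : ℝ)⁻¹ ^ 2 * ∑ j : Fin n, ∑ k : Fin n, f (X j ω) * g (X k ω) := fun ω => by
    rw [← Finset.sum_mul_sum]; ring
  have hb : ∀ j k : Fin n, IsAEBounded P fun ω => f (X j ω) * g (X k ω) := fun j k =>
    (hcomp hfm hf j).mul (hcomp hgm hg k)
  simp_rw [heq]
  refine ⟨((IsAEBounded.sum _ fun j _ => IsAEBounded.sum _ fun k _ =>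
    hb j k).const_mul _).integrable, ?_⟩
  rw [integral_const_mul, integral_finsetSum _ fun j _ =>
    (IsAEBounded.sum _ fun k _ => hb _ _).integrable]
  simp_rw [integral_finsetSum Finset.univ fun k _ => (hb _ _).integrable]
  have hjk : ∀ j k : Fin n, ∫ ω, f (X j ω) * g (X k ω) ∂P =
      if j = k then ∫ x, f x * g x ∂ν else 0 := fun j k => by
    split_ifs with h
    · subst h
      exact hlaw (hfm.mul hgm) j
    · have hi : IndepFun (X j) (X k) P := hindep.indepFun fun h' => h (Fin.ext h')
      have := (hi.comp hfm hgm).integral_fun_mul_eq_mul_integral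
        (hcomp hfm hf j).aemeasurable.aestronglyMeasurable
        (hcomp hgm hg k).aemeasurable.aestronglyMeasurable
      simp only [Function.comp_apply] at this
      rw [this, hlaw hfm, hf0, zero_mul]
  simp_rw [hjk]
  simp only [Finset.sum_ite_eq, Finset.mem_univ, if_true, Finset.sum_const, Finset.card_univ,
    Fintype.card_fin, nsmul_eq_mul]
  have : (n : ℝ) ≠ 0 := by positivity
  field_simp

/-- With probability at least `1 - 1/c` the empirical mean deviates from the mean by at most
`√(c N / n)` standard deviations, simultaneously in all directions. -/
theorem measure_exists_deviation_le [IsProbabilityMeasure ν] {X : ℕ → Ω → E} (hX : ∀ j, HasLaw (X j) ν P)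
    (hindep : iIndepFun X P) {Φ : E → ι → ℝ} (hΦm : ∀ p, Measurable fun x => Φ x p)
    (hΦ : ∀ p, IsAEBounded ν fun x => Φ x p)
    (hnd : ∀ u : ι → ℝ, u ≠ 0 → 0 < ∫ x, (u ⬝ᵥ Φ x - ∫ y, u ⬝ᵥ Φ y ∂ν) ^ 2 ∂ν)
    {n : ℕ} (hn : 1 ≤ n) {c : ℝ} (hc : 0 < c) :
    P {ω | ¬ ∀ u : ι → ℝ, |u ⬝ᵥ ((n : ℝ)⁻¹ • ∑ j : Fin n, Φ (X j ω)) - ∫ y, u ⬝ᵥ Φ y ∂ν| ≤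
      √(c * Fintype.card ι / n) * √(∫ x, (u ⬝ᵥ Φ x - ∫ y, u ⬝ᵥ Φ y ∂ν) ^ 2 ∂ν)} ≤
      ENNReal.ofReal (1 / c) := by
  classical
  have hn0 : (0 : ℝ) < n := by exact_mod_cast hn
  rcases isEmpty_or_nonempty ι with hι | hι
  · refine le_trans (le_of_eq ?_) zero_le
    convert measure_empty (μ := P)
    ext ω
    simp
  set μΦ : ι → ℝ := fun p => ∫ y, Φ y p ∂ν with hμΦ
  set Ψ : E → ι → ℝ := fun x => Φ x - μΦ with hΨ
  have hΨm : ∀ p, Measurable fun x => Ψ x p := fun p => (hΦm p).sub_const _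
  have hΨb : ∀ p, IsAEBounded ν fun x => Ψ x p := fun p => (hΦ p).sub (.const _)
  have hΨ0 : ∀ p, ∫ x, Ψ x p ∂ν = 0 := fun p => by
    simp only [hΨ, Pi.sub_apply]
    rw [integral_sub (hΦ p).integrable (integrable_const _)]
    simp [hμΦ]
  have hcen : ∀ (u : ι → ℝ) x, u ⬝ᵥ Φ x - ∫ y, u ⬝ᵥ Φ y ∂ν = u ⬝ᵥ Ψ x := fun u x => by
    rw [integral_dotProduct_eq hΦ, hΨ, dotProduct_sub]
  simp_rw [hcen] at hnd ⊢
  set S : Matrix ι ι ℝ := Matrix.of fun p q => ∫ x, Ψ x p * Ψ x q ∂ν with hSdef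
  have hSherm : S.IsHermitian := by
    ext p q
    simp [hSdef, Matrix.conjTranspose_apply, mul_comm]
  have hS : S.PosDef := Matrix.PosDef.of_dotProduct_mulVec_pos hSherm fun u hu => by
    rw [star_trivial, hSdef, dotProduct_covariance_mulVec hΨb]
    exact hnd u hu
  set z : Ω → ι → ℝ := fun ω p => (n : ℝ)⁻¹ * ∑ j : Fin n, Ψ (X j ω) p with hz
  have hzeq : ∀ (u : ι → ℝ) ω, u ⬝ᵥ ((n : ℝ)⁻¹ • ∑ j : Fin n, Φ (X j ω)) -
      ∫ y, u ⬝ᵥ Φ y ∂ν = u ⬝ᵥ z ω := fun u ω => by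
    rw [integral_dotProduct_eq hΦ, ← dotProduct_sub]
    congr 1
    ext p
    simp only [hz, hΨ, hμΦ, Pi.sub_apply, Pi.smul_apply, Finset.sum_apply, smul_eq_mul,
      Finset.sum_sub_distrib, Finset.sum_const, Finset.card_univ, Fintype.card_fin, nsmul_eq_mul]
    field_simp
  simp_rw [hzeq]
  set Q : Ω → ℝ := fun ω => z ω ⬝ᵥ S⁻¹.mulVec (z ω) with hQ
  obtain ⟨R, hR⟩ : ∃ R : ι → ι → ℝ, ∀ p q, S⁻¹ p q = R p q := ⟨_, fun _ _ => rfl⟩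
  have hQeq : ∀ ω, Q ω = ∑ p, ∑ q, R p q * (z ω p * z ω q) := fun ω => by
    simp only [hQ, dotProduct, Matrix.mulVec, Finset.mul_sum, hR]
    exact Finset.sum_congr rfl fun p _ => Finset.sum_congr rfl fun q _ => by ring
  have hmom : ∀ p q, Integrable (fun ω => z ω p * z ω q) P ∧
      ∫ ω, z ω p * z ω q ∂P = (∫ x, Ψ x p * Ψ x q ∂ν) / n := fun p q => integral_mul_average_eq hX hindep (hΨm p) (hΨm q) (hΨb p) (hΨb q)
    (hΨ0 p) hn
  have hQint : Integrable Q P := by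
    rw [show Q = _ from funext hQeq]
    exact integrable_finsetSum _ fun p _ => integrable_finsetSum _ fun q _ =>
      (hmom p q).1.const_mul _
  have hQ0 : ∀ ω, 0 ≤ Q ω := fun ω => by
    have := hS.inv.posSemidef.dotProduct_mulVec_nonneg (z ω)
    rwa [star_trivial] at this
  -- The covariance of z is S/n, so the expectation is the trace of S⁻¹S divided by n: the dimension
  -- appears once, with no constant from the conditioning of S.
  have hEQ : ∫ ω, Q ω ∂P = Fintype.card ι / n := by
    simp_rw [hQeq]
    rw [integral_finsetSum _ fun p _ => integrable_finsetSum _ fun q _ =>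
      (hmom p q).1.const_mul _]
    have : ∀ p, ∫ ω, ∑ q, R p q * (z ω p * z ω q) ∂P = (S⁻¹ * S) p p / n := fun p => by
      rw [integral_finsetSum _ fun q _ => (hmom p q).1.const_mul _, Matrix.mul_apply,
        Finset.sum_div]
      refine Finset.sum_congr rfl fun q _ => ?_
      rw [integral_const_mul, (hmom p q).2, mul_div_assoc, hR, hSdef, Matrix.of_apply]
      simp_rw [mul_comm (Ψ _ p)]
    simp_rw [this, Matrix.nonsing_inv_mul _ ((Matrix.isUnit_iff_isUnit_det _).1 hS.isUnit)]
    simp [div_eq_mul_inv]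
  have hN : (0 : ℝ) < Fintype.card ι := by exact_mod_cast Fintype.card_pos
  have hmk := mul_meas_ge_le_integral_of_nonneg (ae_of_all P hQ0) hQint
    (c * Fintype.card ι / n)
  have hsub : {ω | ¬ ∀ u : ι → ℝ, |u ⬝ᵥ z ω| ≤
      √(c * Fintype.card ι / n) * √(∫ x, (u ⬝ᵥ Ψ x) ^ 2 ∂ν)} ⊆
      {ω | c * Fintype.card ι / n ≤ Q ω} := by
    intro ω hω
    by_contra hlt
    rw [mem_ofPred_eq, not_le] at hlt
    refine hω fun u => ?_
    have h := sq_dotProduct_le_of_posDef hS u (z ω)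
    rw [hSdef, dotProduct_covariance_mulVec hΨb, ← hSdef] at h
    rw [← Real.sqrt_mul (by positivity)]
    refine Real.abs_le_sqrt (h.trans ?_)
    exact mul_le_mul_of_nonneg_right hlt.le (integral_nonneg fun _ => sq_nonneg _)
  refine (measure_mono hsub).trans ?_
  rw [hEQ] at hmk
  rw [ENNReal.le_ofReal_iff_toReal_le (measure_ne_top _ _) (by positivity), le_div_iff₀ hc]
  have : 0 < (Fintype.card ι : ℝ) / n := by positivity
  rw [measureReal_def] at hmk
  refine le_of_mul_le_mul_right ?_ this
  calc _ = _ := by ring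
    _ ≤ _ := hmk
    _ = _ := by ring

end Covariance

end AdditiveExpSeries

/-! ### The features as polynomials of prescribed degree. -/

namespace AdditiveExpSeries

open Polynomial in
theorem natDegree_iterate_derivative_eq (p : ℝ[X]) (k : ℕ) :
    (derivative^[k] p).natDegree = p.natDegree - k := by
  induction k with
  | zero => simp
  | succ k ih => rw [Function.iterate_succ_apply', natDegree_derivative, ih]; omega

open Polynomial in
-- Degrees are compared on both sides of Rodrigues' formula: k derivatives of a polynomial of degree
-- α + β + 2k, divided by one of degree α + β.
theorem natDegree_jacobi (α β k : ℕ) :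
    (jacobi α β k).natDegree = k ∧ jacobi α β k ≠ 0 := by
  have h1 : (1 - X : ℝ[X]).natDegree = 1 := by
    rw [← neg_sub, natDegree_neg, ← C_1, natDegree_X_sub_C]
  have h2 : (1 + X : ℝ[X]).natDegree = 1 := by
    rw [add_comm, ← C_1, natDegree_X_add_C]
  have n1 : (1 - X : ℝ[X]) ≠ 0 := fun h => by simp [h] at h1
  have n2 : (1 + X : ℝ[X]) ≠ 0 := fun h => by simp [h] at h2
  have hw : ((1 - X) ^ α * (1 + X) ^ β : ℝ[X]).natDegree = α + β := by
    rw [natDegree_mul (pow_ne_zero _ n1) (pow_ne_zero _ n2), natDegree_pow, natDegree_pow, h1, h2]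
    ring
  have hw0 : ((1 - X) ^ α * (1 + X) ^ β : ℝ[X]) ≠ 0 :=
    mul_ne_zero (pow_ne_zero _ n1) (pow_ne_zero _ n2)
  have hfac : (1 - X ^ 2 : ℝ[X]) = (1 - X) * (1 + X) := by ring
  have h3 : ((1 - X) ^ α * (1 + X) ^ β * (1 - X ^ 2) ^ k : ℝ[X]).natDegree = α + β + 2 * k := by
    rw [hfac, natDegree_mul hw0 (pow_ne_zero _ (mul_ne_zero n1 n2)), hw, natDegree_pow,
      natDegree_mul n1 n2, h1, h2]
    ring
  have hc : (-1) ^ k / (2 ^ k * (k ! : ℝ)) ≠ 0 := by positivity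
  have hR : (derivative^[k] ((1 - X) ^ α * (1 + X) ^ β * (1 - X ^ 2) ^ k : ℝ[X])) ≠ 0 := by
    intro h0
    have hdeg := natDegree_iterate_derivative_eq
      ((1 - X) ^ α * (1 + X) ^ β * (1 - X ^ 2) ^ k : ℝ[X]) k
    -- For k ≥ 1 the derivative has positive degree, hence is nonzero; for k = 0 this may fail, but
    -- no derivative is taken.
    rcases k with _ | k
    · rw [Function.iterate_zero, id, pow_zero, mul_one] at h0
      exact hw0 h0
    · rw [h0, h3, natDegree_zero] at hdeg
      omega
  have hrod := jacobi_rodrigues α β k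
  have hj0 : jacobi α β k ≠ 0 := by
    intro h0
    rw [h0, mul_zero] at hrod
    exact (mul_ne_zero (C_ne_zero.2 hc) hR) hrod.symm
  refine ⟨?_, hj0⟩
  have hd := congrArg natDegree hrod
  rw [natDegree_mul hw0 hj0, hw, natDegree_C_mul hc, natDegree_iterate_derivative_eq, h3] at hd
  omega

open Polynomial in
/-- The polynomial `φ_{i,k}`. -/
noncomputable def phiPoly (d : ℕ) (i : Fin d) (k : ℕ) : ℝ[X] :=
  C (√((2 * k + d : ℝ) * (k ! : ℝ) * ((k + d - 1)! : ℝ) /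
      (((k + (d - 1 - (i : ℕ)))! : ℝ) * ((k + (i : ℕ))! : ℝ))) *
    √(((d - 1 - (i : ℕ))! : ℝ) * ((i : ℕ)! : ℝ))) *
    (jacobi (d - 1 - (i : ℕ)) (i : ℕ) k).comp (C 2 * X - C 1)

theorem phi_eq_eval (d : ℕ) (i : Fin d) (k : ℕ) (t : ℝ) : phi d i k t = (phiPoly d i k).eval t := by
  simp [phi, phiPoly]

open Polynomial in
theorem natDegree_phiPoly {d : ℕ} (i : Fin d) (k : ℕ) :
    (phiPoly d i k).natDegree = k ∧ phiPoly d i k ≠ 0 := by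
  have hd : (0 : ℝ) < d := by exact_mod_cast i.pos
  have hl : (C 2 * X - C 1 : ℝ[X]).natDegree = 1 := by
    rw [natDegree_sub_C, natDegree_C_mul_X _ two_ne_zero]
  obtain ⟨h1, h2⟩ := natDegree_jacobi (d - 1 - (i : ℕ)) (i : ℕ) k
  have hc : √((2 * k + d : ℝ) * (k ! : ℝ) * ((k + d - 1)! : ℝ) /
      (((k + (d - 1 - (i : ℕ)))! : ℝ) * ((k + (i : ℕ))! : ℝ))) *
    √(((d - 1 - (i : ℕ))! : ℝ) * ((i : ℕ)! : ℝ)) ≠ 0 := by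
    have h3 : ∀ n : ℕ, (0 : ℝ) < n ! := fun n => by exact_mod_cast n.factorial_pos
    have := h3 k; have := h3 (k + d - 1); have := h3 (k + (d - 1 - (i : ℕ)))
    have := h3 (k + (i : ℕ)); have := h3 (d - 1 - (i : ℕ)); have := h3 (i : ℕ)
    have hk : (0 : ℝ) < 2 * k + d := by positivity
    positivity
  refine ⟨by rw [phiPoly, natDegree_C_mul hc, natDegree_comp, h1, hl, mul_one], ?_⟩
  rw [phiPoly]
  refine mul_ne_zero (C_ne_zero.2 hc) fun h0 => ?_
  rw [comp_eq_zero_iff] at h0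
  rcases h0 with h0 | ⟨-, h0⟩
  · exact h2 h0
  · rw [h0, natDegree_C] at hl
    omega

open Polynomial in
/-- The `i`-th component of the additive function `θ · φ_m`. -/
noncomputable def thetaPoly {d : ℕ} (m : Fin d → ℕ) (θ : Idx m → ℝ) (i : Fin d) : ℝ[X] :=
  ∑ k : Fin (m i), C (θ ⟨i, k⟩) * phiPoly d i (k + 1)

variable {d : ℕ} {m : Fin d → ℕ}

theorem dotProduct_phiVec (θ : Idx m → ℝ) (x : Fin d → ℝ) :
    θ ⬝ᵥ phiVec m x = ∑ i, (thetaPoly m θ i).eval (x i) := by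
  rw [dotProduct, Fintype.sum_sigma]
  refine Finset.sum_congr rfl fun i _ => ?_
  simp [thetaPoly, Polynomial.eval_finsetSum, phiVec, phi_eq_eval]

theorem natDegree_thetaPoly_le (θ : Idx m → ℝ) (i : Fin d) :
    (thetaPoly m θ i).natDegree ≤ m i := by
  refine Polynomial.natDegree_sum_le_of_forall_le _ _ fun k _ => ?_
  refine (Polynomial.natDegree_C_mul_le _ _).trans ?_
  rw [(natDegree_phiPoly i _).1]
  exact k.2

open Polynomial in
-- Since φ_{i,0} is a nonzero constant, the hypothesis is a linear relation among φ_{i,0}, ...,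
-- φ_{i,m_i}, which have distinct degrees.
theorem eq_zero_of_thetaPoly_eq_C {θ : Idx m → ℝ} {c : Fin d → ℝ}
    (h : ∀ i, thetaPoly m θ i = C (c i)) : θ = 0 := by
  funext ⟨i, k⟩
  let S : Polynomial.Sequence ℝ := ⟨phiPoly d i, fun k => by
    rw [degree_eq_natDegree (natDegree_phiPoly i k).2, (natDegree_phiPoly i k).1]⟩
  have hli : LinearIndependent ℝ (phiPoly d i) := S.linearIndependent
  obtain ⟨a, ha⟩ : ∃ a : ℝ, C a * phiPoly d i 0 = C (c i) := by
    obtain ⟨h1, h2⟩ := natDegree_phiPoly i 0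
    obtain ⟨b, hb⟩ := natDegree_eq_zero.1 h1
    have hb0 : b ≠ 0 := fun h => h2 (by rw [← hb, h, C_0])
    exact ⟨c i / b, by rw [← hb, ← C_mul, div_mul_cancel₀ _ hb0]⟩
  have hli2 : LinearIndependent ℝ fun k : Fin (m i + 1) => phiPoly d i k :=
    hli.comp (fun k : Fin (m i + 1) => (k : ℕ)) Fin.val_injective
  rw [Fintype.linearIndependent_iff] at hli2
  have h0 := hli2 (Fin.cons (-a) fun k => θ ⟨i, k⟩) (by
    rw [Fin.sum_univ_succ]
    simp only [Fin.cons_zero, Fin.cons_succ, Fin.val_zero, Fin.val_succ, smul_eq_C_mul]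
    have h1 := h i
    rw [thetaPoly] at h1
    rw [h1, ← ha, C_neg]
    ring) k.succ
  simpa using h0

open Polynomial in
theorem exists_thetaPoly_add_C_eq (p : Fin d → ℝ[X]) (hp : ∀ i, (p i).natDegree ≤ m i) :
    ∃ (θ : Idx m → ℝ) (c : Fin d → ℝ), ∀ i, p i = thetaPoly m θ i + C (c i) := by
  choose b hb using fun i => exists_eq_sum_of_natDegree_eq (natDegree_phiPoly i) (m i + 1) (p i)
    (Nat.lt_succ_of_le (hp i))
  choose e he using fun i => natDegree_eq_zero.1 (natDegree_phiPoly (d := d) i 0).1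
  refine ⟨fun q => b q.1 (q.2 + 1), fun i => b i 0 * e i, fun i => ?_⟩
  rw [hb i, Finset.sum_range_succ', thetaPoly, C_mul, he i,
    Finset.sum_range fun k => C (b i (k + 1)) * phiPoly d i (k + 1)]

theorem continuous_phiVec (p : Idx m) : Continuous fun x => phiVec m x p := by
  simp only [phiVec, phi_eq_eval]
  exact (phiPoly d p.1 _).continuous.comp (continuous_apply p.1)

theorem isAEBounded_leb_of_continuous {g : (Fin d → ℝ) → ℝ} (hg : Continuous g) :
    IsAEBounded (leb d) g := by
  obtain ⟨B, hB⟩ := (isCompact_Icc (a := (0 : Fin d → ℝ)) (b := 1)).exists_bound_of_continuousOn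
    hg.continuousOn
  refine ⟨hg.aemeasurable, B, ?_⟩
  filter_upwards [ae_mem_simplex d] with x hx
  exact hB x (simplex_subset_Icc d hx)

theorem isAEBounded_phiVec (p : Idx m) : IsAEBounded (leb d) fun x => phiVec m x p :=
  isAEBounded_leb_of_continuous (continuous_phiVec p)

/-- The features and the constants are linearly independent in `L²` of the simplex. -/
theorem eq_zero_of_integral_sq_sub_nonpos (hm : ∀ i, 1 ≤ m i) {u : Idx m → ℝ} {c : ℝ}
    (h : ∫ x, (u ⬝ᵥ phiVec m x - c) ^ 2 ∂(leb d) ≤ 0) : u = 0 := by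
  obtain ⟨C, hC, hle⟩ := sq_sub_eval_le d
  refine eq_zero_of_thetaPoly_eq_C (c := fun i => (thetaPoly m u i).eval 0) fun i => ?_
  have hI : ∀ s ∈ Icc (0 : ℝ) 1,
      (thetaPoly m u i).eval s = (Polynomial.C ((thetaPoly m u i).eval 0)).eval s := fun s hs => by
    have := hle (thetaPoly m u) m hm (natDegree_thetaPoly_le u) c i s hs 0 (by simp)
    simp_rw [← dotProduct_phiVec] at this
    have h2 : C * (m i : ℝ) ^ (2 * d) * ∫ x, (u ⬝ᵥ phiVec m x - c) ^ 2 ∂(leb d) ≤ 0 :=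
      mul_nonpos_of_nonneg_of_nonpos (by positivity) h
    have h3 := pow_eq_zero_iff two_ne_zero |>.1 (le_antisymm (this.trans h2) (sq_nonneg _))
    rw [Polynomial.eval_C]
    linarith
  exact Polynomial.eq_of_infinite_eval_eq _ _
    ((Icc_infinite zero_lt_one).mono fun s hs => hI s hs)

theorem eq_zero_of_dotProduct_phiVec_ae_eq (hm : ∀ i, 1 ≤ m i) (u : Idx m → ℝ) (c : ℝ)
    (h : ∀ᵐ x ∂(leb d), u ⬝ᵥ phiVec m x = c) : u = 0 := by
  refine eq_zero_of_integral_sq_sub_nonpos hm (c := c) (le_of_eq ?_)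
  rw [integral_congr_ae (g := fun _ => (0 : ℝ)) (by filter_upwards [h] with x hx; simp [hx])]
  simp

/-! ### The model as an exponential family -/

theorem densityMeasure_expDensity_eq [NeZero (leb d)] (θ : Idx m → ℝ) :
    densityMeasure (expDensity m θ) = (leb d).tilted fun x => θ ⬝ᵥ phiVec m x := by
  have hpos := integral_exp_pos (IsAEBounded.dotProduct isAEBounded_phiVec θ).exp.integrable
  rw [densityMeasure, Measure.tilted]
  refine withDensity_congr_ae ?_
  filter_upwards [ae_mem_simplex d] with x hx
  rw [expDensity, indicator_of_mem hx, Real.exp_sub, psi, Real.exp_log hpos]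

theorem meanMap_eq_expMean [NeZero (leb d)] : meanMap m = expMean (leb d) (phiVec m) := by
  funext θ p
  have hpos := integral_exp_pos (IsAEBounded.dotProduct isAEBounded_phiVec θ).exp.integrable
  rw [meanMap, expMean, integral_tilted]
  refine integral_congr_ae ?_
  filter_upwards [ae_mem_simplex d] with x hx
  rw [expDensity, indicator_of_mem hx, Real.exp_sub, psi, Real.exp_log hpos, smul_eq_mul, mul_comm]

theorem meanMap_mleParam {n : ℕ} {x : Fin n → Fin d → ℝ} (h : ∃ θ, meanMap m θ = empMean m x) :
    meanMap m (mleParam m x) = empMean m x := by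
  rw [mleParam, meanMapInv, dif_pos h]
  exact h.choose_spec

theorem mleParam_eq_zero {n : ℕ} {x : Fin n → Fin d → ℝ}
    (h : ¬ ∃ θ, meanMap m θ = empMean m x) : mleParam m x = 0 := by
  rw [mleParam, meanMapInv, dif_neg h]

end AdditiveExpSeries

/-! ### The true density: tilting, norm comparison, oscillation and bias. -/

namespace AdditiveExpSeries

/-- Integrals of nonnegative functions against a bounded tilt are comparable. -/
theorem exists_integral_tilted_comparison {E : Type*} [MeasurableSpace E] {μ : Measure E}
    [IsFiniteMeasure μ] [NeZero μ] {h : E → ℝ} (hh : IsAEBounded μ h) :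
    ∃ K : ℝ, 0 < K ∧ ∀ g : E → ℝ, IsAEBounded μ g → (∀ x, 0 ≤ g x) →
      ∫ x, g x ∂μ ≤ K * ∫ x, g x ∂(μ.tilted h) ∧ ∫ x, g x ∂(μ.tilted h) ≤ K * ∫ x, g x ∂μ := by
  have hpos := integral_exp_pos hh.exp.integrable
  set Z := ∫ x, Real.exp (h x) ∂μ with hZ
  obtain ⟨B, hB⟩ := hh.bounded
  refine ⟨Z * Real.exp B + Real.exp B / Z, by positivity, fun g hg hg0 => ?_⟩
  have hI := integral_nonneg (μ := μ) (f := g) hg0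
  have hT := integral_nonneg (μ := μ.tilted h) (f := g) hg0
  have heq : ∫ x, g x ∂(μ.tilted h) = ∫ x, Real.exp (h x) / Z * g x ∂μ := by
    rw [integral_tilted]; rfl
  have hwb : IsAEBounded μ fun x => Real.exp (h x) / Z * g x := by
    simp_rw [div_eq_inv_mul]
    exact (hh.exp.const_mul _).mul hg
  have h1 : ∫ x, g x ∂μ ≤ (Z * Real.exp B) * ∫ x, g x ∂(μ.tilted h) := by
    rw [heq, ← integral_const_mul]
    refine integral_mono_ae hg.integrable (hwb.const_mul _).integrable ?_
    filter_upwards [hB] with x hx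
    have : Z * Real.exp B * (Real.exp (h x) / Z * g x) = Real.exp (B + h x) * g x := by
      rw [Real.exp_add]; field_simp
    rw [this]
    exact le_mul_of_one_le_left (hg0 x) (Real.one_le_exp (by linarith [(abs_le.1 hx).1]))
  have h2 : ∫ x, g x ∂(μ.tilted h) ≤ (Real.exp B / Z) * ∫ x, g x ∂μ := by
    rw [heq, ← integral_const_mul]
    refine integral_mono_ae hwb.integrable (hg.const_mul _).integrable ?_
    filter_upwards [hB] with x hx
    have := hg0 x
    have := Real.exp_le_exp.2 ((le_abs_self _).trans hx)
    gcongr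
  have h3 : 0 ≤ Real.exp B / Z * ∫ x, g x ∂(μ.tilted h) := by positivity
  have h4 : 0 ≤ Z * Real.exp B * ∫ x, g x ∂μ := by positivity
  constructor <;> linarith

variable {d : ℕ}

/-- The additive function `∑ i, ℓ_i(x_i)`, with the `ℓ_i` extended by zero outside `[0,1]`. -/
noncomputable def sumLog (ℓ : Fin d → ℝ → ℝ) (x : Fin d → ℝ) : ℝ :=
  ∑ i, (Icc (0 : ℝ) 1).indicator (ℓ i) (x i)

theorem sumLog_eq (ℓ : Fin d → ℝ → ℝ) {x : Fin d → ℝ} (hx : x ∈ simplex d) :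
    sumLog ℓ x = ∑ i, ℓ i (x i) :=
  Finset.sum_congr rfl fun i _ => indicator_of_mem (hx.1 i) _

namespace IsProductForm

variable {f : (Fin d → ℝ) → ℝ} {ℓ : Fin d → ℝ → ℝ}

theorem neZero_leb (hf : IsProductForm f ℓ) : NeZero (leb d) := ⟨fun h0 => by
  have := hf.isProbDensity.lintegral_eq_one
  simp [h0] at this⟩

theorem measurable_indicator (hf : IsProductForm f ℓ) (i : Fin d) : Measurable ((Icc (0 : ℝ) 1).indicator (ℓ i)) := by
  refine measurable_of_restrict_of_restrict_compl (s := Icc (0 : ℝ) 1) measurableSet_Icc ?_ ?_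
  · convert hf.measurable i using 1
    funext t
    simp [domRestrict]
  · convert measurable_const (a := (0 : ℝ)) using 1
    funext t
    exact indicator_of_notMem t.2 _

theorem isAEBounded_indicator (hf : IsProductForm f ℓ) (i : Fin d) :
    IsAEBounded (leb d) fun x => (Icc (0 : ℝ) 1).indicator (ℓ i) (x i) := by
  obtain ⟨C, hC⟩ := hf.bounded i
  refine ⟨((hf.measurable_indicator i).comp (measurable_pi_apply i)).aemeasurable, C, ?_⟩
  filter_upwards [ae_mem_simplex d] with x hx
  rw [indicator_of_mem (hx.1 i)]
  exact hC _ (hx.1 i)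

theorem isAEBounded_sumLog (hf : IsProductForm f ℓ) : IsAEBounded (leb d) (sumLog ℓ) :=
  IsAEBounded.sum _ fun i _ => hf.isAEBounded_indicator i

theorem densityMeasure_eq (hf : IsProductForm f ℓ) : densityMeasure f = (leb d).tilted (sumLog ℓ) := by
  have := hf.neZero_leb
  have hpos := integral_exp_pos hf.isAEBounded_sumLog.exp.integrable
  have hZ : ∫ y, Real.exp (∑ i, ℓ i (y i)) ∂(leb d) = ∫ y, Real.exp (sumLog ℓ y) ∂(leb d) := by
    refine integral_congr_ae ?_
    filter_upwards [ae_mem_simplex d] with x hx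
    rw [sumLog_eq ℓ hx]
  rw [densityMeasure, Measure.tilted]
  refine withDensity_congr_ae ?_
  filter_upwards [ae_mem_simplex d, hf.eq_exp] with x hx h
  rw [h, hZ, sumLog_eq ℓ hx, Real.exp_sub, Real.exp_log hpos]

theorem isProbabilityMeasure (hf : IsProductForm f ℓ) : IsProbabilityMeasure (densityMeasure f) := by
  have := hf.neZero_leb
  rw [hf.densityMeasure_eq]
  exact isProbabilityMeasure_tilted_of_isAEBounded hf.isAEBounded_sumLog

theorem densityMeasure_ac (_hf : IsProductForm f ℓ) : densityMeasure f ≪ leb d := withDensity_absolutelyContinuous _ _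

theorem isAEBounded_sub (hf : IsProductForm f ℓ) (m : Fin d → ℕ) (θ : Idx m → ℝ) :
    IsAEBounded (leb d) fun x => θ ⬝ᵥ phiVec m x - sumLog ℓ x :=
  (IsAEBounded.dotProduct isAEBounded_phiVec θ).sub hf.isAEBounded_sumLog

/-- Both laws are tilts of Lebesgue measure, so the model law is the tilt of the true one by the
difference of the exponents. -/
theorem klDensity_eq (hf : IsProductForm f ℓ) (m : Fin d → ℕ) (θ : Idx m → ℝ) :
    klDensity f (expDensity m θ) = ENNReal.ofReal
      (tiltDiv (densityMeasure f) fun x => θ ⬝ᵥ phiVec m x - sumLog ℓ x) := by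
  have := hf.neZero_leb
  have := hf.isProbabilityMeasure
  rw [klDensity, ← klDiv_tilted_right ((hf.isAEBounded_sub m θ).mono hf.densityMeasure_ac),
    densityMeasure_expDensity_eq]
  congr 1
  conv_rhs => rw [hf.densityMeasure_eq]
  rw [tilted_tilted hf.isAEBounded_sumLog.exp.integrable]
  congr 1
  funext x
  simp

/-- The shift does not depend on θ, so likelihood minimality carries over to the functional taken
with respect to the true law. -/
theorem log_integral_exp_sub_eq (hf : IsProductForm f ℓ) (m : Fin d → ℕ) (θ : Idx m → ℝ) :
    Real.log (∫ x, Real.exp (θ ⬝ᵥ phiVec m x - sumLog ℓ x) ∂(densityMeasure f)) =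
      logPartition (leb d) (phiVec m) θ - Real.log (∫ x, Real.exp (sumLog ℓ x) ∂(leb d)) := by
  have := hf.neZero_leb
  rw [hf.densityMeasure_eq, integral_exp_tilted, Real.log_div]
  · simp [logPartition]
  · have : ∀ x, (sumLog ℓ + fun x => θ ⬝ᵥ phiVec m x - sumLog ℓ x) x = θ ⬝ᵥ phiVec m x :=
      fun x => by simp
    simp_rw [this]
    exact (integral_exp_pos (IsAEBounded.dotProduct isAEBounded_phiVec θ).exp.integrable).ne'
  · exact (integral_exp_pos hf.isAEBounded_sumLog.exp.integrable).ne'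

theorem exists_integral_comparison (hf : IsProductForm f ℓ) :
    ∃ K : ℝ, 0 < K ∧ ∀ g : (Fin d → ℝ) → ℝ, IsAEBounded (leb d) g → (∀ x, 0 ≤ g x) →
      ∫ x, g x ∂(leb d) ≤ K * ∫ x, g x ∂(densityMeasure f) ∧
        ∫ x, g x ∂(densityMeasure f) ≤ K * ∫ x, g x ∂(leb d) := by
  have := hf.neZero_leb
  rw [hf.densityMeasure_eq]
  exact exists_integral_tilted_comparison hf.isAEBounded_sumLog

theorem integral_sq_sub_pos (hf : IsProductForm f ℓ) {m : Fin d → ℕ} (hm : ∀ i, 1 ≤ m i) {u : Idx m → ℝ} (hu : u ≠ 0)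
    (c : ℝ) : 0 < ∫ x, (u ⬝ᵥ phiVec m x - c) ^ 2 ∂(densityMeasure f) := by
  obtain ⟨K, hK, h⟩ := hf.exists_integral_comparison
  by_contra! hle
  refine hu (eq_zero_of_integral_sq_sub_nonpos hm (c := c) ?_)
  refine (h _ ((IsAEBounded.dotProduct isAEBounded_phiVec u).sub (.const c)).sq
    fun _ => sq_nonneg _).1.trans ?_
  exact mul_nonpos_of_nonneg_of_nonpos hK.le hle

/-- Oscillation of the model functions in terms of their variance. -/
theorem exists_oscillation_le (hf : IsProductForm f ℓ) : ∃ C : ℝ, 0 < C ∧ ∀ m : Fin d → ℕ, (∀ i, 1 ≤ m i) →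
    ∀ u : Idx m → ℝ, ∀ᵐ x ∂(densityMeasure f),
      |u ⬝ᵥ phiVec m x - ∫ y, u ⬝ᵥ phiVec m y ∂(densityMeasure f)| ≤
        C * (∑ i, (m i : ℝ)) ^ d *
          √(∫ x, (u ⬝ᵥ phiVec m x - ∫ y, u ⬝ᵥ phiVec m y ∂(densityMeasure f)) ^ 2
            ∂(densityMeasure f)) := by
  have := hf.isProbabilityMeasure
  obtain ⟨K, hK, h⟩ := hf.exists_integral_comparison
  obtain ⟨C, hC, hosc⟩ := sq_sub_sum_eval_le d
  refine ⟨√(C * K), by positivity, fun m hm u => ?_⟩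
  have hac := hf.densityMeasure_ac
  set ν := densityMeasure f
  have hub := IsAEBounded.dotProduct isAEBounded_phiVec u
  have hubν := hub.mono hac
  set c := ∫ y, u ⬝ᵥ phiVec m y ∂ν
  set S := ∑ i, (m i : ℝ)
  have hS : 0 ≤ S := Finset.sum_nonneg fun _ _ => by positivity
  set V := ∫ x, (u ⬝ᵥ phiVec m x - c) ^ 2 ∂ν
  have hxy : ∀ x ∈ simplex d, ∀ y ∈ simplex d,
      |u ⬝ᵥ phiVec m x - u ⬝ᵥ phiVec m y| ≤ √(C * K) * S ^ d * √V := fun x hx y hy => by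
    have h1 := hosc (thetaPoly m u) m hm (natDegree_thetaPoly_le u) c x hx y hy
    simp_rw [← dotProduct_phiVec] at h1
    have h2 := (h _ (hub.sub (.const c)).sq fun _ => sq_nonneg _).1
    have h3 : √(C * K) * S ^ d * √V = √(C * S ^ (2 * d) * (K * V)) := by
      rw [show C * S ^ (2 * d) * (K * V) = (C * K) * (S ^ d) ^ 2 * V by ring,
        Real.sqrt_mul (by positivity) V, Real.sqrt_mul (by positivity) ((S ^ d) ^ 2),
        Real.sqrt_sq (by positivity)]
    rw [h3]
    refine Real.abs_le_sqrt (h1.trans ?_)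
    exact mul_le_mul_of_nonneg_left h2 (by positivity)
  have hs := hac.ae_le (ae_mem_simplex d)
  filter_upwards [hs] with x hx
  -- The deviation from the mean is an average of differences, each bounded by the oscillation.
  have h1 : u ⬝ᵥ phiVec m x - c = ∫ y, (u ⬝ᵥ phiVec m x - u ⬝ᵥ phiVec m y) ∂ν := by
    rw [integral_sub (integrable_const _) hubν.integrable]
    simp [c]
  rw [h1, ← Real.norm_eq_abs]
  have h2 := norm_integral_le_of_norm_le_const (μ := ν)
    (f := fun y => u ⬝ᵥ phiVec m x - u ⬝ᵥ phiVec m y) (C := √(C * K) * S ^ d * √V) (by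
      filter_upwards [hs] with y hy
      exact hxy x hx y hy)
  simpa using h2

theorem integral_sq_sum_sub_le (hf : IsProductForm f ℓ) (p : Fin d → Polynomial ℝ) :
    ∫ x, (∑ i, ((p i).eval (x i) - (Icc (0 : ℝ) 1).indicator (ℓ i) (x i))) ^ 2 ∂(leb d) ≤
      d * ∑ i : Fin d, ∫ t in (0 : ℝ)..1, (ℓ i t - (p i).eval t) ^ 2 *
        wt (i : ℕ) (d - 1 - (i : ℕ)) t := by
  have hpb : ∀ i, IsAEBounded (leb d) fun x =>
      (p i).eval (x i) - (Icc (0 : ℝ) 1).indicator (ℓ i) (x i) := fun i =>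
    (isAEBounded_leb_of_continuous ((p i).continuous.comp (continuous_apply i))).sub
      (hf.isAEBounded_indicator i)
  have h3 : ∫ x, (∑ i, ((p i).eval (x i) - (Icc (0 : ℝ) 1).indicator (ℓ i) (x i))) ^ 2 ∂(leb d) ≤
      d * ∑ i, ∫ x, ((p i).eval (x i) - (Icc (0 : ℝ) 1).indicator (ℓ i) (x i)) ^ 2 ∂(leb d) := by
    rw [← integral_finsetSum _ fun i _ => (hpb i).sq.integrable, ← integral_const_mul]
    refine integral_mono (IsAEBounded.sum _ fun i _ => hpb i).sq.integrable
      ((IsAEBounded.sum _ fun i _ => (hpb i).sq).const_mul _).integrable fun x => ?_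
    have := sq_sum_le_card_mul_sum_sq (s := (Finset.univ : Finset (Fin d)))
      (f := fun i => (p i).eval (x i) - (Icc (0 : ℝ) 1).indicator (ℓ i) (x i))
    simpa using this
  refine h3.trans (mul_le_mul_of_nonneg_left (Finset.sum_le_sum fun i _ => ?_) (by positivity))
  obtain ⟨B, hB⟩ := hf.bounded i
  obtain ⟨M, hM⟩ := (isCompact_Icc (a := (0 : ℝ)) (b := 1)).exists_bound_of_continuousOn
    (p i).continuous.continuousOn
  refine (integral_sq_apply_leb_le i ((p i).continuous.measurable.sub
    (hf.measurable_indicator i)) (K := M + B) fun t ht => ?_).trans (le_of_eq ?_)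
  · simp only [Pi.sub_apply, indicator_of_mem ht]
    exact (abs_sub _ _).trans (add_le_add (hM t ht) (hB t ht))
  · refine intervalIntegral.integral_congr fun t ht => ?_
    rw [uIcc_of_le zero_le_one] at ht
    simp only [Pi.sub_apply, indicator_of_mem ht]
    ring

/-- Approximation of the log-density by model functions. -/
theorem exists_approx_leb (hf : IsProductForm f ℓ) {r : Fin d → ℕ} (hr : ∀ i, d < r i)
    (hℓ : ∀ i, ℓ i ∈ sobolev (marginal d i) (r i)) :
    ∃ C : ℝ, 0 < C ∧ ∀ m : Fin d → ℕ, (∀ i, 2 * r i ≤ m i) → ∃ (θ : Idx m → ℝ) (c : ℝ),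
      (∀ᵐ x ∂(leb d), |θ ⬝ᵥ phiVec m x - sumLog ℓ x - c| ≤ C * ∑ i, (m i : ℝ)⁻¹) ∧
      ∫ x, (θ ⬝ᵥ phiVec m x - sumLog ℓ x - c) ^ 2 ∂(leb d) ≤
        C * ∑ i, ((m i : ℝ) ^ (2 * r i))⁻¹ := by
  choose A hA happ using fun i => exists_polynomial_approx i (hr i) (hℓ i)
  have hD0 : 0 ≤ ∑ i, A i := Finset.sum_nonneg fun j _ => (hA j).le
  have hAD : ∀ i, A i ≤ ∑ i, A i := fun i =>
    Finset.single_le_sum (fun j _ => (hA j).le) (Finset.mem_univ i)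
  obtain ⟨D, hD⟩ : ∃ D, D = ∑ i, A i := ⟨_, rfl⟩
  rw [← hD] at hAD hD0
  refine ⟨D + d * D + 1, by positivity, fun m hm => ?_⟩
  choose p hpdeg hp2 hpsup using fun i => happ i (m i) (hm i)
  obtain ⟨θ, c, hθ⟩ := exists_thetaPoly_add_C_eq (m := m) p hpdeg
  refine ⟨θ, -∑ i, c i, ?_⟩
  have hθe : ∀ x, θ ⬝ᵥ phiVec m x - sumLog ℓ x - (-∑ i, c i) =
      ∑ i, ((p i).eval (x i) - (Icc (0 : ℝ) 1).indicator (ℓ i) (x i)) := fun x => by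
    rw [dotProduct_phiVec, sumLog]
    simp only [hθ, Polynomial.eval_add, Polynomial.eval_C, Finset.sum_sub_distrib,
      Finset.sum_add_distrib]
    ring
  simp_rw [hθe]
  have hS1 : 0 ≤ ∑ i, (m i : ℝ)⁻¹ := Finset.sum_nonneg fun _ _ => by positivity
  have hS2 : 0 ≤ ∑ i, ((m i : ℝ) ^ (2 * r i))⁻¹ := Finset.sum_nonneg fun _ _ => by positivity
  constructor
  · have h1 : ∀ i, ∀ᵐ x ∂(leb d), |ℓ i (x i) - (p i).eval (x i)| ≤ A i / m i := fun i =>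
      ae_leb_of_ae i (hpsup i)
    filter_upwards [ae_mem_simplex d, ae_all_iff.2 h1] with x hx h2
    have h3 : |∑ i, ((p i).eval (x i) - (Icc (0 : ℝ) 1).indicator (ℓ i) (x i))| ≤
        ∑ i, D * (m i : ℝ)⁻¹ := by
      refine (Finset.abs_sum_le_sum_abs _ _).trans (Finset.sum_le_sum fun i _ => ?_)
      rw [indicator_of_mem (hx.1 i), abs_sub_comm]
      refine (h2 i).trans ?_
      rw [div_eq_mul_inv]
      exact mul_le_mul_of_nonneg_right (hAD i) (by positivity)
    rw [← Finset.mul_sum] at h3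
    refine h3.trans (mul_le_mul_of_nonneg_right ?_ hS1)
    have : 0 ≤ d * D := by positivity
    linarith
  · refine (hf.integral_sq_sum_sub_le p).trans ?_
    have h4 := Finset.sum_le_sum fun i (_ : i ∈ Finset.univ) => (hp2 i).trans
      (mul_le_mul_of_nonneg_right (hAD i) (by positivity : 0 ≤ ((m i : ℝ) ^ (2 * r i))⁻¹))
    rw [← Finset.mul_sum] at h4
    refine (mul_le_mul_of_nonneg_left h4 (by positivity : (0 : ℝ) ≤ d)).trans ?_
    rw [← mul_assoc]
    exact mul_le_mul_of_nonneg_right (by linarith) hS2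

/-- Centring at the mean under the true law instead of at c at most doubles the uniform error, and
the variance is at most the second moment about c; the change of measure costs a bounded factor. -/
theorem exists_approx (hf : IsProductForm f ℓ) {r : Fin d → ℕ} (hr : ∀ i, d < r i)
    (hℓ : ∀ i, ℓ i ∈ sobolev (marginal d i) (r i)) :
    ∃ C : ℝ, 0 < C ∧ ∀ m : Fin d → ℕ, (∀ i, 2 * r i ≤ m i) → ∃ θ : Idx m → ℝ,
      (∀ᵐ x ∂(densityMeasure f), |(θ ⬝ᵥ phiVec m x - sumLog ℓ x) -
        ∫ y, (θ ⬝ᵥ phiVec m y - sumLog ℓ y) ∂(densityMeasure f)| ≤ C * ∑ i, (m i : ℝ)⁻¹) ∧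
      ∫ x, ((θ ⬝ᵥ phiVec m x - sumLog ℓ x) -
        ∫ y, (θ ⬝ᵥ phiVec m y - sumLog ℓ y) ∂(densityMeasure f)) ^ 2 ∂(densityMeasure f) ≤
        C * ∑ i, ((m i : ℝ) ^ (2 * r i))⁻¹ := by
  have := hf.isProbabilityMeasure
  obtain ⟨K, hK, hcomp⟩ := hf.exists_integral_comparison
  obtain ⟨D, hD, happ⟩ := hf.exists_approx_leb hr hℓ
  refine ⟨2 * D + K * D, by positivity, fun m hm => ?_⟩
  obtain ⟨θ, c, hsup, hsq⟩ := happ m hm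
  refine ⟨θ, ?_⟩
  have heb : IsAEBounded (leb d) fun x => θ ⬝ᵥ phiVec m x - sumLog ℓ x - c :=
    (hf.isAEBounded_sub m θ).sub (.const c)
  have h2 := (hcomp _ heb.sq fun _ => sq_nonneg _).2
  have hS1 : 0 ≤ ∑ i, (m i : ℝ)⁻¹ := Finset.sum_nonneg fun _ _ => by positivity
  have hS2 : 0 ≤ ∑ i, ((m i : ℝ) ^ (2 * r i))⁻¹ := Finset.sum_nonneg fun _ _ => by positivity
  have hac := hf.densityMeasure_ac
  have hebν := heb.mono hac
  generalize densityMeasure f = ν at *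
  have hint : ∫ y, (θ ⬝ᵥ phiVec m y - sumLog ℓ y - c) ∂ν =
      ∫ y, (θ ⬝ᵥ phiVec m y - sumLog ℓ y) ∂ν - c := by
    rw [integral_sub ((hf.isAEBounded_sub m θ).mono hac).integrable (integrable_const _)]
    simp
  have hcen : ∀ x, (θ ⬝ᵥ phiVec m x - sumLog ℓ x) - ∫ y, (θ ⬝ᵥ phiVec m y - sumLog ℓ y) ∂ν =
      (θ ⬝ᵥ phiVec m x - sumLog ℓ x - c) - ∫ y, (θ ⬝ᵥ phiVec m y - sumLog ℓ y - c) ∂ν :=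
    fun x => by rw [hint]; ring
  simp_rw [hcen]
  constructor
  · have hsupν := hac.ae_le hsup
    have h3 : |∫ y, (θ ⬝ᵥ phiVec m y - sumLog ℓ y - c) ∂ν| ≤ D * ∑ i, (m i : ℝ)⁻¹ := by
      have := norm_integral_le_of_norm_le_const (μ := ν)
        (f := fun y => θ ⬝ᵥ phiVec m y - sumLog ℓ y - c) hsupν
      simpa using this
    filter_upwards [hsupν] with x hx
    refine (abs_sub _ _).trans ((add_le_add hx h3).trans ?_)
    have : 0 ≤ (K * D) * ∑ i, (m i : ℝ)⁻¹ := by positivity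
    linarith
  · have h := variance_le_expectation_sq (μ := ν) hebν.aemeasurable.aestronglyMeasurable
    rw [variance_eq_integral hebν.aemeasurable] at h
    refine h.trans (h2.trans ((mul_le_mul_of_nonneg_left hsq hK.le).trans ?_))
    rw [← mul_assoc]
    exact mul_le_mul_of_nonneg_right (by linarith) hS2

end IsProductForm

end AdditiveExpSeries

/-! ### Rate on the event of solvability. -/

namespace AdditiveExpSeries

variable {Ω : Type*} [MeasurableSpace Ω] {P : Measure Ω} [IsProbabilityMeasure P] {d : ℕ}
  {f : (Fin d → ℝ) → ℝ} {ℓ : Fin d → ℝ → ℝ} {r : Fin d → ℕ} {X : ℕ → Ω → Fin d → ℝ}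
  {m : ℕ → Fin d → ℕ}

theorem card_idx (m : Fin d → ℕ) : (Fintype.card (Idx m) : ℝ) = ∑ i, (m i : ℝ) := by
  simp

theorem log_integral_sub_le_of_meanMap_eq (hf : IsProductForm f ℓ) {m : Fin d → ℕ}
    {θ α : Idx m → ℝ} (h : meanMap m θ = α) (θ' : Idx m → ℝ) :
    Real.log (∫ x, Real.exp (θ ⬝ᵥ phiVec m x - sumLog ℓ x) ∂(densityMeasure f)) - θ ⬝ᵥ α ≤
      Real.log (∫ x, Real.exp (θ' ⬝ᵥ phiVec m x - sumLog ℓ x) ∂(densityMeasure f)) - θ' ⬝ᵥ α := by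
  have := hf.neZero_leb
  rw [meanMap_eq_expMean] at h
  have := logPartition_sub_le isAEBounded_phiVec h θ'
  rw [hf.log_integral_exp_sub_eq, hf.log_integral_exp_sub_eq]
  linarith

/-- The rate of the maximum likelihood estimator, on the event where the likelihood equations
are solvable. -/
theorem exists_rate (hf : IsProductForm f ℓ) (hd : d ≠ 0) (hr : ∀ i, d < r i)
    (hℓ : ∀ i, ℓ i ∈ sobolev (marginal d i) (r i))
    (hX : ∀ j, HasLaw (X j) (densityMeasure f) P) (hindep : iIndepFun X P)
    (hm_pos : ∀ n, 1 ≤ n → ∀ i, 1 ≤ m n i)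
    (hm_top : ∀ i, Tendsto (fun n => m n i) atTop atTop)
    (hm_bias : Tendsto
      (fun n => (∑ i, (m n i : ℝ)) ^ (2 * d) * ∑ i, ((m n i : ℝ) ^ (2 * r i))⁻¹) atTop (𝓝 0))
    (hm_var : Tendsto (fun n : ℕ => (∑ i, (m n i : ℝ)) ^ (2 * d + 1) / (n : ℝ)) atTop (𝓝 0)) :
    ∃ A : ℝ, 0 < A ∧ ∀ c : ℝ, 0 < c → ∀ᶠ n : ℕ in atTop,
      P {ω | (∃ θ : Idx (m n) → ℝ, meanMap (m n) θ = empMean (m n) (fun j : Fin n => X j ω)) ∧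
        ENNReal.ofReal (A * (1 + c) *
          ((∑ i, ((m n i : ℝ) ^ (2 * r i))⁻¹) + (∑ i, (m n i : ℝ)) / (n : ℝ))) <
        klDensity f (mleDensity (m n) (fun j : Fin n => X j ω))} ≤ ENNReal.ofReal (1 / c) := by
  have := hf.isProbabilityMeasure
  obtain ⟨C₀, hC₀, hosc⟩ := hf.exists_oscillation_le
  obtain ⟨C₁, hC₁, happ⟩ := hf.exists_approx hr hℓ
  refine ⟨2000 * (C₁ + 1), by positivity, fun c hc => ?_⟩
  have hinv : Tendsto (fun n => C₁ * ∑ i, (m n i : ℝ)⁻¹) atTop (𝓝 0) := by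
    have : Tendsto (fun n => ∑ i, (m n i : ℝ)⁻¹) atTop (𝓝 (∑ _i : Fin d, (0 : ℝ))) :=
      tendsto_finsetSum _ fun i _ =>
        tendsto_inv_atTop_zero.comp (tendsto_natCast_atTop_atTop.comp (hm_top i))
    simpa using this.const_mul C₁
  -- This is an upper bound for B²(δ + ζ)² with B = C₀S^d, δ² = C₁T and ζ² = cS/n; the threshold
  -- 1/1600 = (1/40)² below is the smallness 20B(δ + ζ) ≤ 1/2.
  have hsm : Tendsto (fun n : ℕ => 2 * C₀ ^ 2 *
      (C₁ * ((∑ i, (m n i : ℝ)) ^ (2 * d) * ∑ i, ((m n i : ℝ) ^ (2 * r i))⁻¹) +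
        c * ((∑ i, (m n i : ℝ)) ^ (2 * d + 1) / (n : ℝ)))) atTop (𝓝 0) := by
    simpa using ((hm_bias.const_mul C₁).add (hm_var.const_mul c)).const_mul (2 * C₀ ^ 2)
  have hlarge : ∀ᶠ n in atTop, ∀ i, 2 * r i ≤ m n i :=
    eventually_all.2 fun i => (hm_top i).eventually_ge_atTop _
  filter_upwards [eventually_ge_atTop 1, hlarge,
    hinv.eventually (eventually_le_nhds (show (0 : ℝ) < 1 / 2 by norm_num)),
    hsm.eventually (eventually_le_nhds (show (0 : ℝ) < 1 / 1600 by norm_num))]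
    with n hn hmn hinvn hsmn
  obtain ⟨θb, hb1, hb2⟩ := happ (m n) hmn
  set S := ∑ i, (m n i : ℝ) with hS
  set T := ∑ i, ((m n i : ℝ) ^ (2 * r i))⁻¹ with hT
  have hn0 : (0 : ℝ) < n := by exact_mod_cast hn
  have hne : (Finset.univ : Finset (Fin d)).Nonempty := ⟨⟨0, Nat.pos_of_ne_zero hd⟩, by simp⟩
  have hmpos : ∀ i, (0 : ℝ) < m n i := fun i => by exact_mod_cast hm_pos n hn i
  have hS0 : 0 < S := Finset.sum_pos (fun i _ => hmpos i) hne
  have hT0 : 0 < T := Finset.sum_pos (fun i _ => inv_pos.2 (pow_pos (hmpos i) _)) hne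
  have hdev := measure_exists_deviation_le hX hindep
    (fun p => (continuous_phiVec (m := m n) p).measurable)
    (fun p => (isAEBounded_phiVec p).mono hf.densityMeasure_ac)
    (fun u hu => hf.integral_sq_sub_pos (hm_pos n hn) hu _) hn hc
  refine (measure_mono ?_).trans hdev
  rintro ω ⟨hex, hlt⟩ hsto
  refine absurd hlt (not_lt.2 ?_)
  rw [mleDensity, hf.klDensity_eq]
  refine ENNReal.ofReal_le_ofReal ?_
  rw [card_idx, ← hS] at hsto
  have hδ2 : √(C₁ * T) ^ 2 = C₁ * T := Real.sq_sqrt (by positivity)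
  have hζ2 : √(c * S / n) ^ 2 = c * S / n := Real.sq_sqrt (by positivity)
  refine (tiltDiv_minimiser_le (B := C₀ * S ^ d) (δ := √(C₁ * T)) (ζ := √(c * S / n))
    (α := empMean (m n) fun j : Fin n => X j ω) (θb := θb)
    (fun p => (isAEBounded_phiVec p).mono hf.densityMeasure_ac)
    (hf.isAEBounded_sumLog.mono hf.densityMeasure_ac) (by positivity)
    (Real.sqrt_pos.2 (by positivity)) (Real.sqrt_nonneg _)
    (log_integral_sub_le_of_meanMap_eq hf (meanMap_mleParam hex) θb)
    (hb1.mono fun x hx => hx.trans hinvn) (hb2.trans_eq hδ2.symm) (hosc (m n) (hm_pos n hn))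
    hsto ?_).trans ?_
  · have h1 : (C₀ * S ^ d * (√(C₁ * T) + √(c * S / n))) ^ 2 ≤ (1 / 40) ^ 2 := by
      have h2 : (√(C₁ * T) + √(c * S / n)) ^ 2 ≤ 2 * (C₁ * T + c * S / n) := by
        have := add_sq_le (a := √(C₁ * T)) (b := √(c * S / n))
        rwa [hδ2, hζ2] at this
      calc _ = (C₀ * S ^ d) ^ 2 * (√(C₁ * T) + √(c * S / n)) ^ 2 := mul_pow _ _ _
        _ ≤ (C₀ * S ^ d) ^ 2 * (2 * (C₁ * T + c * S / n)) := by gcongr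
        _ = 2 * C₀ ^ 2 * (C₁ * (S ^ (2 * d) * T) + c * (S ^ (2 * d + 1) / n)) := by ring
        _ ≤ _ := hsmn.trans (by norm_num)
    have h3 := (abs_le_of_sq_le_sq' h1 (by norm_num)).2
    linarith
  · rw [hδ2, hζ2]
    have h1 : 0 ≤ S / n := by positivity
    have h2 : 2000 * (C₁ + 1) * (1 + c) * (T + S / n) - 2000 * (C₁ * T + c * S / n) =
      2000 * ((C₁ * c + 1 + c) * T + (C₁ + C₁ * c + 1) * (S / n)) := by ring
    have h3 : 0 ≤ 2000 * ((C₁ * c + 1 + c) * T + (C₁ + C₁ * c + 1) * (S / n)) := by positivity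
    linarith

end AdditiveExpSeries

/-! ### Unique solvability of the likelihood equations. -/

namespace AdditiveExpSeries

variable {d : ℕ}

theorem convex_simplex (d : ℕ) : Convex ℝ (simplex d) := by
  intro x hx y hy a b ha hb hab
  refine ⟨fun i => (convex_Icc (0 : ℝ) 1) (hx.1 i) (hy.1 i) ha hb hab, fun i j hij => ?_⟩
  simp only [Pi.add_apply, Pi.smul_apply, smul_eq_mul]
  have := hx.2 hij
  have := hy.2 hij
  gcongr

/-- The simplex is convex, and the frontier of a convex set is null. -/
theorem ae_mem_interior_simplex (d : ℕ) : ∀ᵐ x ∂(leb d), x ∈ interior (simplex d) := by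
  have h : ∀ᵐ x ∂(leb d), x ∉ frontier (simplex d) := by
    refine ae_restrict_of_ae ?_
    exact measure_eq_zero_iff_ae_notMem.1 ((convex_simplex d).addHaar_frontier volume)
  filter_upwards [h, ae_mem_simplex d] with x h1 h2
  by_contra h3
  exact h1 ⟨subset_closure h2, h3⟩

/-- A continuous function bounded above almost everywhere on the simplex is bounded above on the
interior. -/
theorem le_of_ae_leb_le {g : (Fin d → ℝ) → ℝ} (hg : Continuous g) {c : ℝ}
    (h : ∀ᵐ x ∂(leb d), g x ≤ c) {x : Fin d → ℝ} (hx : x ∈ interior (simplex d)) : g x ≤ c := by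
  by_contra! hlt
  have ho : IsOpen ({y | c < g y} ∩ interior (simplex d)) :=
    (isOpen_lt continuous_const hg).inter isOpen_interior
  have h0 : volume ({y | c < g y} ∩ interior (simplex d)) = 0 := by
    rw [leb, ae_iff, Measure.restrict_apply₀'
      (measurableSet_simplex d).nullMeasurableSet] at h
    refine measure_mono_null (inter_subset_inter ?_ interior_subset) h
    exact fun y hy => not_le.2 hy
  exact (ho.eq_empty_of_measure_zero h0).subset ⟨hlt, hx⟩

theorem isLocalMax_eval_of_sum {p : Fin d → Polynomial ℝ} {x : Fin d → ℝ}
    (h : IsLocalMax (fun y : Fin d → ℝ => ∑ i, (p i).eval (y i)) x) (i : Fin d) :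
    IsLocalMax (fun t => (p i).eval t) (x i) := by
  have hc : Tendsto (fun t => Function.update x i t) (𝓝 (x i)) (𝓝 x) := by
    have : Continuous fun t => Function.update x i t := continuous_const.update i continuous_id
    simpa using this.tendsto (x i)
  filter_upwards [hc.eventually h] with t ht
  have h1 : ∀ k ∈ ({i}ᶜ : Finset (Fin d)), (p k).eval (Function.update x i t k) =
      (p k).eval (x k) := fun k hk => by
    rw [Function.update_of_ne (by simpa using hk)]
  rw [Fintype.sum_eq_add_sum_compl i, Fintype.sum_eq_add_sum_compl i,
    Finset.sum_congr rfl h1, Function.update_self] at ht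
  exact le_of_add_le_add_right ht

open Polynomial in
/-- The likelihood equations are uniquely solvable for a sample in general position. -/
theorem existsUnique_meanMap_eq [NeZero (leb d)] {m : Fin d → ℕ} (hm : ∀ i, 1 ≤ m i) {n : ℕ}
    (hn : 1 ≤ n) (hmn : ∀ i, m i ≤ n) {x : Fin n → Fin d → ℝ}
    (hx : ∀ j, x j ∈ interior (simplex d)) (hinj : ∀ i, Function.Injective fun j => x j i) :
    ∃! θ : Idx m → ℝ, meanMap m θ = empMean m x := by
  rw [meanMap_eq_expMean]
  have hn0 : (0 : ℝ) < n := by exact_mod_cast hn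
  obtain ⟨θ, hθ⟩ := exists_expMean_eq (μ := leb d) (Φ := phiVec m) isAEBounded_phiVec
    (empMean m x) fun u hu hle => by
    refine hu ?_
    have hgc : Continuous fun y => u ⬝ᵥ phiVec m y :=
      continuous_finsetSum _ fun p _ => continuous_const.mul (continuous_phiVec p)
    have hint : ∀ y ∈ interior (simplex d), u ⬝ᵥ phiVec m y ≤ u ⬝ᵥ empMean m x :=
      fun y hy => le_of_ae_leb_le hgc hle hy
    have hsum : ∑ j, (u ⬝ᵥ empMean m x - u ⬝ᵥ phiVec m (x j)) = 0 := by
      rw [Finset.sum_sub_distrib, Finset.sum_const, Finset.card_univ, Fintype.card_fin, empMean,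
        dotProduct_smul, dotProduct_sum, nsmul_eq_mul, smul_eq_mul]
      field_simp
      simp
    -- The mean of the values at the observations is also their upper bound, so each observation
    -- attains it.
    have hmax : ∀ j, u ⬝ᵥ empMean m x = u ⬝ᵥ phiVec m (x j) := fun j => by
      have := (Finset.sum_eq_zero_iff_of_nonneg fun j _ =>
        sub_nonneg.2 (hint _ (hx j))).1 hsum j (Finset.mem_univ j)
      linarith
    -- Each observation is an interior maximum, hence a critical point in every coordinate: the
    -- derivative, of degree at most m_i - 1 < n, has n distinct roots.
    have hder : ∀ i, derivative (thetaPoly m u i) = 0 := fun i => by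
      refine eq_zero_of_natDegree_lt_card_of_eval_eq_zero _ (hinj i) (fun j => ?_) ?_
      · have hloc : IsLocalMax (fun y : Fin d → ℝ => ∑ i, (thetaPoly m u i).eval (y i)) (x j) := by
          filter_upwards [isOpen_interior.mem_nhds (hx j)] with y hy
          simp only [← dotProduct_phiVec]
          rw [← hmax j]
          exact hint y hy
        exact (isLocalMax_eval_of_sum hloc i).hasDerivAt_eq_zero
          ((thetaPoly m u i).hasDerivAt (x j i))
      · rw [Fintype.card_fin, natDegree_derivative]
        have := natDegree_thetaPoly_le u i
        have := hm i
        have := hmn i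
        omega
    exact eq_zero_of_thetaPoly_eq_C fun i =>
      eq_C_of_natDegree_eq_zero (derivative_eq_zero.1 (hder i))
  refine ⟨θ, hθ, fun θ' hθ' => ?_⟩
  exact expMean_injective isAEBounded_phiVec (eq_zero_of_dotProduct_phiVec_ae_eq hm)
    (hθ'.trans hθ.symm)

/-- Under the product of the two laws every section of the diagonal is a single point, which has no
mass. -/
theorem ae_ne_of_indepFun {Ω : Type*} [MeasurableSpace Ω] {P : Measure Ω} [IsProbabilityMeasure P]
    {Y Z : Ω → ℝ} (hY : AEMeasurable Y P) (hZ : AEMeasurable Z P) (h : IndepFun Y Z P)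
    (hatom : ∀ t, P.map Z {t} = 0) : ∀ᵐ ω ∂P, Y ω ≠ Z ω := by
  have := Measure.isProbabilityMeasure_map hY
  have := Measure.isProbabilityMeasure_map hZ
  have hprod := (indepFun_iff_map_prod_eq_prod_map_map hY hZ).1 h
  have hd : ((P.map Y).prod (P.map Z)) (diagonal ℝ) = 0 := by
    rw [Measure.measure_prod_null measurableSet_diagonal]
    refine ae_of_all _ fun t => ?_
    refine Eq.trans (congrArg _ ?_) (hatom t)
    ext s
    simp [eq_comm]
  rw [← hprod] at hd
  have := ae_of_ae_map (hY.prodMk hZ) (measure_eq_zero_iff_ae_notMem.1 hd)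
  exact this

theorem ae_sample_general_position {Ω : Type*} [MeasurableSpace Ω] {P : Measure Ω}
    [IsProbabilityMeasure P] {f : (Fin d → ℝ) → ℝ} {ℓ : Fin d → ℝ → ℝ} (hf : IsProductForm f ℓ)
    {X : ℕ → Ω → Fin d → ℝ} (hX : ∀ j, HasLaw (X j) (densityMeasure f) P)
    (hindep : iIndepFun X P) :
    ∀ᵐ ω ∂P, (∀ j, X j ω ∈ interior (simplex d)) ∧
      ∀ i, Function.Injective fun j => X j ω i := by
  have h1 : ∀ j, ∀ᵐ ω ∂P, X j ω ∈ interior (simplex d) := fun j => by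
    refine ae_of_ae_map (hX j).aemeasurable ?_
    rw [(hX j).map_eq]
    exact hf.densityMeasure_ac.ae_le (ae_mem_interior_simplex d)
  have h2 : ∀ i j k, j ≠ k → ∀ᵐ ω ∂P, X j ω i ≠ X k ω i := fun i j k hjk => by
    have hc := (hindep.indepFun hjk).comp (measurable_pi_apply i) (measurable_pi_apply i)
    refine ae_ne_of_indepFun ((measurable_pi_apply i).comp_aemeasurable (hX j).aemeasurable)
      ((measurable_pi_apply i).comp_aemeasurable (hX k).aemeasurable) hc fun t => ?_
    change P.map ((fun x : Fin d → ℝ => x i) ∘ X k) {t} = 0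
    rw [← AEMeasurable.map_map_of_aemeasurable (measurable_pi_apply i).aemeasurable
      (hX k).aemeasurable, (hX k).map_eq, Measure.map_apply (measurable_pi_apply i)
      (measurableSet_singleton t)]
    refine hf.densityMeasure_ac ?_
    have := ae_leb_of_ae i (Q := fun s => s ≠ t)
      (ae_restrict_of_ae (measure_eq_zero_iff_ae_notMem.1 (measure_singleton t)))
    exact measure_eq_zero_iff_ae_notMem.2 this
  filter_upwards [ae_all_iff.2 h1, ae_all_iff.2 fun i => ae_all_iff.2 fun j => ae_all_iff.2 fun k =>
    eventually_imp_distrib_left.2 (h2 i j k)] with ω hω1 hω2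
  refine ⟨hω1, fun i j k hjk => ?_⟩
  by_contra hne
  exact hω2 i j k hne hjk

end AdditiveExpSeries

/-! ### Tightness of the divergence at a fixed sample size. -/

namespace AdditiveExpSeries

variable {Ω : Type*} [MeasurableSpace Ω] {P : Measure Ω} [IsProbabilityMeasure P] {d : ℕ}
  {f : (Fin d → ℝ) → ℝ} {ℓ : Fin d → ℝ → ℝ} {r : Fin d → ℕ} {X : ℕ → Ω → Fin d → ℝ}

theorem exists_klDensity_expDensity_le (hf : IsProductForm f ℓ) (m : Fin d → ℕ) (R : ℝ) :
    ∃ C : ℝ, 0 < C ∧ ∀ θ : Idx m → ℝ, ‖θ‖ ≤ R →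
      klDensity f (expDensity m θ) ≤ ENNReal.ofReal C := by
  have := hf.isProbabilityMeasure
  choose B hB using fun p => (isAEBounded_phiVec (m := m) p).bounded
  obtain ⟨A, hA⟩ := hf.isAEBounded_sumLog.bounded
  refine ⟨|2 * (∑ p, R * B p + A)| + 1, by positivity, fun θ hθ => ?_⟩
  rw [hf.klDensity_eq]
  refine ENNReal.ofReal_le_ofReal ?_
  refine (tiltDiv_le_of_abs_le ((hf.isAEBounded_sub m θ).mono hf.densityMeasure_ac)
    (B := ∑ p, R * B p + A) ?_).trans (by linarith [le_abs_self (2 * (∑ p, R * B p + A))])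
  refine hf.densityMeasure_ac.ae_le ?_
  filter_upwards [ae_all_iff.2 hB, hA] with x h1 h2
  refine (abs_sub _ _).trans (add_le_add ?_ h2)
  refine (Finset.abs_sum_le_sum_abs _ _).trans (Finset.sum_le_sum fun p _ => ?_)
  rw [abs_mul]
  exact mul_le_mul ((norm_le_pi_norm θ p).trans hθ) (h1 p) (abs_nonneg _)
    ((norm_nonneg θ).trans hθ)

/-- For a fixed sample size the divergence of the estimator is a tight random variable. -/
theorem exists_measure_klDensity_lt (hf : IsProductForm f ℓ)
    (hX : ∀ j, HasLaw (X j) (densityMeasure f) P) {m : Fin d → ℕ} (hm : ∀ i, 1 ≤ m i) (n : ℕ)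
    {ε : ℝ} (hε : 0 < ε) :
    ∃ C : ℝ, 0 < C ∧ P {ω | ENNReal.ofReal C <
      klDensity f (mleDensity m (fun j : Fin n => X j ω))} < ENNReal.ofReal ε := by
  have := hf.neZero_leb
  set α : Ω → Idx m → ℝ := fun ω => empMean m (fun j : Fin n => X j ω) with hα
  have hαm : AEMeasurable α P := by
    refine aemeasurable_pi_lambda _ fun p => ?_
    simp only [hα, empMean, Pi.smul_apply, Finset.sum_apply, smul_eq_mul]
    have hj : ∀ j : Fin n, AEMeasurable (fun ω => phiVec m (X j ω) p) P := fun j =>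
      (continuous_phiVec p).measurable.comp_aemeasurable (hX j).aemeasurable
    exact (Finset.aemeasurable_fun_sum Finset.univ fun j _ => hj j).const_mul _
  have hinj : Function.Injective (meanMap m) := by
    rw [meanMap_eq_expMean]
    exact expMean_injective isAEBounded_phiVec (eq_zero_of_dotProduct_phiVec_ae_eq hm)
  have hcont : Continuous (meanMap m) := by
    rw [meanMap_eq_expMean]
    exact continuous_expMean isAEBounded_phiVec
  have hball : ∀ k : ℕ, MeasurableSet (meanMap m '' Metric.closedBall 0 (k : ℝ)) := fun k =>
    ((isCompact_closedBall 0 (k : ℝ)).image hcont).measurableSet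
  have hrange : range (meanMap m) = ⋃ k : ℕ, meanMap m '' Metric.closedBall 0 (k : ℝ) := by
    rw [← image_iUnion, Metric.iUnion_closedBall_nat, image_univ]
  -- A large parameter norm is expressed through the empirical mean, using compact images of balls;
  -- measurability of the estimator itself is not needed. The sets decrease to ∅, and outside the
  -- range the convention θ = 0 gives norm 0.
  set B : ℕ → Set (Idx m → ℝ) := fun k =>
    range (meanMap m) \ meanMap m '' Metric.closedBall 0 (k : ℝ) with hB
  have hBm : ∀ k, MeasurableSet (B k) := fun k => by
    refine MeasurableSet.diff ?_ (hball k)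
    rw [hrange]
    exact MeasurableSet.iUnion hball
  have hBanti : Antitone B := fun k l hkl => sdiff_subset_sdiff_right
    (image_mono (Metric.closedBall_subset_closedBall (by exact_mod_cast hkl)))
  have hBempty : ⋂ k, B k = ∅ := by
    rw [← sdiff_iUnion, ← hrange, sdiff_self]
  have := Measure.isProbabilityMeasure_map hαm
  have hlim := tendsto_measure_iInter_atTop (μ := P.map α)
    (fun k => (hBm k).nullMeasurableSet) hBanti ⟨0, measure_ne_top _ _⟩
  rw [hBempty, measure_empty] at hlim
  obtain ⟨k, hk⟩ := (hlim.eventually (eventually_lt_nhds (ENNReal.ofReal_pos.2 hε))).exists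
  obtain ⟨C, hC, hCle⟩ := exists_klDensity_expDensity_le hf m k
  refine ⟨C, hC, lt_of_le_of_lt ?_ hk⟩
  rw [Function.comp_apply, Measure.map_apply_of_aemeasurable hαm (hBm k)]
  refine measure_mono fun ω hω => ?_
  have hnorm : (k : ℝ) < ‖mleParam m (fun j : Fin n => X j ω)‖ := by
    by_contra! hle
    exact absurd hω (not_lt.2 (hCle _ hle))
  have hex : ∃ θ, meanMap m θ = empMean m (fun j : Fin n => X j ω) := by
    by_contra hex
    rw [mleParam_eq_zero hex, norm_zero] at hnorm
    exact absurd hnorm (not_lt.2 k.cast_nonneg)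
  have hs := meanMap_mleParam hex
  refine ⟨⟨_, hs⟩, ?_⟩
  rintro ⟨θ, hθ, hθα⟩
  rw [hinj (hθα.trans hs.symm)] at hθ
  rw [mem_closedBall_zero_iff] at hθ
  exact absurd hnorm (not_lt.2 hθ)

end AdditiveExpSeries
-- The main theorem.
theorem mainTheorem1 {Ω : Type*} [MeasurableSpace Ω] (P : Measure Ω) [IsProbabilityMeasure P]
    (d : ℕ) (hd : 2 ≤ d)
    (f : (Fin d → ℝ) → ℝ) (ℓ : Fin d → ℝ → ℝ) (hf : IsProductForm f ℓ)
    (r : Fin d → ℕ) (hr : ∀ i, d < r i) (hℓ : ∀ i, ℓ i ∈ sobolev (marginal d i) (r i))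
    -- the sample: the first `n` observations are `X 0, ..., X (n - 1)`
    (X : ℕ → Ω → Fin d → ℝ) (hX : ∀ j, HasLaw (X j) (densityMeasure f) P)
    (hindep : iIndepFun X P)
    (m : ℕ → Fin d → ℕ) (hm_pos : ∀ n, 1 ≤ n → ∀ i, 1 ≤ m n i)
    (hm_top : ∀ i, Tendsto (fun n => m n i) atTop atTop)
    (hm_bias : Tendsto
      (fun n => (∑ i, (m n i : ℝ)) ^ (2 * d) * ∑ i, ((m n i : ℝ) ^ (2 * r i))⁻¹) atTop (𝓝 0))
    (hm_var : Tendsto (fun n : ℕ => (∑ i, (m n i : ℝ)) ^ (2 * d + 1) / (n : ℝ)) atTop (𝓝 0)) :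
    -- the estimator is well defined: for every large `n`, almost surely, the likelihood
    -- equations have exactly one solution
    (∀ᶠ n : ℕ in atTop, ∀ᵐ ω ∂P,
      ∃! θ : Idx (m n) → ℝ, meanMap (m n) θ = empMean (m n) (fun j : Fin n => X j ω)) ∧
    -- the divergence converges to zero in probability
    (∀ ε : ℝ, 0 < ε → Tendsto (fun n : ℕ =>
      P {ω | ENNReal.ofReal ε < klDensity f (mleDensity (m n) (fun j : Fin n => X j ω))})
      atTop (𝓝 0)) ∧
    -- with the stated rate
    IsBigOInProbability P
      (fun n ω => klDensity f (mleDensity (m n) (fun j : Fin n => X j ω)))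
      (fun n => (∑ i, ((m n i : ℝ) ^ (2 * r i))⁻¹) + (∑ i, (m n i : ℝ)) / (n : ℝ)) := by
  have hd0 : d ≠ 0 := by omega
  have := hf.neZero_leb
  set S : ℕ → ℝ := fun n => ∑ i, (m n i : ℝ) with hS
  set T : ℕ → ℝ := fun n => ∑ i, ((m n i : ℝ) ^ (2 * r i))⁻¹ with hT
  have hmS : ∀ n i, (m n i : ℝ) ≤ S n := fun n i =>
    Finset.single_le_sum (f := fun i => (m n i : ℝ)) (fun _ _ => by positivity) (Finset.mem_univ i)
  have hmpos : ∀ n, 1 ≤ n → ∀ i, (1 : ℝ) ≤ m n i := fun n hn i => by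
    exact_mod_cast hm_pos n hn i
  have hS1 : ∀ n, 1 ≤ n → 1 ≤ S n := fun n hn =>
    (hmpos n hn ⟨0, by omega⟩).trans (hmS n _)
  have hT0 : ∀ n, 0 ≤ T n := fun n => Finset.sum_nonneg fun _ _ => by positivity
  have ha_pos : ∀ n, 1 ≤ n → 0 < T n + S n / n := fun n hn => by
    have h1 : (0 : ℝ) < n := by exact_mod_cast hn
    have h2 := hS1 n hn
    have h3 := hT0 n
    positivity
  have hsolve : ∀ᶠ n : ℕ in atTop, ∀ᵐ ω ∂P,
      ∃! θ : Idx (m n) → ℝ, meanMap (m n) θ = empMean (m n) (fun j : Fin n => X j ω) := by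
    filter_upwards [eventually_ge_atTop 1,
      hm_var.eventually (eventually_le_nhds zero_lt_one)] with n hn hle
    have hn0 : (0 : ℝ) < n := by exact_mod_cast hn
    rw [div_le_one hn0] at hle
    -- From S ≥ 1 and S^(2d+1) ≤ n.
    have hmn : ∀ i, m n i ≤ n := fun i => by
      have := (hmS n i).trans ((le_self_pow₀ (hS1 n hn) (by omega)).trans hle)
      exact_mod_cast this
    filter_upwards [ae_sample_general_position hf hX hindep] with ω hω
    exact existsUnique_meanMap_eq (hm_pos n hn) hn hmn (fun j => hω.1 j)
      fun i j k hjk => Fin.ext (hω.2 i hjk)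
  obtain ⟨A, hA, hrate⟩ := exists_rate hf hd0 hr hℓ hX hindep hm_pos hm_top hm_bias hm_var
  have hrate' : ∀ c : ℝ, 0 < c → ∀ᶠ n : ℕ in atTop,
      P {ω | ENNReal.ofReal (A * (1 + c) * (T n + S n / n)) <
        klDensity f (mleDensity (m n) (fun j : Fin n => X j ω))} ≤ ENNReal.ofReal (1 / c) := by
    intro c hc
    filter_upwards [hsolve, hrate c hc] with n h1 h2
    refine le_trans (measure_mono_ae ?_) h2
    filter_upwards [h1] with ω hω hlt
    exact ⟨hω.exists, hlt⟩
  refine ⟨hsolve, fun ε hε => ?_, fun ε hε => ?_⟩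
  · have ha : Tendsto (fun n : ℕ => T n + S n / n) atTop (𝓝 0) := by
      have hsum := hm_bias.add hm_var
      rw [add_zero] at hsum
      refine tendsto_of_tendsto_of_tendsto_of_le_of_le' tendsto_const_nhds hsum ?_ ?_
      · filter_upwards [eventually_ge_atTop 1] with n hn using (ha_pos n hn).le
      · filter_upwards [eventually_ge_atTop 1] with n hn
        -- Since S ≥ 1 the rate is dominated by the two quantities assumed to vanish, so convergence
        -- in probability follows from the rate.
        have h1 : T n ≤ S n ^ (2 * d) * T n :=
          le_mul_of_one_le_left (hT0 n) (one_le_pow₀ (hS1 n hn))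
        have h2 : S n / n ≤ S n ^ (2 * d + 1) / n :=
          div_le_div_of_nonneg_right (le_self_pow₀ (hS1 n hn) (by omega)) n.cast_nonneg
        exact add_le_add h1 h2
    rw [ENNReal.tendsto_nhds_zero]
    intro η hη
    obtain ⟨c, hc, hcη⟩ : ∃ c : ℝ, 0 < c ∧ ENNReal.ofReal (1 / c) ≤ η := by
      rcases eq_or_ne η ⊤ with rfl | hη'
      · exact ⟨1, one_pos, le_top⟩
      · have := ENNReal.toReal_pos hη.ne' hη'
        exact ⟨1 / η.toReal, by positivity, by rw [one_div_one_div, ENNReal.ofReal_toReal hη']⟩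
    have hAa : Tendsto (fun n : ℕ => A * (1 + c) * (T n + S n / n)) atTop (𝓝 0) := by
      simpa using ha.const_mul (A * (1 + c))
    filter_upwards [hrate' c hc, hAa.eventually (eventually_le_nhds hε)] with n h1 h2
    refine le_trans (measure_mono fun ω hω => ?_) (h1.trans hcη)
    exact lt_of_le_of_lt (ENNReal.ofReal_le_ofReal h2) hω
  · have hlt : ∀ {n : ℕ}, 1 ≤ n → ∀ {C : ℝ}, 0 < C → ∀ {Y : ℝ≥0∞},
        ENNReal.ofReal C < Y / ENNReal.ofReal (T n + S n / n) →
        ENNReal.ofReal (C * (T n + S n / n)) < Y := by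
      intro n hn C hC Y h
      rw [ENNReal.ofReal_mul hC.le]
      exact (ENNReal.lt_div_iff_mul_lt (Or.inl (ENNReal.ofReal_pos.2 (ha_pos n hn)).ne')
        (Or.inl ENNReal.ofReal_ne_top)).1 h
    -- With c = 2/ε the exceptional probability is at most ε/2, strictly below ε. The n < N are
    -- covered by tightness, whose normalised constants are summed into the final one.
    obtain ⟨N, hN⟩ := eventually_atTop.1 (hrate' (2 / ε) (by positivity))
    have htight := fun n : ℕ => fun hn : 1 ≤ n =>
      exists_measure_klDensity_lt hf hX (hm_pos n hn) n hε
    choose! K hK0 hK using htight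
    have hsum0 : 0 ≤ ∑ n ∈ Finset.range N, |K n / (T n + S n / n)| :=
      Finset.sum_nonneg fun _ _ => abs_nonneg _
    have hA1 : 0 < A * (1 + 2 / ε) := by positivity
    refine ⟨A * (1 + 2 / ε) + ∑ n ∈ Finset.range N, |K n / (T n + S n / n)|, by positivity,
      fun n hn => ?_⟩
    rcases le_or_gt N n with hNn | hnN
    · refine lt_of_le_of_lt (measure_mono fun ω hω => ?_) (lt_of_le_of_lt (hN n hNn) ?_)
      · refine lt_of_le_of_lt (ENNReal.ofReal_le_ofReal ?_) (hlt hn (by positivity) hω)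
        exact mul_le_mul_of_nonneg_right (by linarith) (ha_pos n hn).le
      · rw [one_div_div]
        exact (ENNReal.ofReal_lt_ofReal_iff hε).2 (by linarith)
    · refine lt_of_le_of_lt (measure_mono fun ω hω => ?_) (hK n hn)
      refine lt_of_le_of_lt (ENNReal.ofReal_le_ofReal ?_) (hlt hn (by positivity) hω)
      have h1 : |K n / (T n + S n / n)| ≤ ∑ n ∈ Finset.range N, |K n / (T n + S n / n)| :=
        Finset.single_le_sum (f := fun n : ℕ => |K n / (T n + S n / n)|)
          (fun _ _ => abs_nonneg _) (Finset.mem_range.2 hnN)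
      have h2 := le_abs_self (K n / (T n + S n / n))
      rw [← div_le_iff₀ (ha_pos n hn)]
      linarith
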